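/- Let $\Bbbk$ be a commutative ring. For a graded $\Bbbk$-quiver $\mathcal A$ let $s\mathcal A=\mathcal A[1]$ be its suspension, $(s\mathcal A)^d=\mathcal A^{d+1}$, and let $Ts\mathcal A=\bigoplus_{n\ge0}T^ns\mathcal A$ be the tensor quiver with the cut comultiplication $\Delta$. Maps are written on the right, $\mathrm{pr}_1:Ts\mathcal A\to s\mathcal A$ is the projection onto $T^1s\mathcal A$, the $n$-th component of a map $a:Ts\mathcal A\to Ts\mathcal C$ is $a_n=a|_{T^ns\mathcal A}\,\mathrm{pr}_1$, and the Koszul sign rule $(x\otimes y)(a\otimes c)=(-1)^{\deg y\cdot\deg a}\,xa\otimes yc$ is used. An $A_\infty$-category is a graded quiver $\mathcal A$ with a coderivation $b:Ts\mathcal A\to Ts\mathcal A$ of degree $1$ such that $b^2=0$ and $b_0=0$; an $A_\infty$-functor $f:\mathcal B\to\mathcal C$ is a graded cocategory homomorphism $f:Ts\mathcal B\to Ts\mathcal C$ with $f_0=0$ and $fb=bf$; a natural $A_\infty$-transformation $r:f\to g:\mathcal B\to\mathcal C$ is an $(f,g)$-coderivation $r:Ts\mathcal B\to Ts\mathcal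 C$ of degree $-1$ (that is, $r\Delta=\Delta(f\otimes r+r\otimes g)$) such that $rb+br=0$. In the 2-category $A_\infty$, two natural $A_\infty$-transformations $r,r':f\to g$ represent the same 2-morphism if and only if $r-r'=vb-bv$ for some $(f,g)$-coderivation $v$ of degree $-2$, and the composite of $f\xrightarrow{\,r\,}g\xrightarrow{\,p\,}h$ is represented by the $(f,h)$-coderivation $(r\otimes p)B_2$ with components $$[(r\otimes p)B_2]_n=\sum (f_{a_1}\otimes\dots\otimes f_{a_\alpha}\otimes r_j\otimes g_{c_1}\otimes\dots\otimes g_{c_\beta}\otimes p_t\otimes h_{e_1}\otimes\dots\otimes h_{e_\gamma})\,b_{\alpha+\beta+\gamma+2},$$ where the sum is over $\alpha,\beta,\gamma\ge0$, $j,t\ge 0$, and positive integers $a_i,c_i,e_i$ with $a_1+\dots+a_\alpha+j+c_1+\dots+c_\beta+t+e_1+\dots+e_\gamma=n$. **Proposition.** Let $\mathcal B,\mathcal C$ be $A_\infty$-categories, let $f:\mathcal B\to\mathcal C$ be an $A_\infty$-functor, let $g:\mathrm{Ob}\,\mathcal B\to\mathrm{Ob}\,\mathcal C$ be a map, and for each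 object $X$ of $\mathcal B$ let $r_X\in\mathcal C^0(Xf,Xg)$ be an element with $r_Xs\,b_1=0$. Assume that for all objects $X,Y$ of $\mathcal B$, all $n\ge0$ and all objects $X_0,\dots,X_n$ of $\mathcal B$, with $N=s\mathcal B(X_0,X_1)\otimes_\Bbbk\dots\otimes_\Bbbk s\mathcal B(X_{n-1},X_n)$ (so $N=\Bbbk$ for $n=0$), the chain map $$\mathrm{Hom}(N,(r_Xs\otimes1)b_2):\mathrm{Hom}^\bullet_\Bbbk(N,s\mathcal C(Xg,Yg))\to\mathrm{Hom}^\bullet_\Bbbk(N,s\mathcal C(Xf,Yg)),$$ induced by $(r_Xs\otimes1)b_2:x\mapsto(-1)^{\deg x}(r_Xs\otimes x)b_2$, is a quasi-isomorphism. Let $g,g':\mathcal B\to\mathcal C$ be two $A_\infty$-functors whose underlying map on objects is the given map $g$, and let $r:f\to g$ and $r':f\to g'$ be natural $A_\infty$-transformations whose $0$-th components are both the given maps $\Bbbk\to(s\mathcal C)^{-1}(Xf,Xg)$, $1\mapsto r_Xs$. Then there exists a natural $A_\infty$-transformation $p:g\to g':\mathcal B\to\mathcal C$ such that $r'$ equals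 the composite $(f\xrightarrow{\,r\,}g\xrightarrow{\,p\,}g')$ in the 2-category $A_\infty$. -/

import Mathlib

open scoped TensorProduct DirectSum

universe u

namespace AInf

/-! ### Graded quivers and suspension -/

/-- A `ℤ`-graded `k`-linear quiver with set of objects `S`: a graded `k`-module `Hom X Y` for every
pair of objects.  The homogeneous component of degree `d` is the submodule `gr X Y d`. -/
structure GradedQuiver (k : Type u) [CommRing k] (S : Type u) where
  Hom : S → S → Type u
  [addCommGroup : ∀ X Y, AddCommGroup (Hom X Y)]
  [module : ∀ X Y, Module k (Hom X Y)]
  gr : ∀ X Y, ℤ → Submodule k (Hom X Y)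
  internal : ∀ X Y, DirectSum.IsInternal (gr X Y)

attribute [instance] GradedQuiver.addCommGroup GradedQuiver.module

/-- Shifting the indexing of a direct sum decomposition gives a direct sum decomposition. -/
theorem isInternal_shift {k : Type u} [CommRing k] {M : Type u} [AddCommGroup M] [Module k M]
    {A : ℤ → Submodule k M} (h : DirectSum.IsInternal A) :
    DirectSum.IsInternal (fun d => A (d + 1)) := by
  rw [DirectSum.isInternal_submodule_iff_iSupIndep_and_iSup_eq_top] at h ⊢
  refine ⟨h.1.comp (add_left_injective (1 : ℤ)), ?_⟩
  rw [← h.2]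
  exact (Equiv.addRight (1 : ℤ)).iSup_comp (g := A)

/-- The suspension `sQ = Q[1]`: the same modules, with the grading `(sQ)^d = Q^{d+1}`.
The shift map `s` is the identity on underlying modules. -/
def GradedQuiver.susp {k : Type u} [CommRing k] {S : Type u} (Q : GradedQuiver k S) :
    GradedQuiver k S where
  Hom := Q.Hom
  gr X Y d := Q.gr X Y (d + 1)
  internal X Y := isInternal_shift (Q.internal X Y)

/-- The shift map `s : Q → sQ` of degree `-1`, the identity of the underlying modules. -/
def GradedQuiver.shift {k : Type u} [CommRing k] {S : Type u} (Q : GradedQuiver k S) (X Y : S) :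
    Q.Hom X Y ≃ₗ[k] Q.susp.Hom X Y :=
  LinearEquiv.refl k (Q.Hom X Y)

section Tensor

variable {k : Type u} [CommRing k] {S : Type u} (Q : GradedQuiver k S)

theorem GradedQuiver.bijective (X Y : S) :
    Function.Bijective (DirectSum.coeLinearMap (Q.gr X Y)) :=
  Q.internal X Y

/-- The linear map which multiplies every homogeneous element `x` by `(-1) ^ (d * deg x)`; this is
the Koszul sign which arises when an operation of degree `d` moves past `x`. -/
noncomputable def GradedQuiver.sgn (d : ℤ) (X Y : S) : Q.Hom X Y →ₗ[k] Q.Hom X Y :=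
  DirectSum.coeLinearMap (Q.gr X Y) ∘ₗ
    DirectSum.lmap (fun i => ((d * i).negOnePow : ℤ) • LinearMap.id) ∘ₗ
    (LinearEquiv.ofBijective (DirectSum.coeLinearMap (Q.gr X Y)) (Q.bijective X Y)).symm.toLinearMap

/-! ### The tensor quiver `TQ` -/

/-- Finite sequences of objects `X = X₀, X₁, …, Xₙ = Y` with `n ≥ 0`. -/
inductive ObjPath (S : Type u) : S → S → Type u
  | nil (X : S) : ObjPath S X X
  | cons (X : S) {Z Y : S} (p : ObjPath S Z Y) : ObjPath S X Y

/-- For `p = (X₀, …, Xₙ)`, the module `Q(X₀, X₁) ⊗ Q(X₁, X₂) ⊗ ⋯ ⊗ Q(Xₙ₋₁, Xₙ)`, bracketed to the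
right and ending with the unit `k`; it is `k` for `n = 0`. -/
noncomputable def PathMod : ∀ {X Y : S}, ObjPath S X Y → ModuleCat.{u} k
  | _, _, .nil _ => ModuleCat.of k k
  | _, _, .cons (Z := Z) X p => ModuleCat.of k (Q.Hom X Z ⊗[k] PathMod p)

/-- The module of the sequence of length `0` is `k`. -/
noncomputable def PathMod.nilEquiv (X : S) : PathMod Q (.nil X) ≃ₗ[k] k := LinearEquiv.refl k k

/-- The module of `(X, Z, …, Y)` is the tensor product of `Q(X, Z)` and the module of `(Z, …, Y)`. -/
noncomputable def PathMod.consEquiv (X : S) {Z Y : S} (p : ObjPath S Z Y) :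
    PathMod Q (.cons X p) ≃ₗ[k] Q.Hom X Z ⊗[k] PathMod Q p :=
  LinearEquiv.refl k (Q.Hom X Z ⊗[k] PathMod Q p)

/-- The homogeneous component of degree `d` of a tensor product of graded modules. -/
noncomputable def PathMod.gr : ∀ {X Y : S} (p : ObjPath S X Y), ℤ → Submodule k (PathMod Q p)
  | _, _, .nil _, d => if d = 0 then ⊤ else ⊥
  | _, _, .cons (Z := Z) X p, d =>
      (⨆ i : ℤ, Submodule.map₂ (TensorProduct.mk k (Q.Hom X Z) (PathMod Q p))
        (Q.gr X Z i) (PathMod.gr p (d - i))).comap (PathMod.consEquiv Q X p).toLinearMap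

/-- Koszul signs on tensor products: `t ↦ (-1) ^ (d * deg t) t`. -/
noncomputable def PathMod.sgn (d : ℤ) :
    ∀ {X Y : S} (p : ObjPath S X Y), PathMod Q p →ₗ[k] PathMod Q p
  | _, _, .nil _ => LinearMap.id
  | _, _, .cons (Z := Z) X p =>
      (PathMod.consEquiv Q X p).symm.toLinearMap ∘ₗ
        TensorProduct.map (Q.sgn d X Z) (PathMod.sgn d p) ∘ₗ
        (PathMod.consEquiv Q X p).toLinearMap

/-- `TQ(X, Y) = ⨁ₙ TⁿQ(X, Y)`: the direct sum of `Q(X₀, X₁) ⊗ ⋯ ⊗ Q(Xₙ₋₁, Xₙ)` over all sequences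
with `X₀ = X`, `Xₙ = Y` and `n ≥ 0`. -/
abbrev T (X Y : S) : Type u := ⨁ p : ObjPath S X Y, PathMod Q p

/-- The homogeneous component of degree `d` of `TQ(X, Y)`. -/
def T.gr (X Y : S) (d : ℤ) : Submodule k (T Q X Y) where
  carrier := {t | ∀ p, t p ∈ PathMod.gr Q p d}
  add_mem' ha hb p := by
    rw [DirectSum.add_apply]
    exact Submodule.add_mem _ (ha p) (hb p)
  zero_mem' p := by
    rw [DirectSum.zero_apply]
    exact Submodule.zero_mem _
  smul_mem' c t ht p := by
    rw [DirectSum.smul_apply]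
    exact Submodule.smul_mem _ c (ht p)

/-- Koszul signs on `TQ(X, Y)`. -/
noncomputable def T.sgn (d : ℤ) (X Y : S) : T Q X Y →ₗ[k] T Q X Y :=
  DirectSum.lmap (fun p => PathMod.sgn Q d p)

open Classical in
/-- The inclusion of the summand indexed by the sequence `p`. -/
noncomputable def T.of {X Y : S} (p : ObjPath S X Y) : PathMod Q p →ₗ[k] T Q X Y :=
  DirectSum.lof k (ObjPath S X Y) (fun p => PathMod Q p) p

open Classical in
/-- The linear map out of `TQ(X, Y)` with given restrictions to the summands. -/
noncomputable def T.desc {X Y : S} {M : Type u} [AddCommMonoid M] [Module k M]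
    (φ : ∀ p : ObjPath S X Y, PathMod Q p →ₗ[k] M) : T Q X Y →ₗ[k] M :=
  DirectSum.toModule k (ObjPath S X Y) M φ

/-- The element `1_X` of `T⁰Q(X, X) = k`. -/
noncomputable def T.one (X : S) : T Q X X := T.of Q (.nil X) ((PathMod.nilEquiv Q X).symm 1)

/-- Prepending a factor: `x ↦ (t ↦ x ⊗ t)`. -/
noncomputable def T.cons (X Z Y : S) : Q.Hom X Z →ₗ[k] T Q Z Y →ₗ[k] T Q X Y :=
  (T.desc Q fun p : ObjPath S Z Y =>
    ((TensorProduct.mk k (Q.Hom X Z) (PathMod Q p)).compr₂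
      (T.of Q (.cons X p) ∘ₗ (PathMod.consEquiv Q X p).symm.toLinearMap)).flip).flip

/-- The inclusion of `T¹Q(X, Y) = Q(X, Y)`. -/
noncomputable def T.in1 (X Y : S) : Q.Hom X Y →ₗ[k] T Q X Y :=
  (T.cons Q X Y Y).flip (T.one Q Y)

/-- The inclusion of `Q(X, Z) ⊗ Q(Z, Y)` into `T²Q(X, Y)`, as a bilinear map. -/
noncomputable def T.in2 (X Z Y : S) : Q.Hom X Z →ₗ[k] Q.Hom Z Y →ₗ[k] T Q X Y :=
  (T.cons Q X Z Y).compl₂ (T.in1 Q Z Y)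

/-- The projection `pr₁ : TQ(X, Y) → T¹Q(X, Y) = Q(X, Y)`. -/
noncomputable def T.pr1 (X Y : S) : T Q X Y →ₗ[k] Q.Hom X Y :=
  (TensorProduct.rid k (Q.Hom X Y)).toLinearMap ∘ₗ
    TensorProduct.map LinearMap.id (PathMod.nilEquiv Q Y).toLinearMap ∘ₗ
    (PathMod.consEquiv Q X (.nil Y)).toLinearMap ∘ₗ
    DirectSum.component k (ObjPath S X Y) (fun p => PathMod Q p) (.cons X (.nil Y))

/-- The counit on one summand: the identity of `k` for `n = 0`, and zero for `n > 0`. -/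
noncomputable def PathMod.counit : ∀ {X Y : S} (p : ObjPath S X Y), PathMod Q p →ₗ[k] k
  | _, _, .nil X => (PathMod.nilEquiv Q X).toLinearMap
  | _, _, .cons _ _ => 0

/-- The counit `ε = pr₀ : TQ → T⁰Q` (whose value at `(X, Y)` is zero unless `X = Y`). -/
noncomputable def T.counit (X Y : S) : T Q X Y →ₗ[k] k := T.desc Q fun p => PathMod.counit Q p

/-- Concatenation with an element of one summand. -/
noncomputable def PathMod.mul (Y : S) :
    ∀ {X Z : S} (p : ObjPath S X Z), PathMod Q p →ₗ[k] T Q Z Y →ₗ[k] T Q X Y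
  | _, _, .nil X =>
      (LinearMap.lsmul k (T Q X Y) : k →ₗ[k] T Q X Y →ₗ[k] T Q X Y) ∘ₗ
        (PathMod.nilEquiv Q X).toLinearMap
  | _, Z, .cons (Z := W) X p =>
      TensorProduct.lift ((LinearMap.llcomp k (T Q Z Y) (T Q W Y) (T Q X Y)).compl₁₂
        (T.cons Q X W Y) (PathMod.mul Y p)) ∘ₗ (PathMod.consEquiv Q X p).toLinearMap

/-- Concatenation (the multiplication of the tensor algebra)
`TQ(X, Z) ⊗ TQ(Z, Y) → TQ(X, Y)`. -/
noncomputable def T.mul (X Z Y : S) : T Q X Z ⊗[k] T Q Z Y →ₗ[k] T Q X Y :=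
  TensorProduct.lift (T.desc Q fun p => PathMod.mul Q Y p)

/-! ### The cut comultiplication -/

/-- The tensor square of the quiver `TQ`: `(TQ ⊗ TQ)(X, Y) = ⨁_Z TQ(X, Z) ⊗ TQ(Z, Y)`. -/
abbrev TT (X Y : S) : Type u := ⨁ Z : S, (T Q X Z ⊗[k] T Q Z Y)

open Classical in
/-- The inclusion of the summand of `TQ ⊗ TQ` indexed by `Z`. -/
noncomputable def TT.of (X Y Z : S) : T Q X Z ⊗[k] T Q Z Y →ₗ[k] TT Q X Y :=
  DirectSum.lof k S (fun Z => T Q X Z ⊗[k] T Q Z Y) Z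

open Classical in
/-- The linear map out of `(TQ ⊗ TQ)(X, Y)` with given restrictions to the summands. -/
noncomputable def TT.desc {X Y : S} {M : Type u} [AddCommMonoid M] [Module k M]
    (φ : ∀ Z : S, T Q X Z ⊗[k] T Q Z Y →ₗ[k] M) : TT Q X Y →ₗ[k] M :=
  DirectSum.toModule k S M φ

/-- Prepending a factor to the first tensor factor: `x ↦ (t ⊗ t' ↦ (x ⊗ t) ⊗ t')`. -/
noncomputable def TT.cons (X Z Y : S) : Q.Hom X Z →ₗ[k] TT Q Z Y →ₗ[k] TT Q X Y :=
  (TT.desc Q fun W =>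
    ((LinearMap.rTensorHom (T Q W Y) ∘ₗ T.cons Q X Z W).compr₂ (TT.of Q X Y W)).flip).flip

/-- The cut comultiplication on one summand, determined by `Δ(1) = 1 ⊗ 1` and
`Δ(x ⊗ t) = 1 ⊗ (x ⊗ t) + x · Δ(t)`, where `x · -` prepends `x` to the first tensor factor; thus
`Δ(h₁ ⊗ ⋯ ⊗ hₙ) = ∑ₖ (h₁ ⊗ ⋯ ⊗ hₖ) ⊗ (hₖ₊₁ ⊗ ⋯ ⊗ hₙ)`, with `0 ≤ k ≤ n`. -/
noncomputable def PathMod.comul : ∀ {X Y : S} (p : ObjPath S X Y), PathMod Q p →ₗ[k] TT Q X Y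
  | _, _, .nil X =>
      LinearMap.toSpanSingleton k (TT Q X X) (TT.of Q X X X (T.one Q X ⊗ₜ[k] T.one Q X)) ∘ₗ
        (PathMod.nilEquiv Q X).toLinearMap
  | _, Y, .cons (Z := Z) X p =>
      TT.of Q X Y X ∘ₗ TensorProduct.mk k (T Q X X) (T Q X Y) (T.one Q X) ∘ₗ T.of Q (.cons X p) +
        TensorProduct.lift ((TT.cons Q X Z Y).compl₂ (PathMod.comul p)) ∘ₗ
          (PathMod.consEquiv Q X p).toLinearMap

/-- The cut comultiplication `Δ : TQ → TQ ⊗ TQ`. -/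
noncomputable def T.comul (X Y : S) : T Q X Y →ₗ[k] TT Q X Y := T.desc Q fun p => PathMod.comul Q p

end Tensor

/-! ### Maps between tensor quivers -/

section Maps

variable {k : Type u} [CommRing k] {S S' : Type u} {Q : GradedQuiver k S} {R : GradedQuiver k S'}

variable (Q R) in
/-- Families of `k`-linear maps `TQ(X, Y) → TR(Xφ, Yγ)`. -/
abbrev TMap (φ γ : S → S') : Type u := ∀ X Y : S, T Q X Y →ₗ[k] T R (φ X) (γ Y)

variable (Q) in
/-- The identity maps of `TQ`. -/
noncomputable def TMap.one : TMap Q Q (fun X => X) (fun X => X) := fun _ _ => LinearMap.id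

/-- The family `a` is homogeneous of degree `d`. -/
def TMap.HasDegree {φ γ : S → S'} (a : TMap Q R φ γ) (d : ℤ) : Prop :=
  ∀ X Y i, ∀ t ∈ T.gr Q X Y i, a X Y t ∈ T.gr R (φ X) (γ Y) (i + d)

/-- The tensor product `a ⊗ c : TQ ⊗ TQ → TR ⊗ TR`, where `a` has degree `d`, with the Koszul sign of
right operators: `(x ⊗ y)(a ⊗ c) = (-1) ^ (deg y * d) xa ⊗ yc`. -/
noncomputable def TMap.tensor {φ γ χ : S → S'} (d : ℤ) (a : TMap Q R φ γ) (c : TMap Q R γ χ)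
    (X Y : S) : TT Q X Y →ₗ[k] TT R (φ X) (χ Y) :=
  TT.desc Q fun Z => TT.of R (φ X) (χ Y) (γ Z) ∘ₗ
    TensorProduct.map (a X Z) (c Z Y ∘ₗ T.sgn Q d Z Y)

/-- The convolution `Δ · (a ⊗ c) · (concatenation)`, where `a` has degree `d`: its value on
`h₁ ⊗ ⋯ ⊗ hₙ` is `∑ₖ (h₁ ⊗ ⋯ ⊗ hₖ)a ⊗ (hₖ₊₁ ⊗ ⋯ ⊗ hₙ)c` with Koszul signs. -/
noncomputable def TMap.conv {φ γ χ : S → S'} (d : ℤ) (a : TMap Q R φ γ) (c : TMap Q R γ χ) :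
    TMap Q R φ χ := fun X Y =>
  TT.desc R (fun W => T.mul R (φ X) W (χ Y)) ∘ₗ TMap.tensor d a c X Y ∘ₗ T.comul Q X Y

/-- The composite of `a` with `pr₁ : TR → T¹R ⊆ TR`: it retains precisely the components
`aₙ = a|_{TⁿQ} pr₁ : TⁿQ → R` of `a`. -/
noncomputable def TMap.comp1 {φ γ : S → S'} (a : TMap Q R φ γ) : TMap Q R φ γ := fun X Y =>
  T.in1 R (φ X) (γ Y) ∘ₗ T.pr1 R (φ X) (γ Y) ∘ₗ a X Y

/-- `a : TQ → TR` is a homomorphism of (graded, counital) cocategories. -/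
structure IsCocategoryHom {φ : S → S'} (a : TMap Q R φ φ) : Prop where
  degree : a.HasDegree 0
  comul : ∀ X Y, T.comul R (φ X) (φ Y) ∘ₗ a X Y = TMap.tensor 0 a a X Y ∘ₗ T.comul Q X Y
  counit : ∀ X Y, T.counit R (φ X) (φ Y) ∘ₗ a X Y = T.counit Q X Y

/-- `r : TQ → TR` is an `(f, g)`-coderivation of degree `d`: `rΔ = Δ(f ⊗ r + r ⊗ g)`. -/
structure IsCoderivation {φ γ : S → S'} (f : TMap Q R φ φ) (g : TMap Q R γ γ) (d : ℤ)
    (r : TMap Q R φ γ) : Prop where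
  degree : r.HasDegree d
  comul : ∀ X Y, T.comul R (φ X) (γ Y) ∘ₗ r X Y =
    (TMap.tensor 0 f r X Y + TMap.tensor d r g X Y) ∘ₗ T.comul Q X Y

end Maps

/-! ### `A_∞`-categories, functors and transformations -/

/-- An `A_∞`-category with set of objects `S`: a graded quiver `C` and a codifferential
`b : TsC → TsC`, that is, a coderivation of degree `1` with `b² = 0` and `b₀ = 0`. -/
structure AInfCategory (k : Type u) [CommRing k] (S : Type u) where
  quiver : GradedQuiver k S
  b : TMap quiver.susp quiver.susp (fun X => X) (fun X => X)
  isCoderivation : IsCoderivation (TMap.one quiver.susp) (TMap.one quiver.susp) 1 b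
  b_zero : ∀ X, T.pr1 quiver.susp X X (b X X (T.one quiver.susp X)) = 0
  b_sq : ∀ X Y, b X Y ∘ₗ b X Y = 0

section

variable {k : Type u} [CommRing k] {S S' : Type u}

/-- The suspended quiver `sC`. -/
abbrev AInfCategory.s (C : AInfCategory k S) : GradedQuiver k S := C.quiver.susp

/-- The component `b₁ : sC(X, Y) → sC(X, Y)`. -/
noncomputable def AInfCategory.b1 (C : AInfCategory k S) (X Y : S) :
    C.s.Hom X Y →ₗ[k] C.s.Hom X Y :=
  T.pr1 C.s X Y ∘ₗ C.b X Y ∘ₗ T.in1 C.s X Y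

/-- The component `b₂`, as a bilinear map `(x, y) ↦ (x ⊗ y)b₂`. -/
noncomputable def AInfCategory.b2 (C : AInfCategory k S) (X Z Y : S) :
    C.s.Hom X Z →ₗ[k] C.s.Hom Z Y →ₗ[k] C.s.Hom X Y :=
  (T.in2 C.s X Z Y).compr₂ (T.pr1 C.s X Y ∘ₗ C.b X Y)

/-- An `A_∞`-functor `B → C` with underlying map of objects `φ`: a cocategory homomorphism
`f : TsB → TsC` with `f₀ = 0` and `fb = bf`. -/
structure AInfFunctor (B : AInfCategory k S) (C : AInfCategory k S') (φ : S → S') where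
  map : TMap B.s C.s φ φ
  isCocategoryHom : IsCocategoryHom map
  map_zero : ∀ X, T.pr1 C.s (φ X) (φ X) (map X X (T.one B.s X)) = 0
  map_b : ∀ X Y, C.b (φ X) (φ Y) ∘ₗ map X Y = map X Y ∘ₗ B.b X Y

variable {B : AInfCategory k S} {C : AInfCategory k S'}

/-- An `A_∞`-transformation `f → g : B → C` of degree `d`: an `(f, g)`-coderivation. -/
structure AInfTransformation {φ γ : S → S'} (f : AInfFunctor B C φ) (g : AInfFunctor B C γ)
    (d : ℤ) where
  map : TMap B.s C.s φ γ
  isCoderivation : IsCoderivation f.map g.map d map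

/-- The `0`-th component of an `A_∞`-transformation, `k → sC(Xf, Xg)`, evaluated at `1`. -/
noncomputable def AInfTransformation.zeroComponent {φ γ : S → S'} {f : AInfFunctor B C φ}
    {g : AInfFunctor B C γ} {d : ℤ} (r : AInfTransformation f g d) (X : S) :
    C.s.Hom (φ X) (γ X) :=
  T.pr1 C.s (φ X) (γ X) (r.map X X (T.one B.s X))

/-- A natural `A_∞`-transformation `r : f → g : B → C`: an `(f, g)`-coderivation of degree `-1`
such that `rb + br = 0`. -/
structure NatTransformation {φ γ : S → S'} (f : AInfFunctor B C φ) (g : AInfFunctor B C γ)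
    extends AInfTransformation f g (-1) where
  natural : ∀ X Y, C.b (φ X) (γ Y) ∘ₗ map X Y + map X Y ∘ₗ B.b X Y = 0

/-- Equivalence of natural `A_∞`-transformations `f → g : B → C`: `r - r' = [v, b] = vb - bv` for an
`(f, g)`-coderivation `v` of degree `-2`.  The 2-morphisms `f → g` of the 2-category `A_∞` are the
equivalence classes, so this is equality of the 2-morphisms represented by `r` and `r'`. -/
def Equivalent {φ γ : S → S'} (f : AInfFunctor B C φ) (g : AInfFunctor B C γ)
    (r r' : TMap B.s C.s φ γ) : Prop :=
  ∃ v : AInfTransformation f g (-2), ∀ X Y,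
    r X Y - r' X Y = C.b (φ X) (γ Y) ∘ₗ v.map X Y - v.map X Y ∘ₗ B.b X Y

variable {φ γ χ : S → S'} {f : AInfFunctor B C φ} {g : AInfFunctor B C γ} {h : AInfFunctor B C χ}

/-- The map `θ = (r ⊗ p)θ : TsB → TsC`,
`θ = ∑ f_{a_1} ⊗ ⋯ ⊗ f_{a_α} ⊗ r_j ⊗ g_{c_1} ⊗ ⋯ ⊗ g_{c_β} ⊗ p_t ⊗ h_{e_1} ⊗ ⋯ ⊗ h_{e_γ}`,
for coderivations `f --r--> g --p--> h`. -/
noncomputable def theta {d e : ℤ} (r : AInfTransformation f g d) (p : AInfTransformation g h e) :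
    TMap B.s C.s φ χ :=
  TMap.conv 0 f.map (TMap.conv d r.map.comp1 (TMap.conv 0 g.map (TMap.conv e p.map.comp1 h.map)))

/-- The `(f, h)`-coderivation of degree `d` with components `aₙ`,
`∑ f_{i_1} ⊗ ⋯ ⊗ f_{i_q} ⊗ aₙ ⊗ h_{j_1} ⊗ ⋯ ⊗ h_{j_t}`. -/
noncomputable def coderivationOf (f : AInfFunctor B C φ) (h : AInfFunctor B C χ) (d : ℤ)
    (a : TMap B.s C.s φ χ) : TMap B.s C.s φ χ :=
  TMap.conv 0 f.map (TMap.conv d a.comp1 h.map)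

/-- `(r ⊗ p)B₂`: the `(f, h)`-coderivation with components `[(r ⊗ p)B₂]ₙ = ∑ₗ (r ⊗ p)θₙₗ bₗ`. -/
noncomputable def B2 {d e : ℤ} (r : AInfTransformation f g d) (p : AInfTransformation g h e) :
    TMap B.s C.s φ χ :=
  coderivationOf f h (d + e + 1) fun X Y => C.b (φ X) (χ Y) ∘ₗ theta r p X Y

/-- The composite `f --r--> g --p--> h` of natural `A_∞`-transformations in the 2-category `A_∞` is
represented by `(r ⊗ p)B₂`. -/
noncomputable def NatTransformation.comp (r : NatTransformation f g) (p : NatTransformation g h) :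
    TMap B.s C.s φ χ :=
  B2 r.toAInfTransformation p.toAInfTransformation

end

/-! ### The quasi-isomorphism assumption -/

section Assumption

variable {k : Type u} [CommRing k] {S S' : Type u}

/-- The differential `∑ 1^{⊗q} ⊗ b₁ ⊗ 1^{⊗t}` of the complex `sB(X₀, X₁) ⊗ ⋯ ⊗ sB(Xₙ₋₁, Xₙ)`. -/
noncomputable def PathMod.diff (B : AInfCategory k S) :
    ∀ {X Y : S} (p : ObjPath S X Y), PathMod B.s p →ₗ[k] PathMod B.s p
  | _, _, .nil _ => 0
  | _, _, .cons (Z := Z) X p =>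
      (PathMod.consEquiv B.s X p).symm.toLinearMap ∘ₗ
        (TensorProduct.map (B.b1 X Z) (PathMod.sgn B.s 1 p) +
          TensorProduct.map LinearMap.id (PathMod.diff B p)) ∘ₗ
        (PathMod.consEquiv B.s X p).toLinearMap

/-- The module `Homⁱ(N, sC(X, Y))` of `k`-linear maps of degree `i`, where
`N = sB(X₀, X₁) ⊗ ⋯ ⊗ sB(Xₙ₋₁, Xₙ)`. -/
def homDeg (B : AInfCategory k S) (C : AInfCategory k S') {X₀ Xₙ : S} (p : ObjPath S X₀ Xₙ)
    (X Y : S') (i : ℤ) : Submodule k (PathMod B.s p →ₗ[k] C.s.Hom X Y) where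
  carrier := {a | ∀ j, ∀ t ∈ PathMod.gr B.s p j, a t ∈ C.s.gr X Y (j + i)}
  add_mem' ha hb j t ht := Submodule.add_mem _ (ha j t ht) (hb j t ht)
  zero_mem' _ _ _ := Submodule.zero_mem _
  smul_mem' c _ ha j t ht := Submodule.smul_mem _ c (ha j t ht)

/-- The differential of the complex `Hom(N, sC(X, Y))` in degree `i`:
`a ↦ a b₁ - (-1)ⁱ d_N a` (composition written from left to right). -/
noncomputable def homDiff (B : AInfCategory k S) (C : AInfCategory k S') {X₀ Xₙ : S}
    (p : ObjPath S X₀ Xₙ) (X Y : S') (i : ℤ) (a : PathMod B.s p →ₗ[k] C.s.Hom X Y) :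
    PathMod B.s p →ₗ[k] C.s.Hom X Y :=
  C.b1 X Y ∘ₗ a - ((i.negOnePow : ℤˣ) : ℤ) • (a ∘ₗ PathMod.diff B p)

/-- The map `(ρ ⊗ 1)b₂ : sC(X', Y) → sC(X, Y)`, `x ↦ (-1) ^ (deg x) (ρ ⊗ x)b₂`, for an element
`ρ ∈ sC(X, X')` of degree `-1`. -/
noncomputable def leftMul (C : AInfCategory k S') {X X' : S'} (ρ : C.s.Hom X X') (Y : S') :
    C.s.Hom X' Y →ₗ[k] C.s.Hom X Y :=
  C.b2 X X' Y ρ ∘ₗ C.s.sgn 1 X' Y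

/-- The chain map `u = Hom(N, w) : Hom(N, sC(X', Y)) → Hom(N, sC(X, Y))`, where
`N = sB(X₀, X₁) ⊗ ⋯ ⊗ sB(Xₙ₋₁, Xₙ)` and `w : sC(X', Y) → sC(X, Y)` is a chain map, is a
quasi-isomorphism: in every degree `i` the induced map of cohomology is surjective and injective. -/
def HomQuasiIso (B : AInfCategory k S) (C : AInfCategory k S') {X₀ Xₙ : S} (p : ObjPath S X₀ Xₙ)
    {X X' Y : S'} (w : C.s.Hom X' Y →ₗ[k] C.s.Hom X Y) : Prop :=
  ∀ i : ℤ,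
    (∀ a ∈ homDeg B C p X Y i, homDiff B C p X Y i a = 0 →
      ∃ c ∈ homDeg B C p X' Y i, homDiff B C p X' Y i c = 0 ∧
        ∃ e ∈ homDeg B C p X Y (i - 1), a - w ∘ₗ c = homDiff B C p X Y (i - 1) e) ∧
    (∀ c ∈ homDeg B C p X' Y i, homDiff B C p X' Y i c = 0 →
      (∃ e ∈ homDeg B C p X Y (i - 1), w ∘ₗ c = homDiff B C p X Y (i - 1) e) →
        ∃ e ∈ homDeg B C p X' Y (i - 1), c = homDiff B C p X' Y (i - 1) e)

end Assumption

end AInf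

open AInf

/-! The pair (p, v) is built by obstruction theory, one tensor length at a time, where v is the
coderivation exhibiting r' as equivalent to (r ⊗ p)B₂. Coderivations are freely determined by their
components (`isCoderivation_ofComp`, `IsCoderivation.eq_conv`), so arbitrary p of degree -1 and v of
degree -2 can be prescribed componentwise. Two errors must vanish: the bracket λ = pb + bp, a
coderivation g → g' of degree 0, and the defect ν = r' - (r ⊗ p)B₂ - (vb - bv), a coderivation f →
g' of degree -1.

The errors satisfy two identities. Since b² = 0, λ commutes with b (`AInfTransformation.b_bracket`).
Since r is a cycle, (r ⊗ p)B₂ is the commutator of θ = (r ⊗ p)θ with b, minus (r ⊗ λ)θ (`B2_eq`); as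
r' is also a cycle, νb + bν = θ'b + bθ' with θ' = (r ⊗ λ)θ (`b_defect`).

Suppose the components of λ and ν vanish on all lengths below n. On length n, a coderivation reduces
to its n-th component, the differential of TsB to ∑ 1 ⊗ b₁ ⊗ 1 modulo shorter words, and θ' to r₀ ⊗
λₙ. The two identities then read dλₙ = 0 and dνₙ = u(λₙ) in the Hom complexes, where u is
composition with (r₀ ⊗ 1)b₂ (`homDiff_bracket`, `homDiff_defect`): (λₙ, νₙ) is a cycle in the cone
of u. The cone is acyclic because u is a quasi-isomorphism, so `HomQuasiIso.exists_primitive` bounds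
this cycle, and the bounding pair corrects the n-th components of p and v without affecting the
errors on shorter lengths (`exists_correction`).

The induction begins at n = 0, where nothing is required; the component p₀ itself comes from the
case N = k. The n-th correction leaves lengths below n alone, so the sequence has a limit
(`AInfTransformation.exists_limit`), and both errors of the limit vanish on every length, hence are
zero. -/

namespace AInf

/-! ### Signs -/

/-- The sign `(-1) ^ n`, as an element of `k`. -/
def sg (k : Type u) [CommRing k] (n : ℤ) : k := ((n.negOnePow : ℤ) : k)

section

variable (k : Type u) [CommRing k]

theorem sg_add (m n : ℤ) : sg k (m + n) = sg k m * sg k n := by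
  simp [sg, Int.negOnePow_add]

theorem sg_zero : sg k 0 = 1 := by simp [sg]

theorem sg_one : sg k 1 = -1 := by simp [sg]

theorem sg_neg (n : ℤ) : sg k (-n) = sg k n := by simp [sg, Int.negOnePow_neg]

theorem sg_mul_self (n : ℤ) : sg k n * sg k n = 1 := by
  rw [← sg_add, sg, Int.negOnePow_even _ ⟨n, rfl⟩]; simp

theorem negOnePow_smul {M : Type*} [AddCommGroup M] [Module k M] (n : ℤ) (x : M) :
    ((n.negOnePow : ℤˣ) : ℤ) • x = sg k n • x := by
  rw [sg, Int.cast_smul_eq_zsmul]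

end

/-- The length of a sequence of objects. -/
def ObjPath.len {S : Type u} : ∀ {X Y : S}, ObjPath S X Y → ℕ
  | _, _, .nil _ => 0
  | _, _, .cons _ p => p.len + 1

section Words

variable {k : Type u} [CommRing k] {S : Type u} (Q : GradedQuiver k S)

/-! ### Generalities on tensor quivers -/

theorem T.desc_of {X Y : S} {M : Type u} [AddCommMonoid M] [Module k M]
    (φ : ∀ p : ObjPath S X Y, PathMod Q p →ₗ[k] M) (p : ObjPath S X Y) (t : PathMod Q p) :
    T.desc Q φ (T.of Q p t) = φ p t := by
  classical
  unfold T.desc T.of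
  convert DirectSum.toModule_lof k (φ := φ) p t

theorem TT.desc_of {X Y : S} {M : Type u} [AddCommMonoid M] [Module k M]
    (φ : ∀ Z : S, T Q X Z ⊗[k] T Q Z Y →ₗ[k] M) (Z : S) (t) :
    TT.desc Q φ (TT.of Q X Y Z t) = φ Z t := by
  classical
  unfold TT.desc TT.of
  convert DirectSum.toModule_lof k (φ := φ) Z t

theorem T.hom_ext {X Y : S} {M : Type u} [AddCommMonoid M] [Module k M] {a c : T Q X Y →ₗ[k] M}
    (h : ∀ p t, a (T.of Q p t) = c (T.of Q p t)) : a = c := by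
  classical
  refine DirectSum.linearMap_ext k fun p => LinearMap.ext fun t => ?_
  exact h p t

theorem TT.hom_ext {X Y : S} {M : Type u} [AddCommMonoid M] [Module k M] {a c : TT Q X Y →ₗ[k] M}
    (h : ∀ Z x y, a (TT.of Q X Y Z (x ⊗ₜ y)) = c (TT.of Q X Y Z (x ⊗ₜ y))) : a = c := by
  classical
  refine DirectSum.linearMap_ext k fun Z => TensorProduct.ext' fun x y => ?_
  exact h Z x y

theorem T.of_apply_self {X Y : S} (p : ObjPath S X Y) (t : PathMod Q p) : T.of Q p t p = t := by
  classical
  exact DirectSum.component.lof_self k (M := fun p => PathMod Q p) p t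

theorem T.of_apply_ne {X Y : S} {p q : ObjPath S X Y} (h : p ≠ q) (t : PathMod Q p) :
    T.of Q p t q = 0 := by
  classical
  exact DirectSum.of_eq_of_ne (β := fun p : ObjPath S X Y => PathMod Q p) p q t h.symm

theorem T.eq_sum {X Y : S} (t : T Q X Y) :
    ∃ s : Finset (ObjPath S X Y), t = ∑ p ∈ s, T.of Q p (t p) := by
  classical
  refine ⟨DFinsupp.support t, ?_⟩
  exact (DirectSum.sum_support_of t).symm

theorem T.of_mem_gr {X Y : S} {p : ObjPath S X Y} {t : PathMod Q p} {d : ℤ}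
    (h : t ∈ PathMod.gr Q p d) : T.of Q p t ∈ T.gr Q X Y d := by
  intro q
  by_cases hq : p = q
  · subst hq; rwa [T.of_apply_self]
  · rw [T.of_apply_ne Q hq]; exact Submodule.zero_mem _

theorem T.cons_of {X Z Y : S} (x : Q.Hom X Z) (p : ObjPath S Z Y) (t : PathMod Q p) :
    T.cons Q X Z Y x (T.of Q p t) =
      T.of Q (.cons X p) ((PathMod.consEquiv Q X p).symm (x ⊗ₜ t)) := by
  simp only [T.cons, LinearMap.flip_apply, T.desc_of]
  rfl

theorem TT.cons_of {X Z Y W : S} (x : Q.Hom X Z) (t : T Q Z W) (t' : T Q W Y) :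
    TT.cons Q X Z Y x (TT.of Q Z Y W (t ⊗ₜ t')) = TT.of Q X Y W (T.cons Q X Z W x t ⊗ₜ t') := by
  simp only [TT.cons, LinearMap.flip_apply, TT.desc_of]
  rfl

theorem PathMod.cons_induction {X Z Y : S} {p : ObjPath S Z Y} {P : PathMod Q (.cons X p) → Prop}
    (h0 : P 0) (hadd : ∀ s t, P s → P t → P (s + t))
    (h : ∀ x t, P ((PathMod.consEquiv Q X p).symm (x ⊗ₜ t))) (t) : P t := by
  obtain ⟨s, rfl⟩ := (PathMod.consEquiv Q X p).symm.surjective t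
  induction s with
  | zero => rw [map_zero]; exact h0
  | tmul x t => exact h x t
  | add a b ha hb => rw [map_add]; exact hadd _ _ ha hb

/-! ### Words -/

/-- Words: sequences of composable homogeneous elements. -/
inductive Word : S → S → Type u
  | nil (X : S) : Word X X
  | cons {X Z Y : S} (i : ℤ) (x : Q.gr X Z i) (w : Word Z Y) : Word X Y

namespace Word

variable {Q}

/-- The element of `TQ` given by a word. -/
noncomputable def toT : ∀ {X Y : S}, Word Q X Y → T Q X Y
  | _, _, nil X => T.one Q X
  | _, _, cons _ x w => T.cons Q _ _ _ x.1 w.toT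

/-- The degree of a word. -/
def deg : ∀ {X Y : S}, Word Q X Y → ℤ
  | _, _, nil _ => 0
  | _, _, cons i _ w => i + w.deg

/-- The length of a word. -/
def len : ∀ {X Y : S}, Word Q X Y → ℕ
  | _, _, nil _ => 0
  | _, _, cons _ _ w => w.len + 1

/-- The sum of `F u v` over all ways to cut the word `w` into `u` and `v`. -/
def sum {M : Type u} [AddCommMonoid M] : ∀ {X Y : S} (_ : Word Q X Y)
    (_ : ∀ Z, Word Q X Z → Word Q Z Y → M), M
  | _, _, nil X, F => F X (nil X) (nil X)
  | X, _, cons i x w, F => F X (nil X) (cons i x w) + w.sum fun Z u v => F Z (cons i x u) v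

section sum

variable {M : Type u} [AddCommMonoid M] {X Y : S} (w : Word Q X Y)

theorem sum_congr {F G : ∀ Z, Word Q X Z → Word Q Z Y → M}
    (h : ∀ Z u v, u.len + v.len = w.len → u.deg + v.deg = w.deg → F Z u v = G Z u v) :
    w.sum F = w.sum G := by
  induction w with
  | nil X => exact h _ _ _ rfl rfl
  | cons i x w ih =>
    simp only [sum]
    rw [h _ (nil _) (cons i x w) (by simp [len]) (by simp [deg])]
    congr 1
    refine ih fun Z u v h1 h2 => h _ _ _ ?_ ?_
    · simp only [len]; omega
    · simp only [deg]; omega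

theorem sum_add (F G : ∀ Z, Word Q X Z → Word Q Z Y → M) :
    (w.sum fun Z u v => F Z u v + G Z u v) = w.sum F + w.sum G := by
  induction w with
  | nil X => rfl
  | cons i x w ih => simp only [sum, ih]; abel

theorem sum_zero : (w.sum fun _ _ _ => (0 : M)) = 0 := by
  induction w with
  | nil X => rfl
  | cons i x w ih => simp only [sum, ih, add_zero]

theorem map_sum {N : Type u} [AddCommMonoid N] {A : Type*} [FunLike A M N] [AddMonoidHomClass A M N]
    (a : A) (F : ∀ Z, Word Q X Z → Word Q Z Y → M) :
    a (w.sum F) = w.sum fun Z u v => a (F Z u v) := by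
  induction w with
  | nil X => rfl
  | cons i x w ih => simp only [sum, ih, map_add]

/-- Both sides run over the cuts of `w` into three consecutive words. This is coassociativity of Δ,
in the form used to rearrange iterated convolutions. -/
theorem sum_assoc (F : ∀ W Z, Word Q X W → Word Q W Z → Word Q Z Y → M) :
    (w.sum fun Z u v => u.sum fun W a b => F W Z a b v) =
      w.sum fun W a u => u.sum fun Z b v => F W Z a b v := by
  induction w with
  | nil X => rfl
  | cons i x w ih =>
    simp only [sum, sum_add]
    rw [ih]
    abel

theorem sum_eq_first {F : ∀ Z, Word Q X Z → Word Q Z Y → M}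
    (h : ∀ Z u v, 0 < u.len → u.len + v.len = w.len → F Z u v = 0) : w.sum F = F X (nil X) w := by
  cases w with
  | nil X => rfl
  | cons i x w =>
    simp only [sum]
    rw [sum_congr w (G := fun _ _ _ => 0), sum_zero, add_zero]
    intro Z u v h1 _
    refine h _ _ _ (by simp [len]) ?_
    simp only [len]; omega

theorem sum_eq_last {F : ∀ Z, Word Q X Z → Word Q Z Y → M}
    (h : ∀ Z u v, 0 < v.len → u.len + v.len = w.len → F Z u v = 0) : w.sum F = F Y w (nil Y) := by
  induction w with
  | nil X => rfl
  | cons i x w ih =>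
    simp only [sum]
    rw [h _ (nil _) _ (by simp [len]) (by simp [len]), zero_add]
    refine ih fun Z u v h1 h2 => h _ _ _ h1 ?_
    simp only [len]; omega

end sum

theorem toT_nil (X : S) : (nil X : Word Q X X).toT = T.one Q X := rfl

theorem toT_cons {X Z Y : S} (i : ℤ) (x : Q.gr X Z i) (w : Word Q Z Y) :
    (cons i x w).toT = T.cons Q X Z Y x.1 w.toT := rfl

theorem exists_path {X Y : S} (w : Word Q X Y) :
    ∃ p : ObjPath S X Y, p.len = w.len ∧ ∃ t ∈ PathMod.gr Q p w.deg, w.toT = T.of Q p t := by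
  induction w with
  | nil X =>
    refine ⟨.nil X, rfl, (PathMod.nilEquiv Q X).symm 1, ?_, rfl⟩
    simp [PathMod.gr, deg]
  | cons i x w ih =>
    obtain ⟨p, hp, t, ht, h⟩ := ih
    refine ⟨.cons _ p, by simp [ObjPath.len, len, hp], _, ?_, by rw [toT_cons, h, T.cons_of]⟩
    rw [PathMod.gr, Submodule.mem_comap]
    refine Submodule.mem_iSup_of_mem i ?_
    simp only [LinearEquiv.coe_coe, LinearEquiv.apply_symm_apply, deg]
    refine Submodule.apply_mem_map₂ _ x.2 ?_
    convert ht using 2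
    ring

theorem toT_mem_gr {X Y : S} (w : Word Q X Y) : w.toT ∈ T.gr Q X Y w.deg := by
  obtain ⟨p, -, t, ht, h⟩ := w.exists_path
  rw [h]
  exact T.of_mem_gr Q ht

end Word

/-- The predicates `P` and `P'` on degrees serve two spanning arguments at once: words of a fixed
degree, and words of any degree. -/
theorem T.cons_mem_span {X Z Y : S} {i : ℤ} {x : Q.Hom X Z} (hx : x ∈ Q.gr X Z i) {n : ℕ}
    {P P' : ℤ → Prop} (hP : ∀ d, P d → P' (i + d)) {t : T Q Z Y}
    (ht : t ∈ Submodule.span k {t | ∃ w : Word Q Z Y, w.len = n ∧ P w.deg ∧ w.toT = t}) :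
    T.cons Q X Z Y x t ∈
      Submodule.span k {t | ∃ w : Word Q X Y, w.len = n + 1 ∧ P' w.deg ∧ w.toT = t} := by
  have : Submodule.span k {t | ∃ w : Word Q Z Y, w.len = n ∧ P w.deg ∧ w.toT = t} ≤
      (Submodule.span k {t | ∃ w : Word Q X Y, w.len = n + 1 ∧ P' w.deg ∧ w.toT = t}).comap
        (T.cons Q X Z Y x) := by
    rw [Submodule.span_le]
    rintro _ ⟨w, h1, h2, rfl⟩
    refine Submodule.subset_span ⟨.cons i ⟨x, hx⟩ w, ?_, ?_, rfl⟩
    · simp [Word.len, h1]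
    · exact hP _ h2
  exact this ht

theorem T.of_mem_span_gr {X Y : S} (p : ObjPath S X Y) : ∀ (d : ℤ) (t : PathMod Q p),
    t ∈ PathMod.gr Q p d → T.of Q p t ∈
      Submodule.span k {t | ∃ w : Word Q X Y, w.len = p.len ∧ w.deg = d ∧ w.toT = t} := by
  induction p with
  | nil X =>
    intro d t ht
    by_cases hd : d = 0
    · have : T.of Q (.nil X) t = (PathMod.nilEquiv Q X t) • T.one Q X := by
        rw [T.one, ← map_smul, ← map_smul]
        simp
      rw [this]
      exact Submodule.smul_mem _ _ (Submodule.subset_span ⟨.nil X, rfl, hd.symm, rfl⟩)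
    · simp only [PathMod.gr, hd, if_false, Submodule.mem_bot] at ht
      rw [ht, map_zero]
      exact Submodule.zero_mem _
  | cons X p ih =>
    intro d t ht
    rw [PathMod.gr] at ht
    obtain ⟨s, rfl⟩ := (PathMod.consEquiv Q X p).symm.surjective t
    rw [Submodule.mem_comap] at ht
    simp only [LinearEquiv.coe_coe, LinearEquiv.apply_symm_apply] at ht
    set N := Submodule.span k {t | ∃ w : Word Q X _, w.len = p.len + 1 ∧ w.deg = d ∧ w.toT = t}
    suffices (⨆ i : ℤ, Submodule.map₂ (TensorProduct.mk k (Q.Hom X _) (PathMod Q p))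
        (Q.gr X _ i) (PathMod.gr Q p (d - i))) ≤
        N.comap (T.of Q (.cons X p) ∘ₗ (PathMod.consEquiv Q X p).symm.toLinearMap) from this ht
    refine iSup_le fun i => Submodule.map₂_le.2 fun x hx t ht => ?_
    rw [Submodule.mem_comap, TensorProduct.mk_apply, LinearMap.comp_apply, LinearEquiv.coe_coe,
      ← T.cons_of]
    exact T.cons_mem_span Q hx (P := fun e => e = d - i) (P' := fun e => e = d)
      (by intro e he; omega) (ih _ t ht)

theorem T.of_mem_span {X Y : S} (p : ObjPath S X Y) : ∀ t : PathMod Q p, T.of Q p t ∈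
      Submodule.span k {t | ∃ w : Word Q X Y, w.len = p.len ∧ True ∧ w.toT = t} := by
  induction p with
  | nil X =>
    intro t
    have : T.of Q (.nil X) t = (PathMod.nilEquiv Q X t) • T.one Q X := by
      rw [T.one, ← map_smul, ← map_smul]
      simp
    rw [this]
    exact Submodule.smul_mem _ _ (Submodule.subset_span ⟨.nil X, rfl, trivial, rfl⟩)
  | @cons X Z Y p ih =>
    intro t
    refine PathMod.cons_induction Q (P := fun t => T.of Q (.cons X p) t ∈ _) ?_ (fun s t hs ht => ?_) (fun x t => ?_) t
    · rw [map_zero]; exact Submodule.zero_mem _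
    · rw [map_add]; exact Submodule.add_mem _ hs ht
    · rw [← T.cons_of]
      set N := Submodule.span k {t | ∃ w : Word Q X _, w.len = p.len + 1 ∧ True ∧ w.toT = t}
      have hx : x ∈ ⨆ i, Q.gr X _ i := by
        rw [(Q.internal X _).submodule_iSup_eq_top]; trivial
      suffices (⨆ i, Q.gr X Z i) ≤ N.comap ((T.cons Q X Z Y).flip (T.of Q p t)) from this hx
      refine iSup_le fun i x hx => ?_
      exact T.cons_mem_span Q hx (P := fun _ => True) (P' := fun _ => True) (fun _ h => h) (ih t)

theorem T.span_words (X Y : S) : Submodule.span k (Set.range (Word.toT (Q := Q) (X := X) (Y := Y)))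
    = ⊤ := by
  rw [eq_top_iff]
  rintro t -
  obtain ⟨s, hs⟩ := T.eq_sum Q t
  rw [hs]
  refine Submodule.sum_mem _ fun p _ => ?_
  refine Submodule.span_mono ?_ (T.of_mem_span Q p (t p))
  rintro _ ⟨w, -, -, rfl⟩
  exact ⟨w, rfl⟩

theorem T.gr_le_span (X Y : S) (d : ℤ) : T.gr Q X Y d ≤
    Submodule.span k {t | ∃ w : Word Q X Y, w.deg = d ∧ w.toT = t} := by
  intro t ht
  obtain ⟨s, hs⟩ := T.eq_sum Q t
  rw [hs]
  refine Submodule.sum_mem _ fun p _ => ?_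
  refine Submodule.span_mono ?_ (T.of_mem_span_gr Q p d (t p) (ht p))
  rintro _ ⟨w, -, h, rfl⟩
  exact ⟨w, h, rfl⟩

variable {Q}

/-- Words are the test elements of the whole proof: on them the Koszul sign operators are scalars
and Δ is a sum over cuts. -/
theorem T.word_ext {X Y : S} {M : Type u} [AddCommMonoid M] [Module k M] {a c : T Q X Y →ₗ[k] M}
    (h : ∀ w : Word Q X Y, a w.toT = c w.toT) : a = c := by
  refine LinearMap.ext_on (T.span_words Q X Y) ?_
  rintro _ ⟨w, rfl⟩
  exact h w

theorem T.word_ext_gr {X Y : S} {M : Type u} [AddCommMonoid M] [Module k M]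
    {a c : T Q X Y →ₗ[k] M} {d : ℤ} (h : ∀ w : Word Q X Y, w.deg = d → a w.toT = c w.toT)
    {t : T Q X Y} (ht : t ∈ T.gr Q X Y d) : a t = c t := by
  suffices T.gr Q X Y d ≤ LinearMap.eqLocus a c from this ht
  refine (T.gr_le_span Q X Y d).trans (Submodule.span_le.2 ?_)
  rintro _ ⟨w, hw, rfl⟩
  exact h w hw

end Words

section

variable {k : Type u} [CommRing k] {S : Type u} (Q : GradedQuiver k S)

/-! ### The structure maps of `TQ` -/

theorem T.mul_of {X Z Y : S} (p : ObjPath S X Z) (t : PathMod Q p) (y : T Q Z Y) :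
    T.mul Q X Z Y (T.of Q p t ⊗ₜ y) = PathMod.mul Q Y p t y := by
  rw [T.mul, TensorProduct.lift.tmul, T.desc_of]

theorem T.one_mul {X Y : S} (y : T Q X Y) : T.mul Q X X Y (T.one Q X ⊗ₜ y) = y := by
  rw [T.one, T.mul_of]
  simp [PathMod.mul]

theorem T.cons_mul {X W Z Y : S} (x : Q.Hom X W) (t : T Q W Z) (y : T Q Z Y) :
    T.mul Q X Z Y (T.cons Q X W Z x t ⊗ₜ y) = T.cons Q X W Y x (T.mul Q W Z Y (t ⊗ₜ y)) := by
  suffices (TensorProduct.curry (T.mul Q X Z Y) ∘ₗ T.cons Q X W Z x).flip y =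
      T.cons Q X W Y x ∘ₗ (TensorProduct.curry (T.mul Q W Z Y)).flip y from
    LinearMap.congr_fun this t
  refine T.hom_ext Q fun p t => ?_
  simp only [LinearMap.flip_apply, LinearMap.comp_apply, TensorProduct.curry_apply]
  rw [T.cons_of, T.mul_of, T.mul_of, PathMod.mul]
  simp

theorem T.comul_one (X : S) :
    T.comul Q X X (T.one Q X) = TT.of Q X X X (T.one Q X ⊗ₜ T.one Q X) := by
  rw [T.one, T.comul, T.desc_of]
  simp [PathMod.comul, T.one]

theorem T.comul_cons {X Z Y : S} (x : Q.Hom X Z) (t : T Q Z Y) :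
    T.comul Q X Y (T.cons Q X Z Y x t) =
      TT.of Q X Y X (T.one Q X ⊗ₜ T.cons Q X Z Y x t) + TT.cons Q X Z Y x (T.comul Q Z Y t) := by
  suffices T.comul Q X Y ∘ₗ T.cons Q X Z Y x =
      TT.of Q X Y X ∘ₗ TensorProduct.mk k _ _ (T.one Q X) ∘ₗ T.cons Q X Z Y x +
        TT.cons Q X Z Y x ∘ₗ T.comul Q Z Y from
    LinearMap.congr_fun this t
  refine T.hom_ext Q fun p t => ?_
  simp only [LinearMap.comp_apply, LinearMap.add_apply]
  rw [T.cons_of, T.comul, T.desc_of, PathMod.comul]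
  simp [T.desc_of, T.comul]

theorem T.sgn_of (d : ℤ) {X Y : S} (p : ObjPath S X Y) (t : PathMod Q p) :
    T.sgn Q d X Y (T.of Q p t) = T.of Q p (PathMod.sgn Q d p t) := by
  classical
  exact DirectSum.lmap_lof (R := k) (fun p => PathMod.sgn Q d p) p t

theorem T.sgn_one (d : ℤ) (X : S) : T.sgn Q d X X (T.one Q X) = T.one Q X := by
  rw [T.one, T.sgn_of]
  rfl

theorem T.sgn_cons (d : ℤ) {X Z Y : S} (x : Q.Hom X Z) (t : T Q Z Y) :
    T.sgn Q d X Y (T.cons Q X Z Y x t) = T.cons Q X Z Y (Q.sgn d X Z x) (T.sgn Q d Z Y t) := by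
  suffices T.sgn Q d X Y ∘ₗ T.cons Q X Z Y x =
      T.cons Q X Z Y (Q.sgn d X Z x) ∘ₗ T.sgn Q d Z Y from LinearMap.congr_fun this t
  refine T.hom_ext Q fun p t => ?_
  simp only [LinearMap.comp_apply]
  rw [T.cons_of, T.sgn_of, T.sgn_of, T.cons_of, PathMod.sgn]
  simp

variable {Q}

theorem GradedQuiver.sgn_apply (d : ℤ) {X Y : S} {i : ℤ} {x : Q.Hom X Y} (hx : x ∈ Q.gr X Y i) :
    Q.sgn d X Y x = sg k (d * i) • x := by
  have h : (LinearEquiv.ofBijective (DirectSum.coeLinearMap (Q.gr X Y)) (Q.bijective X Y)).symm x =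
      DirectSum.lof k ℤ (fun i => Q.gr X Y i) i ⟨x, hx⟩ := by
    rw [LinearEquiv.symm_apply_eq]
    simp [DirectSum.coeLinearMap_lof]
  rw [GradedQuiver.sgn, LinearMap.comp_apply, LinearMap.comp_apply, LinearEquiv.coe_coe, h,
    DirectSum.lmap_lof, DirectSum.coeLinearMap_lof, ← negOnePow_smul]
  rfl

theorem Word.sgn_toT (d : ℤ) {X Y : S} (w : Word Q X Y) :
    T.sgn Q d X Y w.toT = sg k (d * w.deg) • w.toT := by
  induction w with
  | nil X => rw [toT_nil, T.sgn_one, deg, mul_zero, sg_zero, one_smul]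
  | cons i x w ih =>
    rw [toT_cons, T.sgn_cons, ih, GradedQuiver.sgn_apply d x.2, deg, mul_add, sg_add, map_smul,
      map_smul, LinearMap.smul_apply, smul_smul, mul_comm]

theorem T.sgn_apply (d : ℤ) {X Y : S} {i : ℤ} {t : T Q X Y} (ht : t ∈ T.gr Q X Y i) :
    T.sgn Q d X Y t = sg k (d * i) • t := by
  have := T.word_ext_gr (a := T.sgn Q d X Y) (c := sg k (d * i) • LinearMap.id) (d := i)
    (by rintro w rfl; rw [Word.sgn_toT]; rfl) ht
  rw [this]
  rfl

theorem T.mul_mem_gr {X Z Y : S} {i j : ℤ} {x : T Q X Z} {y : T Q Z Y} (hx : x ∈ T.gr Q X Z i)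
    (hy : y ∈ T.gr Q Z Y j) : T.mul Q X Z Y (x ⊗ₜ y) ∈ T.gr Q X Y (i + j) := by
  have cons_mem : ∀ {X Z Y : S} {i j : ℤ} (x : Q.gr X Z i) (y : T Q Z Y), y ∈ T.gr Q Z Y j →
      T.cons Q X Z Y x.1 y ∈ T.gr Q X Y (i + j) := by
    intro X Z Y i j x y hy
    suffices T.gr Q Z Y j ≤ (T.gr Q X Y (i + j)).comap (T.cons Q X Z Y x.1) from this hy
    refine (T.gr_le_span Q Z Y j).trans (Submodule.span_le.2 ?_)
    rintro _ ⟨w, rfl, rfl⟩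
    exact (Word.cons i x w).toT_mem_gr
  suffices T.gr Q X Z i ≤ (T.gr Q X Y (i + j)).comap
      ((TensorProduct.curry (T.mul Q X Z Y)).flip y) from this hx
  refine (T.gr_le_span Q X Z i).trans (Submodule.span_le.2 ?_)
  rintro _ ⟨w, rfl, rfl⟩
  show T.mul Q X Z Y (w.toT ⊗ₜ y) ∈ T.gr Q X Y (w.deg + j)
  clear hx x
  induction w with
  | nil X => rw [Word.toT_nil, T.one_mul, Word.deg, zero_add]; exact hy
  | cons i x w ih =>
    rw [Word.toT_cons, T.cons_mul, Word.deg, add_assoc]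
    exact cons_mem _ _ (ih hy)

theorem Word.comul_toT {X Y : S} (w : Word Q X Y) :
    T.comul Q X Y w.toT = w.sum fun Z u v => TT.of Q X Y Z (u.toT ⊗ₜ v.toT) := by
  induction w with
  | nil X => exact T.comul_one Q X
  | cons i x w ih =>
    rw [toT_cons, T.comul_cons, ih, map_sum]
    simp only [sum, TT.cons_of]
    rfl

theorem T.mul_one {X Y : S} (x : T Q X Y) : T.mul Q X Y Y (x ⊗ₜ T.one Q Y) = x := by
  suffices (TensorProduct.curry (T.mul Q X Y Y)).flip (T.one Q Y) = LinearMap.id from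
    LinearMap.congr_fun this x
  refine T.word_ext fun w => ?_
  show T.mul Q X Y Y (w.toT ⊗ₜ T.one Q Y) = w.toT
  clear x
  induction w with
  | nil X => exact T.one_mul Q _
  | cons i x w ih => rw [Word.toT_cons, T.cons_mul, ih]

/-! ### The compatibility of the cut comultiplication and the concatenation -/

variable (Q) in
/-- Multiplication of the first tensor factor from the left. -/
noncomputable def TT.lmul (X Z Y : S) : T Q X Z →ₗ[k] TT Q Z Y →ₗ[k] TT Q X Y :=
  (TT.desc Q fun W =>
    ((LinearMap.rTensorHom (T Q W Y) ∘ₗ TensorProduct.curry (T.mul Q X Z W)).compr₂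
      (TT.of Q X Y W)).flip).flip

variable (Q) in
/-- Multiplication of the second tensor factor from the right. -/
noncomputable def TT.rmul (X Z Y : S) : T Q Z Y →ₗ[k] TT Q X Z →ₗ[k] TT Q X Y :=
  (TT.desc Q fun W =>
    ((LinearMap.lTensorHom (T Q X W) ∘ₗ (TensorProduct.curry (T.mul Q W Z Y)).flip).compr₂
      (TT.of Q X Y W)).flip).flip

theorem TT.lmul_of {X Z W Y : S} (x : T Q X Z) (s : T Q Z W) (t : T Q W Y) :
    TT.lmul Q X Z Y x (TT.of Q Z Y W (s ⊗ₜ t)) = TT.of Q X Y W (T.mul Q X Z W (x ⊗ₜ s) ⊗ₜ t) := by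
  simp only [TT.lmul, LinearMap.flip_apply, TT.desc_of]
  rfl

theorem TT.rmul_of {X Z W Y : S} (y : T Q Z Y) (s : T Q X W) (t : T Q W Z) :
    TT.rmul Q X Z Y y (TT.of Q X Z W (s ⊗ₜ t)) = TT.of Q X Y W (s ⊗ₜ T.mul Q W Z Y (t ⊗ₜ y)) := by
  simp only [TT.rmul, LinearMap.flip_apply, TT.desc_of]
  rfl

theorem TT.lmul_one {X Y : S} (z : TT Q X Y) : TT.lmul Q X X Y (T.one Q X) z = z := by
  suffices TT.lmul Q X X Y (T.one Q X) = LinearMap.id from LinearMap.congr_fun this z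
  refine TT.hom_ext Q fun Z x y => ?_
  rw [TT.lmul_of, T.one_mul]
  rfl

theorem TT.lmul_cons {X W Z Y : S} (a : Q.Hom X W) (x : T Q W Z) (z : TT Q Z Y) :
    TT.lmul Q X Z Y (T.cons Q X W Z a x) z = TT.cons Q X W Y a (TT.lmul Q W Z Y x z) := by
  suffices TT.lmul Q X Z Y (T.cons Q X W Z a x) = TT.cons Q X W Y a ∘ₗ TT.lmul Q W Z Y x from
    LinearMap.congr_fun this z
  refine TT.hom_ext Q fun Z x y => ?_
  rw [LinearMap.comp_apply, TT.lmul_of, TT.lmul_of, TT.cons_of, T.cons_mul]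

theorem TT.rmul_cons {X W Z Y : S} (a : Q.Hom X W) (y : T Q Z Y) (z : TT Q W Z) :
    TT.rmul Q X Z Y y (TT.cons Q X W Z a z) = TT.cons Q X W Y a (TT.rmul Q W Z Y y z) := by
  suffices TT.rmul Q X Z Y y ∘ₗ TT.cons Q X W Z a = TT.cons Q X W Y a ∘ₗ TT.rmul Q W Z Y y from
    LinearMap.congr_fun this z
  refine TT.hom_ext Q fun Z x y => ?_
  simp only [LinearMap.comp_apply, TT.rmul_of, TT.cons_of]

/-- The tensor quiver is an infinitesimal bialgebra: `Δ(xy) + x ⊗ y = Δ(x)y + xΔ(y)`. -/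
theorem T.comul_mul {X Z Y : S} (x : T Q X Z) (y : T Q Z Y) :
    T.comul Q X Y (T.mul Q X Z Y (x ⊗ₜ y)) + TT.of Q X Y Z (x ⊗ₜ y) =
      TT.rmul Q X Z Y y (T.comul Q X Z x) + TT.lmul Q X Z Y x (T.comul Q Z Y y) := by
  suffices T.comul Q X Y ∘ₗ (TensorProduct.curry (T.mul Q X Z Y)).flip y +
        TT.of Q X Y Z ∘ₗ (TensorProduct.mk k _ _).flip y =
      TT.rmul Q X Z Y y ∘ₗ T.comul Q X Z + (TT.lmul Q X Z Y).flip (T.comul Q Z Y y) from LinearMap.congr_fun this x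
  refine T.word_ext fun w => ?_
  simp only [LinearMap.comp_apply, LinearMap.add_apply, LinearMap.flip_apply,
    TensorProduct.curry_apply, TensorProduct.mk_apply]
  clear x
  induction w with
  -- For the empty word both sides are Δ(y) + 1 ⊗ y.
  | nil X => simp only [Word.toT_nil, T.one_mul, T.comul_one, TT.rmul_of, TT.lmul_one]; exact add_comm _ _
  | cons i a w ih =>
    simp only [Word.toT_cons, T.cons_mul, T.comul_cons, TT.lmul_cons, map_add, TT.rmul_of,
      TT.rmul_cons, add_assoc]
    -- The term 1 ⊗ axy stands on both sides; what remains is the inductive hypothesis with `a`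
    -- prepended.
    rw [← map_add, ← ih, map_add, TT.cons_of]

/-! ### The projections onto `T⁰Q` and `T¹Q` -/

theorem T.pr1_of_cons_nil {X Y : S} (x : Q.Hom X Y) :
    T.pr1 Q X Y (T.cons Q X Y Y x (T.one Q Y)) = x := by
  rw [T.one, T.cons_of, T.pr1]
  simp only [LinearMap.comp_apply]
  have : DirectSum.component k (ObjPath S X Y) (fun p => PathMod Q p) (.cons X (.nil Y))
      (T.of Q (.cons X (.nil Y)) ((PathMod.consEquiv Q X (.nil Y)).symm
        (x ⊗ₜ[k] (PathMod.nilEquiv Q Y).symm 1))) = _ := T.of_apply_self Q _ _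
  rw [this, LinearEquiv.coe_coe, LinearEquiv.coe_coe, LinearEquiv.apply_symm_apply,
    TensorProduct.map_tmul, LinearEquiv.coe_coe, LinearEquiv.apply_symm_apply,
    TensorProduct.rid_tmul, one_smul, LinearMap.id_apply]

theorem T.pr1_in1 {X Y : S} (x : Q.Hom X Y) : T.pr1 Q X Y (T.in1 Q X Y x) = x :=
  T.pr1_of_cons_nil x

theorem T.pr1_of {X Y : S} {p : ObjPath S X Y} (hp : p.len ≠ 1) (t : PathMod Q p) :
    T.pr1 Q X Y (T.of Q p t) = 0 := by
  have hne : p ≠ .cons X (.nil Y) := by rintro rfl; exact hp rfl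
  have : DirectSum.component k (ObjPath S X Y) (fun p => PathMod Q p) (.cons X (.nil Y))
      (T.of Q p t) = 0 := T.of_apply_ne Q hne t
  rw [T.pr1, LinearMap.comp_apply, LinearMap.comp_apply, LinearMap.comp_apply, this, map_zero,
    map_zero, map_zero]

theorem Word.pr1_toT {X Y : S} {w : Word Q X Y} (hw : w.len ≠ 1) : T.pr1 Q X Y w.toT = 0 := by
  obtain ⟨p, hp, t, -, h⟩ := w.exists_path
  rw [h, T.pr1_of (hp ▸ hw)]

/-- The family of maps `TQ(X, Y) → T⁰R(Xφ, Yφ)` whose restriction to `T⁰Q` preserves units. -/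
noncomputable def PathMod.unit {S' : Type u} (R : GradedQuiver k S') (φ : S → S') :
    ∀ {X Y : S} (p : ObjPath S X Y), PathMod Q p →ₗ[k] T R (φ X) (φ Y)
  | _, _, .nil X => LinearMap.toSpanSingleton k _ (T.one R (φ X)) ∘ₗ
      (PathMod.nilEquiv Q X).toLinearMap
  | _, _, .cons _ _ => 0

end

section

variable {k : Type u} [CommRing k] {S S' : Type u} {Q : GradedQuiver k S}
  {R : GradedQuiver k S'} {φ γ χ ψ : S → S'}

variable (Q R φ) in
/-- The unit for the convolution. -/
noncomputable def TMap.unit : TMap Q R φ φ := fun _ _ => T.desc Q fun p => PathMod.unit R φ p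

theorem TMap.unit_one (X : S) : TMap.unit Q R φ X X (T.one Q X) = T.one R (φ X) := by
  rw [TMap.unit, T.one, T.desc_of, PathMod.unit]
  simp

theorem TMap.unit_cons {X Y Z : S} (x : Q.Hom X Z) (t : T Q Z Y) :
    TMap.unit Q R φ X Y (T.cons Q X Z Y x t) = 0 := by
  suffices TMap.unit Q R φ X Y ∘ₗ T.cons Q X Z Y x = 0 from LinearMap.congr_fun this t
  refine T.hom_ext Q fun p t => ?_
  rw [LinearMap.comp_apply, T.cons_of, TMap.unit, T.desc_of, PathMod.unit]
  rfl

theorem TMap.unit_word {X Y : S} {w : Word Q X Y} (hw : 0 < w.len) :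
    TMap.unit Q R φ X Y w.toT = 0 := by
  cases w with
  | nil => simp [Word.len] at hw
  | cons i x w => exact TMap.unit_cons _ _

/-- The projection `TQ → T⁰Q ⊆ TQ`. -/
noncomputable abbrev T.pi0 (Q : GradedQuiver k S) : TMap Q Q (fun X => X) (fun X => X) :=
  TMap.unit Q Q fun X => X

/-- The projection `TQ → T¹Q ⊆ TQ`. -/
noncomputable def T.pi1 (Q : GradedQuiver k S) : TMap Q Q (fun X => X) (fun X => X) :=
  fun X Y => T.in1 Q X Y ∘ₗ T.pr1 Q X Y

theorem T.pi1_word {X Y : S} {w : Word Q X Y} (hw : w.len ≠ 1) : T.pi1 Q X Y w.toT = 0 := by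
  rw [T.pi1, LinearMap.comp_apply, Word.pr1_toT hw, map_zero]

theorem T.pi1_one (X : S) : T.pi1 Q X X (T.one Q X) = 0 :=
  T.pi1_word (w := Word.nil X) (by simp [Word.len])

theorem T.pi1_in1 {X Y : S} (x : Q.Hom X Y) : T.pi1 Q X Y (T.in1 Q X Y x) = T.in1 Q X Y x := by
  rw [T.pi1, LinearMap.comp_apply, T.pr1_in1]

theorem T.pi0_in1 {X Y : S} (x : Q.Hom X Y) : T.pi0 Q X Y (T.in1 Q X Y x) = 0 :=
  TMap.unit_cons (φ := fun X => X) x (T.one Q Y)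

/-- A tensor x ⊗ t has length one exactly when t has length zero. -/
theorem T.pi1_cons {X Y Z : S} (x : Q.Hom X Z) (t : T Q Z Y) :
    T.pi1 Q X Y (T.cons Q X Z Y x t) = T.cons Q X Z Y x (T.pi0 Q Z Y t) := by
  suffices (T.pi1 Q X Y : T Q X Y →ₗ[k] T Q X Y) ∘ₗ T.cons Q X Z Y x =
      T.cons Q X Z Y x ∘ₗ (T.pi0 Q Z Y : T Q Z Y →ₗ[k] T Q Z Y) from LinearMap.congr_fun this t
  refine T.word_ext fun w => ?_
  rw [LinearMap.comp_apply, LinearMap.comp_apply]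
  rcases Nat.eq_zero_or_pos w.len with hw | hw
  · cases w with
    | nil => rw [Word.toT_nil, TMap.unit_one]; exact T.pi1_in1 x
    | cons i y w => simp [Word.len] at hw
  · rw [TMap.unit_word hw, map_zero]
    obtain ⟨p, hp, s, -, h⟩ := w.exists_path
    rw [h, T.cons_of, T.pi1, LinearMap.comp_apply, T.pr1_of, map_zero]
    simp only [ObjPath.len]
    omega

theorem T.pi0_mul {X Y Z : S} (x : T Q X Z) (y : T Q Z Y) :
    T.pi0 Q X Y (T.mul Q X Z Y (x ⊗ₜ y)) =
      T.mul Q X Z Y (T.pi0 Q X Z x ⊗ₜ T.pi0 Q Z Y y) := by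
  suffices T.pi0 Q X Y ∘ₗ (TensorProduct.curry (T.mul Q X Z Y)).flip y =
      (TensorProduct.curry (T.mul Q X Z Y)).flip (T.pi0 Q Z Y y) ∘ₗ T.pi0 Q X Z from
    LinearMap.congr_fun this x
  refine T.word_ext fun w => ?_
  simp only [LinearMap.comp_apply, LinearMap.flip_apply, TensorProduct.curry_apply]
  cases w with
  | nil X => simp only [Word.toT_nil, TMap.unit_one, T.one_mul]
  | cons i x w => 
    simp only [Word.toT_cons, TMap.unit_cons, T.cons_mul, TensorProduct.zero_tmul, map_zero]

/-- A product has length one exactly when its factors have lengths (1, 0) or (0, 1). -/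
theorem T.pi1_mul {X Y Z : S} (x : T Q X Z) (y : T Q Z Y) :
    T.pi1 Q X Y (T.mul Q X Z Y (x ⊗ₜ y)) =
      T.mul Q X Z Y (T.pi1 Q X Z x ⊗ₜ T.pi0 Q Z Y y) +
      T.mul Q X Z Y (T.pi0 Q X Z x ⊗ₜ T.pi1 Q Z Y y) := by
  suffices T.pi1 Q X Y ∘ₗ (TensorProduct.curry (T.mul Q X Z Y)).flip y =
      (TensorProduct.curry (T.mul Q X Z Y)).flip (T.pi0 Q Z Y y) ∘ₗ T.pi1 Q X Z +
      (TensorProduct.curry (T.mul Q X Z Y)).flip (T.pi1 Q Z Y y) ∘ₗ T.pi0 Q X Z from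
    LinearMap.congr_fun this x
  refine T.word_ext fun w => ?_
  simp only [LinearMap.comp_apply, LinearMap.flip_apply, TensorProduct.curry_apply,
    LinearMap.add_apply]
  cases w with
  | nil X => simp [Word.toT_nil, TMap.unit_one, T.one_mul, T.pi1_one]
  | cons i x w =>
    simp only [Word.toT_cons, TMap.unit_cons, T.cons_mul, TensorProduct.zero_tmul, map_zero,
      T.pi1_cons, T.pi0_mul, add_zero]

end

section

variable {k : Type u} [CommRing k] {S S' : Type u} {Q : GradedQuiver k S}
  {R : GradedQuiver k S'} {φ γ χ ψ : S → S'}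

/-! ### Convolution -/

theorem TMap.tensor_of (d : ℤ) (a : TMap Q R φ γ) (c : TMap Q R γ χ) {X Y Z : S} (x : T Q X Z)
    (y : T Q Z Y) : TMap.tensor d a c X Y (TT.of Q X Y Z (x ⊗ₜ y)) =
      TT.of R (φ X) (χ Y) (γ Z) (a X Z x ⊗ₜ c Z Y (T.sgn Q d Z Y y)) := by
  rw [TMap.tensor, TT.desc_of]
  rfl

theorem TMap.tensor_comul (d : ℤ) (a : TMap Q R φ γ) (c : TMap Q R γ χ) {X Y : S}
    (w : Word Q X Y) : TMap.tensor d a c X Y (T.comul Q X Y w.toT) = w.sum fun Z u v =>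
      sg k (d * v.deg) • TT.of R (φ X) (χ Y) (γ Z) (a X Z u.toT ⊗ₜ c Z Y v.toT) := by
  rw [Word.comul_toT, Word.map_sum]
  refine w.sum_congr fun Z u v _ _ => ?_
  rw [tensor_of, Word.sgn_toT, map_smul, TensorProduct.tmul_smul, map_smul]

theorem TMap.conv_toT (d : ℤ) (a : TMap Q R φ γ) (c : TMap Q R γ χ) {X Y : S}
    (w : Word Q X Y) : TMap.conv d a c X Y w.toT = w.sum fun Z u v =>
      sg k (d * v.deg) • T.mul R (φ X) (γ Z) (χ Y) (a X Z u.toT ⊗ₜ c Z Y v.toT) := by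
  rw [TMap.conv, LinearMap.comp_apply, LinearMap.comp_apply, tensor_comul, Word.map_sum]
  refine w.sum_congr fun Z u v _ _ => ?_
  rw [map_smul, TT.desc_of]

theorem TMap.ext_word {a c : TMap Q R φ γ}
    (h : ∀ X Y (w : Word Q X Y), a X Y w.toT = c X Y w.toT) : a = c :=
  funext fun X => funext fun Y => T.word_ext (h X Y)

theorem TMap.unit_conv (h : TMap Q R φ γ) : TMap.conv 0 (TMap.unit Q R φ) h = h := by
  refine TMap.ext_word fun X Y w => ?_
  rw [conv_toT, Word.sum_eq_first]
  · rw [Word.toT_nil, unit_one, T.one_mul, zero_mul, sg_zero, one_smul]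
  · intro Z u v hu _
    rw [unit_word hu, TensorProduct.zero_tmul, map_zero, smul_zero]

theorem TMap.conv_unit (d : ℤ) (f : TMap Q R φ γ) : TMap.conv d f (TMap.unit Q R γ) = f := by
  refine TMap.ext_word fun X Y w => ?_
  rw [conv_toT, Word.sum_eq_last]
  · rw [Word.toT_nil, unit_one, T.mul_one, Word.deg, mul_zero, sg_zero, one_smul]
  · intro Z u v hu _
    rw [unit_word hu, TensorProduct.tmul_zero, map_zero, smul_zero]

theorem TMap.HasDegree.of_word {a : TMap Q R φ γ} {d : ℤ}
    (h : ∀ X Y (w : Word Q X Y), a X Y w.toT ∈ T.gr R (φ X) (γ Y) (w.deg + d)) :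
    a.HasDegree d := by
  intro X Y i t ht
  suffices T.gr Q X Y i ≤ (T.gr R (φ X) (γ Y) (i + d)).comap (a X Y) from this ht
  refine (T.gr_le_span Q X Y i).trans (Submodule.span_le.2 ?_)
  rintro _ ⟨w, rfl, rfl⟩
  exact h X Y w

theorem TMap.HasDegree.word {a : TMap Q R φ γ} {d : ℤ} (h : a.HasDegree d) {X Y : S}
    (w : Word Q X Y) : a X Y w.toT ∈ T.gr R (φ X) (γ Y) (w.deg + d) :=
  h X Y _ _ w.toT_mem_gr

theorem Word.sum_mem {M : Type u} [AddCommMonoid M] [Module k M] {X Y : S} {w : Word Q X Y}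
    {F : ∀ Z, Word Q X Z → Word Q Z Y → M} (N : Submodule k M)
    (h : ∀ Z u v, u.len + v.len = w.len → u.deg + v.deg = w.deg → F Z u v ∈ N) : w.sum F ∈ N := by
  induction w with
  | nil X => exact h _ _ _ rfl rfl
  | cons i x w ih =>
    refine N.add_mem (h _ _ _ (by simp [len]) (by simp [deg])) (ih fun Z u v h1 h2 => h _ _ _ ?_ ?_)
    · simp only [len]; omega
    · simp only [deg]; omega

/-- The parameter `d'` only contributes signs, so it need not equal the degree of `a`. -/
theorem TMap.HasDegree.conv {a : TMap Q R φ γ} {c : TMap Q R γ χ} {d e : ℤ} (ha : a.HasDegree d)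
    (hc : c.HasDegree e) (d' : ℤ) : (TMap.conv d' a c).HasDegree (d + e) := by
  refine .of_word fun X Y w => ?_
  rw [conv_toT]
  refine Word.sum_mem _ fun Z u v _ hd => Submodule.smul_mem _ _ ?_
  have := T.mul_mem_gr (ha.word u) (hc.word v)
  rwa [show u.deg + d + (v.deg + e) = w.deg + (d + e) by rw [← hd]; ring] at this

/-! ### Comultiplication of convolutions. -/

variable (Q R) in
/-- Families of linear maps `(TQ ⊗ TQ)(X, Y) → (TR ⊗ TR)(Xφ, Yγ)`. -/
abbrev TTMap (φ γ : S → S') : Type u := ∀ X Y : S, TT Q X Y →ₗ[k] TT R (φ X) (γ Y)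

theorem TTMap.add_apply (U V : TTMap Q R φ γ) {X Y : S} (z : TT Q X Y) :
    (U + V) X Y z = U X Y z + V X Y z := rfl

/-- The condition `u Δ = Δ U`. -/
def TMap.HasComul (u : TMap Q R φ γ) (U : TTMap Q R φ γ) : Prop :=
  ∀ X Y, T.comul R (φ X) (γ Y) ∘ₗ u X Y = U X Y ∘ₗ T.comul Q X Y

theorem TMap.HasComul.apply {u : TMap Q R φ γ} {U : TTMap Q R φ γ} (h : u.HasComul U) {X Y : S}
    (t : T Q X Y) : T.comul R (φ X) (γ Y) (u X Y t) = U X Y (T.comul Q X Y t) :=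
  LinearMap.congr_fun (h X Y) t

/-- `U'` is the convolution of the second component of `U` with `v`. -/
def RightConv (d : ℤ) (v : TMap Q R γ χ) (U : TTMap Q R φ γ) (U' : TTMap Q R φ χ) : Prop :=
  ∀ X Y (w : Word Q X Y), (w.sum fun Z a b => sg k (d * b.deg) •
    TT.rmul R (φ X) (γ Z) (χ Y) (v Z Y b.toT) (U X Z (T.comul Q X Z a.toT))) =
      U' X Y (T.comul Q X Y w.toT)

/-- `V'` is the convolution of `u` with the first component of `V`. -/
def LeftConv (d : ℤ) (u : TMap Q R φ γ) (V : TTMap Q R γ χ) (V' : TTMap Q R φ χ) : Prop :=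
  ∀ X Y (w : Word Q X Y), (w.sum fun Z a b => sg k (d * b.deg) •
    TT.lmul R (φ X) (γ Z) (χ Y) (u X Z a.toT) (V Z Y (T.comul Q Z Y b.toT))) =
      V' X Y (T.comul Q X Y w.toT)

theorem RightConv.add {d : ℤ} {v : TMap Q R γ χ} {U₁ U₂ : TTMap Q R φ γ} {U₁' U₂' : TTMap Q R φ χ}
    (h₁ : RightConv d v U₁ U₁') (h₂ : RightConv d v U₂ U₂') :
    RightConv d v (U₁ + U₂) (U₁' + U₂') := by
  intro X Y w
  rw [TTMap.add_apply, ← h₁, ← h₂, ← Word.sum_add]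
  refine w.sum_congr fun Z u v _ _ => ?_
  rw [TTMap.add_apply, map_add, smul_add]

theorem LeftConv.add {d : ℤ} {u : TMap Q R φ γ} {V₁ V₂ : TTMap Q R γ χ} {V₁' V₂' : TTMap Q R φ χ}
    (h₁ : LeftConv d u V₁ V₁') (h₂ : LeftConv d u V₂ V₂') :
    LeftConv d u (V₁ + V₂) (V₁' + V₂') := by
  intro X Y w
  rw [TTMap.add_apply, ← h₁, ← h₂, ← Word.sum_add]
  refine w.sum_congr fun Z u v _ _ => ?_
  rw [TTMap.add_apply, map_add, smul_add]

/-- This is coassociativity with signs: the parameter is `e + d` because both `a` and `c` pass the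
argument of `v`. -/
theorem rightConv_tensor (e d : ℤ) (a : TMap Q R φ ψ) (c : TMap Q R ψ γ) (v : TMap Q R γ χ) :
    RightConv (e + d) v (TMap.tensor e a c) (TMap.tensor e a (TMap.conv d c v)) := by
  intro X Y w
  rw [TMap.tensor_comul]
  calc _ = w.sum fun Z u r => u.sum fun W s t => (sg k ((e + d) * r.deg) * sg k (e * t.deg)) •
        TT.of R (φ X) (χ Y) (ψ W) (a X W s.toT ⊗ₜ
          T.mul R (ψ W) (γ Z) (χ Y) (c W Z t.toT ⊗ₜ v Z Y r.toT)) := by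
        refine w.sum_congr fun Z u r _ _ => ?_
        rw [TMap.tensor_comul, Word.map_sum, ← DistribSMul.toAddMonoidHom_apply, Word.map_sum]
        refine u.sum_congr fun W s t _ _ => ?_
        rw [map_smul, TT.rmul_of, DistribSMul.toAddMonoidHom_apply, smul_smul]
    _ = _ := by
        rw [Word.sum_assoc]
        refine w.sum_congr fun W s r _ _ => ?_
        rw [TMap.conv_toT]
        change _ = ((sg k (e * r.deg)) • (TT.of R (φ X) (χ Y) (ψ W) ∘ₗ
          TensorProduct.mk k _ _ (a X W s.toT))) _
        rw [Word.map_sum]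
        refine r.sum_congr fun Z t u _ hd => ?_
        rw [map_smul, LinearMap.smul_apply, smul_smul, ← hd]
        congr 1
        rw [← sg_add, ← sg_add]
        congr 1
        ring

/-- Mirror image of `rightConv_tensor`: now `u` and `a` together pass the argument of `c`. -/
theorem leftConv_tensor (e d : ℤ) (u : TMap Q R φ γ) (a : TMap Q R γ ψ) (c : TMap Q R ψ χ) :
    LeftConv d u (TMap.tensor e a c) (TMap.tensor (d + e) (TMap.conv d u a) c) := by
  intro X Y w
  rw [TMap.tensor_comul]
  symm
  calc _ = w.sum fun Z s r => s.sum fun W p q => (sg k ((d + e) * r.deg) * sg k (d * q.deg)) •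
        TT.of R (φ X) (χ Y) (ψ Z) (T.mul R (φ X) (γ W) (ψ Z) (u X W p.toT ⊗ₜ a W Z q.toT) ⊗ₜ
          c Z Y r.toT) := by
        refine w.sum_congr fun Z s r _ _ => ?_
        rw [TMap.conv_toT]
        change ((sg k ((d + e) * r.deg)) • (TT.of R (φ X) (χ Y) (ψ Z) ∘ₗ
          (TensorProduct.mk k _ _).flip (c Z Y r.toT))) _ = _
        rw [Word.map_sum]
        refine s.sum_congr fun W p q _ _ => ?_
        rw [map_smul, LinearMap.smul_apply, smul_smul, mul_comm]
        rfl
    _ = _ := by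
        rw [Word.sum_assoc]
        refine w.sum_congr fun W p r _ _ => ?_
        rw [TMap.tensor_comul, Word.map_sum, ← DistribSMul.toAddMonoidHom_apply, Word.map_sum]
        refine r.sum_congr fun Z q s _ hd => ?_
        rw [map_smul, TT.lmul_of, DistribSMul.toAddMonoidHom_apply, smul_smul, ← hd]
        congr 1
        rw [← sg_add, ← sg_add]
        congr 1
        ring

theorem TT.add_right_cancel {X Y : S} {x y z : TT Q X Y} (h : x + z = y + z) : x = y := by
  have hz : z + (-1 : k) • z = 0 := by
    conv_lhs => rw [← one_smul k z, smul_smul, ← add_smul]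
    rw [mul_one, add_neg_cancel, zero_smul]
  have := congrArg (· + (-1 : k) • z) h
  simpa only [add_assoc, hz, add_zero] using this

/-- The comultiplication of a convolution. -/
theorem TMap.HasComul.conv {d : ℤ} {u : TMap Q R φ γ} {v : TMap Q R γ χ} {U : TTMap Q R φ γ}
    {V : TTMap Q R γ χ} {U' V' W : TTMap Q R φ χ} (hu : u.HasComul U) (hv : v.HasComul V)
    (hU : RightConv d v U U') (hV : LeftConv d u V V') (hW : U' + V' = W + TMap.tensor d u v) :
    (TMap.conv d u v).HasComul W := by
  intro X Y
  refine T.word_ext fun w => TT.add_right_cancel (z := TMap.tensor d u v X Y (T.comul Q X Y w.toT))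
    ?_
  have hW' : U' X Y (T.comul Q X Y w.toT) + V' X Y (T.comul Q X Y w.toT) =
      W X Y (T.comul Q X Y w.toT) + TMap.tensor d u v X Y (T.comul Q X Y w.toT) := by
    rw [← TTMap.add_apply, hW]
    rfl
  rw [LinearMap.comp_apply, LinearMap.comp_apply, ← hW', ← hU, ← hV, TMap.conv_toT, tensor_comul,
    Word.map_sum, ← Word.sum_add, ← Word.sum_add]
  -- For each cut of `w`, the infinitesimal bialgebra rule is applied to the product of the two
  -- values; its extra term is what produces `TMap.tensor d u v`.
  refine w.sum_congr fun Z a b _ _ => ?_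
  rw [map_smul, ← smul_add, T.comul_mul, smul_add, hu.apply, hv.apply]

/-- Elements of T¹ are primitive: Δ(x) = 1 ⊗ x + x ⊗ 1. The value of `d` is immaterial, since its
sign is attached to the empty right piece. -/
theorem in1_hasComul (d : ℤ) (a : ∀ X Y : S, T Q X Y →ₗ[k] R.Hom (φ X) (γ Y)) :
    TMap.HasComul (fun X Y => T.in1 R (φ X) (γ Y) ∘ₗ a X Y)
      (TMap.tensor 0 (TMap.unit Q R φ) (fun X Y => T.in1 R (φ X) (γ Y) ∘ₗ a X Y) +
        TMap.tensor d (fun X Y => T.in1 R (φ X) (γ Y) ∘ₗ a X Y) (TMap.unit Q R γ)) := by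
  intro X Y
  refine T.word_ext fun w => ?_
  have h : ∀ x, T.comul R (φ X) (γ Y) (T.in1 R (φ X) (γ Y) x) =
      TT.of R (φ X) (γ Y) (φ X) (T.one R (φ X) ⊗ₜ T.in1 R (φ X) (γ Y) x) +
      TT.of R (φ X) (γ Y) (γ Y) (T.in1 R (φ X) (γ Y) x ⊗ₜ T.one R (γ Y)) := by
    intro x
    rw [show T.in1 R (φ X) (γ Y) x = T.cons R _ _ _ x (T.one R (γ Y)) from rfl, T.comul_cons, T.comul_one, TT.cons_of]
  rw [LinearMap.comp_apply, LinearMap.comp_apply, LinearMap.comp_apply, h, TTMap.add_apply, TMap.tensor_comul, TMap.tensor_comul, Word.sum_eq_first,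
    Word.sum_eq_last]
  · simp only [Word.toT_nil, TMap.unit_one, Word.deg, mul_zero, zero_mul, sg_zero, one_smul]
    rfl
  · intro Z u v hu _
    rw [TMap.unit_word hu, TensorProduct.tmul_zero, map_zero, smul_zero]
  · intro Z u v hu _
    rw [TMap.unit_word hu, TensorProduct.zero_tmul, map_zero, smul_zero]

/-- The term f ⊗ v in excess in the rule for a convolution cancels against the term unit ⊗ v of `v`,
which becomes f ⊗ v after convolution with `f`. -/
theorem TMap.HasComul.conv_left {f : TMap Q R φ φ} {v : TMap Q R φ χ} {W W' : TTMap Q R φ χ}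
    (hf : f.HasComul (TMap.tensor 0 f f))
    (hv : v.HasComul (TMap.tensor 0 (TMap.unit Q R φ) v + W)) (hW : LeftConv 0 f W W') :
    (TMap.conv 0 f v).HasComul (TMap.tensor 0 f (TMap.conv 0 f v) + W') := by
  refine hf.conv hv (rightConv_tensor 0 0 f f v)
    ((leftConv_tensor 0 0 f (TMap.unit Q R φ) v).add hW) ?_
  rw [conv_unit, zero_add]
  abel

/-- Here the excess a ⊗ v cancels against a ⊗ unit, whose second factor becomes `v` after
convolution. -/
theorem TMap.HasComul.conv_in1 {d : ℤ} {a : TMap Q R φ γ} {v : TMap Q R γ χ} {W : TTMap Q R γ χ}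
    {W' : TTMap Q R φ χ} (ha : a.HasComul (TMap.tensor 0 (TMap.unit Q R φ) a +
      TMap.tensor d a (TMap.unit Q R γ)))
    (hv : v.HasComul W) (hW : LeftConv d a W W') :
    (TMap.conv d a v).HasComul (TMap.tensor 0 (TMap.unit Q R φ) (TMap.conv d a v) + W') := by
  have h1 := rightConv_tensor 0 d (TMap.unit Q R φ) a v
  have h2 := rightConv_tensor d 0 a (TMap.unit Q R γ) v
  rw [zero_add] at h1
  rw [add_zero, unit_conv] at h2
  refine ha.conv hv (h1.add h2) hW ?_
  abel

theorem TMap.HasComul.coderivation {d : ℤ} {f : TMap Q R φ φ} {h : TMap Q R χ χ} {a : TMap Q R φ χ}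
    (hf : f.HasComul (TMap.tensor 0 f f)) (hh : h.HasComul (TMap.tensor 0 h h))
    (ha : a.HasComul (TMap.tensor 0 (TMap.unit Q R φ) a + TMap.tensor d a (TMap.unit Q R χ))) :
    (TMap.conv 0 f (TMap.conv d a h)).HasComul
      (TMap.tensor 0 f (TMap.conv 0 f (TMap.conv d a h)) +
        TMap.tensor d (TMap.conv 0 f (TMap.conv d a h)) h) := by
  have h1 := leftConv_tensor 0 d a h h
  rw [add_zero] at h1
  have h2 := leftConv_tensor d 0 f (TMap.conv d a h) h
  rw [zero_add] at h2
  exact hf.conv_left (ha.conv_in1 hh h1) h2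

/-- A cut of θ falls to the left of the factor `a`, between `a` and the distinguished factor of `p`,
or to the right of the latter. In the middle case the left piece is the coderivation with components
`a`. -/
theorem TMap.HasComul.theta {d e : ℤ} {f : TMap Q R φ φ} {g : TMap Q R γ γ} {h : TMap Q R χ χ}
    {a : TMap Q R φ γ} {p : TMap Q R γ χ} (hf : f.HasComul (TMap.tensor 0 f f))
    (ha : a.HasComul (TMap.tensor 0 (TMap.unit Q R φ) a + TMap.tensor d a (TMap.unit Q R γ)))
    (hp : p.HasComul (TMap.tensor 0 g p + TMap.tensor e p h)) :
    (TMap.conv 0 f (TMap.conv d a p)).HasComul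
      (TMap.tensor 0 f (TMap.conv 0 f (TMap.conv d a p)) +
        (TMap.tensor d (TMap.conv 0 f (TMap.conv d a g)) p +
          TMap.tensor (d + e) (TMap.conv 0 f (TMap.conv d a p)) h)) := by
  have h1 := (leftConv_tensor 0 d a g p).add (leftConv_tensor e d a p h)
  rw [add_zero] at h1
  have h2 := (leftConv_tensor d 0 f (TMap.conv d a g) p).add
    (leftConv_tensor (d + e) 0 f (TMap.conv d a p) h)
  rw [zero_add, zero_add] at h2
  exact hf.conv_left (ha.conv_in1 hp h1) h2

/-! ### Coderivations are determined by their components -/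

theorem TMap.unit_of {X Y : S} (p : ObjPath S X Y) (t : PathMod Q p) :
    TMap.unit Q R φ X Y (T.of Q p t) = PathMod.unit R φ p t :=
  T.desc_of Q _ p t

theorem T.pi0_eq {X : S} (z : T Q X X) : T.pi0 Q X X z = T.counit Q X X z • T.one Q X := by
  suffices (T.pi0 Q X X : T Q X X →ₗ[k] T Q X X) =
      (LinearMap.toSpanSingleton k _ (T.one Q X)) ∘ₗ T.counit Q X X from LinearMap.congr_fun this z
  refine T.hom_ext Q fun p t => ?_
  rw [LinearMap.comp_apply, TMap.unit_of, T.counit, T.desc_of]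
  cases p with
  | nil => rfl
  | cons p => simp [PathMod.unit, PathMod.counit]

theorem T.pi0_eq_zero {X Y : S} {z : T Q X Y} (hz : T.counit Q X Y z = 0) : T.pi0 Q X Y z = 0 := by
  by_cases h : X = Y
  · subst h
    rw [T.pi0_eq, hz, zero_smul]
  · suffices (T.pi0 Q X Y : T Q X Y →ₗ[k] T Q X Y) = 0 from LinearMap.congr_fun this z
    refine T.hom_ext Q fun p t => ?_
    rw [TMap.unit_of]
    cases p with
    | nil => exact absurd rfl h
    | cons p => rfl

theorem T.counit_one (X : S) : T.counit Q X X (T.one Q X) = 1 := by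
  rw [T.counit, T.one, T.desc_of]
  exact LinearEquiv.apply_symm_apply _ _

theorem T.counit_cons {X Y Z : S} (x : Q.Hom X Z) (t : T Q Z Y) :
    T.counit Q X Y (T.cons Q X Z Y x t) = 0 := by
  suffices T.counit Q X Y ∘ₗ T.cons Q X Z Y x = 0 from LinearMap.congr_fun this t
  refine T.hom_ext Q fun p t => ?_
  rw [LinearMap.comp_apply, T.cons_of, T.counit, T.desc_of]
  rfl

theorem IsCocategoryHom.pi0_apply {f : TMap Q R φ φ} (hf : IsCocategoryHom f) {X Y : S}
    (w : Word Q X Y) : T.pi0 R (φ X) (φ Y) (f X Y w.toT) = TMap.unit Q R φ X Y w.toT := by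
  cases w with
  | nil =>
    have := LinearMap.congr_fun (hf.counit X X) (T.one Q X)
    rw [LinearMap.comp_apply, T.counit_one] at this
    rw [Word.toT_nil, T.pi0_eq, this, one_smul, TMap.unit_one]
  | cons i x w =>
    rw [Word.toT_cons, TMap.unit_cons]
    refine T.pi0_eq_zero ?_
    have := LinearMap.congr_fun (hf.counit X Y) (T.cons Q _ _ _ x.1 w.toT)
    rwa [LinearMap.comp_apply, T.counit_cons] at this

variable (Q) in
/-- The map `x ⊗ y ↦ (xa)(yc)`. -/
noncomputable def TT.mulMap (a c : TMap Q Q (fun X => X) (fun X => X)) (X Y : S) :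
    TT Q X Y →ₗ[k] T Q X Y :=
  TT.desc Q fun W => T.mul Q X W Y ∘ₗ TensorProduct.map (a X W) (c W Y)

theorem TT.mulMap_of (a c : TMap Q Q (fun X => X) (fun X => X)) {X Y Z : S} (x : T Q X Z)
    (y : T Q Z Y) : TT.mulMap Q a c X Y (TT.of Q X Y Z (x ⊗ₜ y)) =
      T.mul Q X Z Y (a X Z x ⊗ₜ c Z Y y) := by
  rw [TT.mulMap, TT.desc_of]
  rfl

/-- A nonempty word is recovered from its unique cut whose left piece has length one; the empty word
has no such cut and is supplied by `T.pi0`. -/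
theorem T.mulMap_pi1 {X Y : S} (t : T Q X Y) :
    T.pi0 Q X Y t + TT.mulMap Q (T.pi1 Q) (TMap.one Q) X Y (T.comul Q X Y t) = t := by
  suffices (T.pi0 Q X Y : T Q X Y →ₗ[k] T Q X Y) +
      TT.mulMap Q (T.pi1 Q) (TMap.one Q) X Y ∘ₗ T.comul Q X Y = LinearMap.id from
    LinearMap.congr_fun this t
  refine T.word_ext fun w => ?_
  rw [LinearMap.add_apply, LinearMap.comp_apply, Word.comul_toT, Word.map_sum]
  cases w with
  | nil X =>
    rw [Word.sum, TT.mulMap_of, Word.toT_nil, TMap.unit_one, T.pi1_one, TensorProduct.zero_tmul,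
      map_zero, add_zero, LinearMap.id_apply]
  | cons i x w =>
    rw [Word.sum, TT.mulMap_of, Word.toT_nil, Word.toT_cons, TMap.unit_cons, T.pi1_one,
      TensorProduct.zero_tmul, map_zero, zero_add, zero_add, Word.sum_eq_first, TT.mulMap_of,
      Word.toT_cons, Word.toT_nil, T.pi1_cons, TMap.unit_one, T.cons_mul, T.one_mul]
    · rfl
    · intro Z u v hu _
      rw [TT.mulMap_of, Word.toT_cons, T.pi1_cons, TMap.unit_word hu, map_zero,
        TensorProduct.zero_tmul, map_zero]

theorem T.mulMap_pi0 {X Y : S} (t : T Q X Y) :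
    TT.mulMap Q (T.pi0 Q) (T.pi0 Q) X Y (T.comul Q X Y t) = T.pi0 Q X Y t := by
  suffices TT.mulMap Q (T.pi0 Q) (T.pi0 Q) X Y ∘ₗ T.comul Q X Y =
    (T.pi0 Q X Y : T Q X Y →ₗ[k] T Q X Y) from LinearMap.congr_fun this t
  refine T.word_ext fun w => ?_
  rw [LinearMap.comp_apply, Word.comul_toT, Word.map_sum, Word.sum_eq_first]
  · rw [TT.mulMap_of, Word.toT_nil, TMap.unit_one, T.one_mul]
  · intro Z u v hu _
    rw [TT.mulMap_of, TMap.unit_word hu, TensorProduct.zero_tmul, map_zero]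

/-- The element z = f(1) satisfies Δ(z) = z ⊗ z, so splitting off the first tensor factor gives z =
pi0(z) + pi1(z)z, where pi0(z) = 1 by the counit and pi1(z) = 0. -/
theorem IsCocategoryHom.map_one {f : TMap Q R φ φ} (hf : IsCocategoryHom f) {X : S}
    (h0 : T.pr1 R (φ X) (φ X) (f X X (T.one Q X)) = 0) : f X X (T.one Q X) = T.one R (φ X) := by
  have h1 := LinearMap.congr_fun (hf.comul X X) (T.one Q X)
  rw [LinearMap.comp_apply, LinearMap.comp_apply, T.comul_one, TMap.tensor_of, T.sgn_one] at h1
  have h2 := hf.pi0_apply (Word.nil X)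
  rw [Word.toT_nil, TMap.unit_one] at h2
  rw [← T.mulMap_pi1 (f X X (T.one Q X)), h1, TT.mulMap_of, h2, T.pi1, LinearMap.comp_apply, h0,
    map_zero, TensorProduct.zero_tmul, map_zero, add_zero]

section

variable {f : TMap Q R φ φ} {h : TMap Q R χ χ} {E : TMap Q R φ χ} {d : ℤ}

theorem IsCoderivation.mulMap_word (hE : IsCoderivation f h d E)
    (a c : TMap R R (fun X => X) (fun X => X)) {X Y : S} (w : Word Q X Y) :
    TT.mulMap R a c (φ X) (χ Y) (T.comul R (φ X) (χ Y) (E X Y w.toT)) =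
      (w.sum fun Z u v => T.mul R (φ X) (φ Z) (χ Y)
        (a _ _ (f X Z u.toT) ⊗ₜ c _ _ (E Z Y v.toT))) +
      w.sum fun Z u v => sg k (d * v.deg) • T.mul R (φ X) (χ Z) (χ Y)
        (a _ _ (E X Z u.toT) ⊗ₜ c _ _ (h Z Y v.toT)) := by
  have := LinearMap.congr_fun (hE.comul X Y) w.toT
  rw [LinearMap.comp_apply, LinearMap.comp_apply, LinearMap.add_apply, TMap.tensor_comul,
    TMap.tensor_comul] at this
  rw [this, map_add, Word.map_sum, Word.map_sum]
  congr 1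
  · refine w.sum_congr fun Z u v _ _ => ?_
    rw [zero_mul, sg_zero, one_smul, TT.mulMap_of]
  · refine w.sum_congr fun Z u v _ _ => ?_
    rw [map_smul, TT.mulMap_of]

/-- Applying pi0 ⊗ pi0 to the coderivation identity gives z = z + z for the length-zero part z of
the value. -/
theorem IsCoderivation.pi0_eq_zero (hf : IsCocategoryHom f) (hh : IsCocategoryHom h)
    (hE : IsCoderivation f h d E) {X Y : S} (w : Word Q X Y) :
    T.pi0 R (φ X) (χ Y) (E X Y w.toT) = 0 := by
  have := hE.mulMap_word (T.pi0 R) (T.pi0 R) w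
  rw [T.mulMap_pi0, Word.sum_eq_first, Word.sum_eq_last, hf.pi0_apply, hh.pi0_apply, Word.toT_nil,
    TMap.unit_one, Word.toT_nil, TMap.unit_one, T.one_mul, T.mul_one, Word.deg, mul_zero, sg_zero,
    one_smul] at this
  · exact left_eq_add.1 this
  · intro Z u v hv _
    rw [hh.pi0_apply, TMap.unit_word hv, TensorProduct.tmul_zero, map_zero, smul_zero]
  · intro Z u v hu _
    rw [hf.pi0_apply, TMap.unit_word hu, TensorProduct.zero_tmul, map_zero]

/-- Splitting off the first tensor factor of the value: it comes either from a component of `f` or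
from a component of `E`. This recursion is what makes coderivations determined by their components.
-/
theorem IsCoderivation.eq_sum (hf : IsCocategoryHom f) (hh : IsCocategoryHom h)
    (hE : IsCoderivation f h d E) {X Y : S} (w : Word Q X Y) :
    E X Y w.toT = (w.sum fun Z u v => T.mul R (φ X) (φ Z) (χ Y)
        (T.pi1 R _ _ (f X Z u.toT) ⊗ₜ E Z Y v.toT)) +
      w.sum fun Z u v => sg k (d * v.deg) • T.mul R (φ X) (χ Z) (χ Y)
        (T.pi1 R _ _ (E X Z u.toT) ⊗ₜ h Z Y v.toT) := by
  have := T.mulMap_pi1 (E X Y w.toT)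
  rw [hE.pi0_eq_zero hf hh, zero_add, hE.mulMap_word] at this
  exact this.symm

/-- A coderivation with zero components is zero. -/
theorem IsCoderivation.eq_zero (hf : IsCocategoryHom f) (hh : IsCocategoryHom h)
    (hf0 : ∀ X, T.pr1 R (φ X) (φ X) (f X X (T.one Q X)) = 0)
    (hE : IsCoderivation f h d E)
    (h0 : ∀ X Y (w : Word Q X Y), T.pr1 R (φ X) (χ Y) (E X Y w.toT) = 0) : E = 0 := by
  refine TMap.ext_word fun X Y w => ?_
  induction hn : w.len using Nat.strong_induction_on generalizing X w with
  | _ n ih =>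
    rw [hE.eq_sum hf hh, Word.sum_congr (G := fun _ _ _ => 0),
      Word.sum_congr (F := fun Z u v => sg k (d * v.deg) • T.mul R (φ X) (χ Z) (χ Y)
        (T.pi1 R _ _ (E X Z u.toT) ⊗ₜ h Z Y v.toT)) (G := fun _ _ _ => 0), Word.sum_zero, add_zero]
    · rfl
    · intro Z u v _ _
      rw [T.pi1, LinearMap.comp_apply, h0, map_zero, TensorProduct.zero_tmul, map_zero, smul_zero]
    · intro Z u v hl _
      -- The empty `u` contributes nothing because f₀ = 0; otherwise `v` is strictly shorter than
      -- `w` and the induction applies.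
      cases u with
      | nil =>
        rw [Word.toT_nil, T.pi1, LinearMap.comp_apply, hf0, map_zero, TensorProduct.zero_tmul,
          map_zero]
      | cons i x u =>
        rw [ih v.len (by simp only [Word.len] at hl; omega) _ v rfl]
        exact (congrArg _ (TensorProduct.tmul_zero _ _)).trans (map_zero _)

end

end

section

variable {k : Type u} [CommRing k] {S S' : Type u} {Q : GradedQuiver k S}
  {R : GradedQuiver k S'} {φ γ χ ψ : S → S'}

/-! ### Composition with endomorphisms of tensor quivers -/

/-- The composite of `a : TQ → TR` with an endomorphism of `TR`. -/
noncomputable def TMap.post (b : TMap R R (fun X => X) (fun X => X)) (a : TMap Q R φ γ) :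
    TMap Q R φ γ := fun X Y => b (φ X) (γ Y) ∘ₗ a X Y

/-- The composite of an endomorphism of `TQ` with `a : TQ → TR`. -/
noncomputable def TMap.pre (a : TMap Q R φ γ) (b : TMap Q Q (fun X => X) (fun X => X)) :
    TMap Q R φ γ := fun X Y => a X Y ∘ₗ b X Y

theorem T.sgn_sgn (d e : ℤ) {X Y : S} (t : T Q X Y) :
    T.sgn Q d X Y (T.sgn Q e X Y t) = T.sgn Q (e + d) X Y t := by
  suffices T.sgn Q d X Y ∘ₗ T.sgn Q e X Y = T.sgn Q (e + d) X Y from LinearMap.congr_fun this t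
  refine T.word_ext fun w => ?_
  rw [LinearMap.comp_apply, Word.sgn_toT, Word.sgn_toT, map_smul, Word.sgn_toT, smul_smul, add_mul,
    sg_add]

theorem TMap.HasDegree.sgn_apply {a : TMap Q R φ γ} {e : ℤ} (ha : a.HasDegree e) (d : ℤ) {X Y : S}
    (t : T Q X Y) : T.sgn R d (φ X) (γ Y) (a X Y t) = sg k (d * e) • a X Y (T.sgn Q d X Y t) := by
  suffices T.sgn R d (φ X) (γ Y) ∘ₗ a X Y = sg k (d * e) • (a X Y ∘ₗ T.sgn Q d X Y) from
    LinearMap.congr_fun this t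
  refine T.word_ext fun w => ?_
  rw [LinearMap.comp_apply, LinearMap.smul_apply, LinearMap.comp_apply, T.sgn_apply d (ha.word w),
    Word.sgn_toT, map_smul, smul_smul, mul_add, sg_add, mul_comm]

/-- The Koszul rule (a ⊗ c)(a' ⊗ c') = ± aa' ⊗ cc': the sign comes from moving a' past c. -/
theorem TMap.tensor_post (d d' e : ℤ) (a : TMap Q R φ γ) {c : TMap Q R γ χ} (hc : c.HasDegree e)
    (a' c' : TMap R R (fun X => X) (fun X => X)) {X Y : S} (z : TT Q X Y) :
    TMap.tensor d' a' c' (φ X) (χ Y) (TMap.tensor d a c X Y z) =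
      sg k (d' * e) • TMap.tensor (d + d') (TMap.post a' a) (TMap.post c' c) X Y z := by
  suffices TMap.tensor d' a' c' (φ X) (χ Y) ∘ₗ TMap.tensor d a c X Y =
    sg k (d' * e) • TMap.tensor (d + d') (TMap.post a' a) (TMap.post c' c) X Y from LinearMap.congr_fun this z
  refine TT.hom_ext Q fun Z x y => ?_
  rw [LinearMap.comp_apply, LinearMap.smul_apply, tensor_of, tensor_of, tensor_of, hc.sgn_apply,
    T.sgn_sgn, map_smul, TensorProduct.tmul_smul, map_smul]
  rfl

theorem TMap.tensor_pre (d d' e : ℤ) (a : TMap Q R φ γ) (c : TMap Q R γ χ)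
    (a' : TMap Q Q (fun X => X) (fun X => X)) {c' : TMap Q Q (fun X => X) (fun X => X)}
    (hc : c'.HasDegree e) {X Y : S} (z : TT Q X Y) :
    TMap.tensor d a c X Y (TMap.tensor d' a' c' X Y z) =
      sg k (d * e) • TMap.tensor (d' + d) (a.pre a') (c.pre c') X Y z := by
  suffices TMap.tensor d a c X Y ∘ₗ TMap.tensor d' a' c' X Y =
    sg k (d * e) • TMap.tensor (d' + d) (a.pre a') (c.pre c') X Y from LinearMap.congr_fun this z
  refine TT.hom_ext Q fun Z x y => ?_
  rw [LinearMap.comp_apply, LinearMap.smul_apply, tensor_of, tensor_of, tensor_of, hc.sgn_apply,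
    T.sgn_sgn, map_smul, TensorProduct.tmul_smul, map_smul]
  rfl

theorem TMap.one_hasDegree : (TMap.one Q).HasDegree 0 := by
  intro X Y i t ht
  rw [add_zero]
  exact ht

theorem TMap.post_one (a : TMap Q R φ γ) : TMap.post (TMap.one R) a = a := rfl

theorem TMap.pre_one (a : TMap Q R φ γ) : TMap.pre a (TMap.one Q) = a := rfl

theorem TMap.HasDegree.post {b : TMap R R (fun X => X) (fun X => X)} {a : TMap Q R φ γ} {d e : ℤ}
    (ha : a.HasDegree d) (hb : b.HasDegree e) : (TMap.post b a).HasDegree (d + e) := by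
  intro X Y i t ht
  rw [← add_assoc]
  exact hb _ _ _ _ (ha _ _ _ _ ht)

theorem TMap.HasDegree.pre {b : TMap Q Q (fun X => X) (fun X => X)} {a : TMap Q R φ γ} {d e : ℤ}
    (ha : a.HasDegree d) (hb : b.HasDegree e) : (TMap.pre a b).HasDegree (d + e) := by
  intro X Y i t ht
  rw [add_comm d e, ← add_assoc]
  exact ha _ _ _ _ (hb _ _ _ _ ht)

theorem TMap.HasDegree.add {a c : TMap Q R φ γ} {d : ℤ} (ha : a.HasDegree d) (hc : c.HasDegree d) :
    (a + c).HasDegree d :=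
  fun X Y i t ht => Submodule.add_mem _ (ha X Y i t ht) (hc X Y i t ht)

theorem TMap.HasDegree.smul {a : TMap Q R φ γ} {d : ℤ} (ha : a.HasDegree d) (s : k) :
    (s • a).HasDegree d :=
  fun X Y i t ht => Submodule.smul_mem _ s (ha X Y i t ht)

theorem TMap.eq_neg_smul_of_add_eq_zero {a c : TMap Q R φ γ} (h : a + c = 0) :
    a = (-1 : k) • c := by
  refine funext fun X => funext fun Y => LinearMap.ext fun t => ?_
  have h1 : a X Y t + c X Y t = 0 := LinearMap.congr_fun (congrFun (congrFun h X) Y) t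
  exact (eq_neg_of_add_eq_zero_left h1).trans (neg_one_smul k _).symm

theorem TMap.tensor_add_right (d : ℤ) (a : TMap Q R φ γ) (c c' : TMap Q R γ χ) {X Y : S}
    (z : TT Q X Y) : TMap.tensor d a (c + c') X Y z =
      TMap.tensor d a c X Y z + TMap.tensor d a c' X Y z := by
  suffices TMap.tensor d a (c + c') X Y = TMap.tensor d a c X Y + TMap.tensor d a c' X Y from
    LinearMap.congr_fun this z
  refine TT.hom_ext Q fun Z x y => ?_
  rw [LinearMap.add_apply, tensor_of, tensor_of, tensor_of, ← map_add, ← TensorProduct.tmul_add]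
  rfl

theorem TMap.tensor_add_left (d : ℤ) (a a' : TMap Q R φ γ) (c : TMap Q R γ χ) {X Y : S}
    (z : TT Q X Y) : TMap.tensor d (a + a') c X Y z =
      TMap.tensor d a c X Y z + TMap.tensor d a' c X Y z := by
  suffices TMap.tensor d (a + a') c X Y = TMap.tensor d a c X Y + TMap.tensor d a' c X Y from
    LinearMap.congr_fun this z
  refine TT.hom_ext Q fun Z x y => ?_
  rw [LinearMap.add_apply, tensor_of, tensor_of, tensor_of, ← map_add, ← TensorProduct.add_tmul]
  rfl

theorem TMap.tensor_smul_right (d : ℤ) (a : TMap Q R φ γ) (s : k) (c : TMap Q R γ χ) {X Y : S}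
    (z : TT Q X Y) : TMap.tensor d a (s • c) X Y z = s • TMap.tensor d a c X Y z := by
  suffices TMap.tensor d a (s • c) X Y = s • TMap.tensor d a c X Y from
    LinearMap.congr_fun this z
  refine TT.hom_ext Q fun Z x y => ?_
  rw [LinearMap.smul_apply, tensor_of, tensor_of, ← map_smul, ← TensorProduct.tmul_smul]
  rfl

theorem TMap.tensor_smul_left (d : ℤ) (s : k) (a : TMap Q R φ γ) (c : TMap Q R γ χ) {X Y : S}
    (z : TT Q X Y) : TMap.tensor d (s • a) c X Y z = s • TMap.tensor d a c X Y z := by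
  suffices TMap.tensor d (s • a) c X Y = s • TMap.tensor d a c X Y from
    LinearMap.congr_fun this z
  refine TT.hom_ext Q fun Z x y => ?_
  rw [LinearMap.smul_apply, tensor_of, tensor_of, ← map_smul, TensorProduct.smul_tmul']
  rfl

/-! ### Linear combinations of coderivations and brackets with the differential. -/

theorem IsCoderivation.add {d : ℤ} {f : TMap Q R φ φ} {h : TMap Q R χ χ} {a c : TMap Q R φ χ}
    (ha : IsCoderivation f h d a) (hc : IsCoderivation f h d c) : IsCoderivation f h d (a + c) where
  degree := ha.degree.add hc.degree
  comul X Y := by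
    refine LinearMap.ext fun t => ?_
    have h1 := LinearMap.congr_fun (ha.comul X Y) t
    have h2 := LinearMap.congr_fun (hc.comul X Y) t
    simp only [LinearMap.comp_apply, LinearMap.add_apply, Pi.add_apply, map_add,
      TMap.tensor_add_left, TMap.tensor_add_right] at h1 h2 ⊢
    rw [h1, h2]
    abel

theorem IsCoderivation.smul {d : ℤ} {f : TMap Q R φ φ} {h : TMap Q R χ χ} {a : TMap Q R φ χ}
    (ha : IsCoderivation f h d a) (s : k) : IsCoderivation f h d (s • a) where
  degree := ha.degree.smul s
  comul X Y := by
    refine LinearMap.ext fun t => ?_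
    have h1 := LinearMap.congr_fun (ha.comul X Y) t
    simp only [LinearMap.comp_apply, LinearMap.add_apply, Pi.smul_apply, LinearMap.smul_apply,
      map_smul, TMap.tensor_smul_left, TMap.tensor_smul_right] at h1 ⊢
    rw [h1, smul_add]

theorem IsCoderivation.hasComul {d : ℤ} {f : TMap Q R φ φ} {h : TMap Q R χ χ} {a : TMap Q R φ χ}
    (ha : IsCoderivation f h d a) : a.HasComul (TMap.tensor 0 f a + TMap.tensor d a h) :=
  ha.comul

theorem IsCoderivation.comul_apply {d : ℤ} {f : TMap Q R φ φ} {h : TMap Q R χ χ}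
    {a : TMap Q R φ χ} (ha : IsCoderivation f h d a) {X Y : S} (t : T Q X Y) :
    T.comul R (φ X) (χ Y) (a X Y t) = TMap.tensor 0 f a X Y (T.comul Q X Y t) +
      TMap.tensor d a h X Y (T.comul Q X Y t) :=
  LinearMap.congr_fun (ha.comul X Y) t

/-- The bracket `[r, b] = rb - (-1)^d br` with a codifferential is a coderivation. -/
theorem IsCoderivation.bracket {d : ℤ} {f : TMap Q R φ φ} {h : TMap Q R χ χ} {r : TMap Q R φ χ}
    {b : TMap Q Q (fun X => X) (fun X => X)} {b' : TMap R R (fun X => X) (fun X => X)}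
    (hb : IsCoderivation (TMap.one Q) (TMap.one Q) 1 b)
    (hb' : IsCoderivation (TMap.one R) (TMap.one R) 1 b')
    (hf : TMap.post b' f = TMap.pre f b) (hh : TMap.post b' h = TMap.pre h b)
    (hh0 : h.HasDegree 0) (hr : IsCoderivation f h d r) :
    IsCoderivation f h (d + 1) (TMap.post b' r + (-sg k d) • TMap.pre r b) where
  degree := (hr.degree.post hb'.degree).add ((hr.degree.pre hb.degree).smul _)
  comul X Y := by
    refine LinearMap.ext fun t => ?_
    simp only [LinearMap.comp_apply, LinearMap.add_apply, Pi.smul_apply, LinearMap.smul_apply,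
      Pi.add_apply, map_add, map_smul, TMap.tensor_smul_left, TMap.tensor_smul_right,
      TMap.tensor_add_left, TMap.tensor_add_right]
    have h1 : T.comul R (φ X) (χ Y) (TMap.post b' r X Y t) = _ := hb'.comul_apply (r X Y t)
    have h2 : T.comul R (φ X) (χ Y) (TMap.pre r b X Y t) = _ := hr.comul_apply (b X Y t)
    rw [h1, h2, hr.comul_apply, hb.comul_apply]
    simp only [map_add, TMap.tensor_post _ _ _ _ hr.degree, TMap.tensor_post _ _ _ _ hh0,
      TMap.tensor_pre _ _ _ _ _ _ hb.degree, TMap.tensor_pre _ _ _ _ _ _ TMap.one_hasDegree,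
      TMap.post_one, TMap.pre_one, hf, hh, zero_mul, mul_zero, sg_zero, zero_add, add_zero,
      one_mul, mul_one, add_comm (1 : ℤ) d]
    match_scalars
    all_goals first | ring1 | skip
    -- The cross term r ⊗ hb occurs with coefficient 1 - ((-1)^d)², which is zero.
    linear_combination - sg_mul_self k d

/-- The defining property of `θ`, `θΔ = Δ(f ⊗ θ + r ⊗ p + θ ⊗ h)`, for `r` and `p` of degree `-1`
and a cycle `r`, implies that `θb - bθ - θ'` is a coderivation, if `θ'` has the same property with
respect to `r` and `[p, b]`. -/
theorem isCoderivation_bracket_theta {f : TMap Q R φ φ} {h : TMap Q R χ χ} {r : TMap Q R φ γ}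
    {p : TMap Q R γ χ} {θ θ' : TMap Q R φ χ}
    {b : TMap Q Q (fun X => X) (fun X => X)} {b' : TMap R R (fun X => X) (fun X => X)}
    (hb : IsCoderivation (TMap.one Q) (TMap.one Q) 1 b)
    (hb' : IsCoderivation (TMap.one R) (TMap.one R) 1 b')
    (hf : TMap.post b' f = TMap.pre f b) (hh : TMap.post b' h = TMap.pre h b)
    (hh0 : h.HasDegree 0) (hp : p.HasDegree (-1)) (hr : TMap.post b' r + TMap.pre r b = 0)
    (hθd : θ.HasDegree (-2)) (hθd' : θ'.HasDegree (-1))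
    (hθ : θ.HasComul (TMap.tensor 0 f θ + (TMap.tensor (-1) r p + TMap.tensor (-2) θ h)))
    (hθ' : θ'.HasComul (TMap.tensor 0 f θ' + (TMap.tensor (-1) r (TMap.post b' p + TMap.pre p b) +
      TMap.tensor (-1) θ' h))) :
    IsCoderivation f h (-1) (TMap.post b' θ + (-1 : k) • TMap.pre θ b + (-1 : k) • θ') where
  degree := ((hθd.post hb'.degree).add ((hθd.pre hb.degree).smul _)).add (hθd'.smul _)
  comul X Y := by
    refine LinearMap.ext fun t => ?_
    simp only [LinearMap.comp_apply, LinearMap.add_apply, Pi.smul_apply, LinearMap.smul_apply,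
      Pi.add_apply, map_add, map_smul, TMap.tensor_smul_left, TMap.tensor_smul_right,
      TMap.tensor_add_left, TMap.tensor_add_right]
    have h1 : T.comul R (φ X) (χ Y) (TMap.post b' θ X Y t) = _ := hb'.comul_apply (θ X Y t)
    have h2 : T.comul R (φ X) (χ Y) (TMap.pre θ b X Y t) = _ := hθ.apply (b X Y t)
    have h3 : sg k (-1) = -1 := by rw [sg_neg, sg_one]
    have h4 : sg k (-2) = 1 := by rw [sg_neg, show (2 : ℤ) = 1 + 1 by rfl, sg_add, sg_one]; ring
    have h5 : TMap.post b' r = (-1 : k) • TMap.pre r b :=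
      TMap.eq_neg_smul_of_add_eq_zero hr
    rw [h1, h2, hθ.apply, hb.comul_apply, hθ'.apply]
    simp only [map_add, TTMap.add_apply, TMap.tensor_add_right,
      TMap.tensor_post _ _ _ _ hθd, TMap.tensor_post _ _ _ _ hh0, TMap.tensor_post _ _ _ _ hp,
      TMap.tensor_pre _ _ _ _ _ _ hb.degree, TMap.tensor_pre _ _ _ _ _ _ TMap.one_hasDegree,
      TMap.post_one, TMap.pre_one, hf, hh, h5, zero_mul, mul_zero, sg_zero, zero_add, add_zero,
      one_mul, mul_one, h3, h4, TMap.tensor_smul_left,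
      show (-1 : ℤ) + 1 = 0 by rfl, show (1 : ℤ) + -1 = 0 by rfl, show (-2 : ℤ) + 1 = -1 by rfl,
      show (1 : ℤ) + -2 = -1 by rfl]
    -- The terms rb ⊗ p cancel because `r` is a cycle, and the surviving r ⊗ [p, b] is removed by
    -- the same term of `θ'`.
    match_scalars <;> ring

/-! ### Components of convolutions -/

theorem T.pr1_pi1 {X Y : S} (t : T Q X Y) : T.pr1 Q X Y (T.pi1 Q X Y t) = T.pr1 Q X Y t := by
  rw [T.pi1, LinearMap.comp_apply, T.pr1_in1]

theorem pi1_conv (d : ℤ) (a : TMap Q R φ γ) (c : TMap Q R γ χ) {X Y : S} (w : Word Q X Y) :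
    T.pi1 R _ _ (TMap.conv d a c X Y w.toT) = w.sum fun Z u v => sg k (d * v.deg) •
      (T.mul R (φ X) (γ Z) (χ Y) (T.pi1 R _ _ (a X Z u.toT) ⊗ₜ T.pi0 R _ _ (c Z Y v.toT)) +
        T.mul R (φ X) (γ Z) (χ Y) (T.pi0 R _ _ (a X Z u.toT) ⊗ₜ T.pi1 R _ _ (c Z Y v.toT))) := by
  rw [TMap.conv_toT, Word.map_sum]
  refine w.sum_congr fun Z u v _ _ => ?_
  rw [map_smul, T.pi1_mul]

theorem pi0_conv (d : ℤ) (a : TMap Q R φ γ) (c : TMap Q R γ χ) {X Y : S} (w : Word Q X Y) :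
    T.pi0 R _ _ (TMap.conv d a c X Y w.toT) = w.sum fun Z u v => sg k (d * v.deg) •
      T.mul R (φ X) (γ Z) (χ Y) (T.pi0 R _ _ (a X Z u.toT) ⊗ₜ T.pi0 R _ _ (c Z Y v.toT)) := by
  rw [TMap.conv_toT, Word.map_sum]
  refine w.sum_congr fun Z u v _ _ => ?_
  rw [map_smul, T.pi0_mul]

/-- A family of maps `TQ → R`, viewed as a family of maps `TQ → T¹R ⊆ TR`. -/
noncomputable def TMap.ofComp (a : ∀ X Y : S, T Q X Y →ₗ[k] R.Hom (φ X) (γ Y)) : TMap Q R φ γ :=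
  fun X Y => T.in1 R (φ X) (γ Y) ∘ₗ a X Y

theorem pi0_conv_ofComp (d : ℤ) (a : ∀ X Y : S, T Q X Y →ₗ[k] R.Hom (φ X) (γ Y))
    (c : TMap Q R γ χ) (X Y : S) (w : Word Q X Y) :
    T.pi0 R _ _ (TMap.conv d (TMap.ofComp a) c X Y w.toT) = 0 := by
  rw [pi0_conv, Word.sum_congr (G := fun _ _ _ => 0), Word.sum_zero]
  intro Z u v _ _
  rw [TMap.ofComp, LinearMap.comp_apply, T.pi0_in1, TensorProduct.zero_tmul, map_zero, smul_zero]

/-- A cocategory homomorphism has a length-zero part only on the empty word, where it is 1. Since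
`v` has none at all, length one in the product must come from `v`. -/
theorem pi1_conv_left {f : TMap Q R φ φ} (hf : IsCocategoryHom f) {v : TMap Q R φ γ}
    (hv : ∀ X Y (w : Word Q X Y), T.pi0 R _ _ (v X Y w.toT) = 0) {X Y : S} (w : Word Q X Y) :
    T.pi1 R _ _ (TMap.conv 0 f v X Y w.toT) = T.pi1 R _ _ (v X Y w.toT) := by
  rw [pi1_conv, Word.sum_eq_first]
  · rw [hv, hf.pi0_apply, Word.toT_nil, TMap.unit_one, T.one_mul, TensorProduct.tmul_zero, map_zero,
      zero_add, zero_mul, sg_zero, one_smul]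
  · intro Z u x hu _
    rw [hv, hf.pi0_apply, TMap.unit_word hu, TensorProduct.tmul_zero, TensorProduct.zero_tmul,
      map_zero, zero_add, smul_zero]

theorem pr1_coderivation {f : TMap Q R φ φ} {h : TMap Q R χ χ} (hf : IsCocategoryHom f)
    (hh : IsCocategoryHom h) (d : ℤ) (a : ∀ X Y : S, T Q X Y →ₗ[k] R.Hom (φ X) (χ Y)) {X Y : S}
    (t : T Q X Y) :
    T.pr1 R _ _ (TMap.conv 0 f (TMap.conv d (TMap.ofComp a) h) X Y t) = a X Y t := by
  suffices T.pr1 R _ _ ∘ₗ TMap.conv 0 f (TMap.conv d (TMap.ofComp a) h) X Y = a X Y from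
    LinearMap.congr_fun this t
  refine T.word_ext fun w => ?_
  rw [LinearMap.comp_apply, ← T.pr1_pi1, pi1_conv_left hf (pi0_conv_ofComp d a h), pi1_conv,
    Word.sum_eq_last]
  · rw [Word.deg, mul_zero, sg_zero, one_smul, hh.pi0_apply, Word.toT_nil, TMap.unit_one, T.mul_one,
      TMap.ofComp, LinearMap.comp_apply, T.pi0_in1, TensorProduct.zero_tmul, map_zero, add_zero,
      T.pr1_pi1, T.pr1_in1]
  · intro Z u v hv _
    rw [hh.pi0_apply, TMap.unit_word hv, TMap.ofComp, LinearMap.comp_apply, T.pi0_in1,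
      TensorProduct.zero_tmul, TensorProduct.tmul_zero, map_zero, add_zero, smul_zero]

/-- Every term of θ contains at least two tensor factors, one from `a` and one from `p`, so nothing
lands in T¹. -/
theorem pr1_theta {f : TMap Q R φ φ} (hf : IsCocategoryHom f) (d : ℤ)
    (a : ∀ X Y : S, T Q X Y →ₗ[k] R.Hom (φ X) (γ Y)) {p : TMap Q R γ χ}
    (hp : ∀ X Y (w : Word Q X Y), T.pi0 R _ _ (p X Y w.toT) = 0) {X Y : S} (t : T Q X Y) :
    T.pr1 R _ _ (TMap.conv 0 f (TMap.conv d (TMap.ofComp a) p) X Y t) = 0 := by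
  suffices T.pr1 R _ _ ∘ₗ TMap.conv 0 f (TMap.conv d (TMap.ofComp a) p) X Y = 0 from
    LinearMap.congr_fun this t
  refine T.word_ext fun w => ?_
  rw [LinearMap.comp_apply, ← T.pr1_pi1, pi1_conv_left hf (pi0_conv_ofComp d a p), pi1_conv,
    Word.sum_congr (G := fun _ _ _ => 0), Word.sum_zero, map_zero]
  · rfl
  · intro Z u v _ _
    rw [hp, TMap.ofComp, LinearMap.comp_apply, T.pi0_in1,
      TensorProduct.zero_tmul, TensorProduct.tmul_zero, map_zero, add_zero, smul_zero]

/-! ### Degrees of components, and coderivations with prescribed components. -/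

theorem T.in1_mem_gr {X Y : S} {i : ℤ} {x : Q.Hom X Y} (hx : x ∈ Q.gr X Y i) :
    T.in1 Q X Y x ∈ T.gr Q X Y i := by
  have := (Word.cons i ⟨x, hx⟩ (Word.nil Y)).toT_mem_gr
  rwa [Word.deg, Word.deg, add_zero] at this

theorem T.pr1_mem_gr {X Y : S} {i : ℤ} {t : T Q X Y} (ht : t ∈ T.gr Q X Y i) :
    T.pr1 Q X Y t ∈ Q.gr X Y i := by
  suffices T.gr Q X Y i ≤ (Q.gr X Y i).comap (T.pr1 Q X Y) from this ht
  refine (T.gr_le_span Q X Y i).trans (Submodule.span_le.2 ?_)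
  rintro _ ⟨w, rfl, rfl⟩
  rw [SetLike.mem_coe, Submodule.mem_comap]
  by_cases hw : w.len = 1
  · rcases w with _ | ⟨i, x, _ | ⟨j, y, w⟩⟩
    · simp [Word.len] at hw
    · rw [Word.toT_cons, Word.toT_nil, T.pr1_of_cons_nil, Word.deg, Word.deg, add_zero]
      exact x.2
    · simp [Word.len] at hw
  · rw [Word.pr1_toT hw]
    exact Submodule.zero_mem _

/-- A family of maps `TQ → R` is homogeneous of degree `d`. -/
def CompHasDegree (a : ∀ X Y : S, T Q X Y →ₗ[k] R.Hom (φ X) (γ Y)) (d : ℤ) : Prop :=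
  ∀ X Y i, ∀ t ∈ T.gr Q X Y i, a X Y t ∈ R.gr (φ X) (γ Y) (i + d)

theorem CompHasDegree.ofComp {a : ∀ X Y : S, T Q X Y →ₗ[k] R.Hom (φ X) (γ Y)} {d : ℤ}
    (ha : CompHasDegree a d) : (TMap.ofComp a).HasDegree d :=
  fun X Y i t ht => T.in1_mem_gr (ha X Y i t ht)

theorem TMap.HasDegree.comp {a : TMap Q R φ γ} {d : ℤ} (ha : a.HasDegree d) :
    CompHasDegree (fun X Y => T.pr1 R (φ X) (γ Y) ∘ₗ a X Y) d :=
  fun X Y i t ht => T.pr1_mem_gr (ha X Y i t ht)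

theorem isCoderivation_ofComp {f : TMap Q R φ φ} {h : TMap Q R χ χ} (hf : IsCocategoryHom f)
    (hh : IsCocategoryHom h) {d : ℤ} {a : ∀ X Y : S, T Q X Y →ₗ[k] R.Hom (φ X) (χ Y)}
    (ha : CompHasDegree a d) :
    IsCoderivation f h d (TMap.conv 0 f (TMap.conv d (TMap.ofComp a) h)) where
  degree := by
    have := hf.degree.conv (ha.ofComp.conv hh.degree d) 0
    rwa [add_zero, zero_add] at this
  comul := TMap.HasComul.coderivation hf.comul hh.comul (in1_hasComul d a)

/-- A coderivation is the one with its components. -/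
theorem IsCoderivation.eq_conv {f : TMap Q R φ φ} {h : TMap Q R χ χ} {d : ℤ} {E : TMap Q R φ χ}
    (hf : IsCocategoryHom f) (hh : IsCocategoryHom h)
    (hf0 : ∀ X, T.pr1 R (φ X) (φ X) (f X X (T.one Q X)) = 0) (hE : IsCoderivation f h d E) :
    E = TMap.conv 0 f (TMap.conv d (TMap.ofComp fun X Y => T.pr1 R (φ X) (χ Y) ∘ₗ E X Y) h) := by
  have h1 := (hE.add ((isCoderivation_ofComp hf hh hE.degree.comp).smul (-1))).eq_zero hf hh hf0 ?_
  · have h2 := TMap.eq_neg_smul_of_add_eq_zero h1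
    rwa [smul_smul, neg_one_mul, neg_neg, one_smul] at h2
  · intro X Y w
    rw [Pi.add_apply, Pi.add_apply, LinearMap.add_apply, map_add, Pi.smul_apply, Pi.smul_apply,
      LinearMap.smul_apply, map_smul, pr1_coderivation hf hh, neg_one_smul, LinearMap.comp_apply,
      add_neg_cancel]

end

section

variable {k : Type u} [CommRing k] {S S' : Type u} {Q : GradedQuiver k S}
  {R : GradedQuiver k S'} {φ γ χ ψ : S → S'}

/-! ### Leading terms -/

/-- A family of linear maps on `TQ` vanishes on the summands `TᵐQ` with `m < n`. -/
def VanishesBelow {M : S → S → Type u} [∀ X Y, AddCommGroup (M X Y)] [∀ X Y, Module k (M X Y)]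
    (a : ∀ X Y : S, T Q X Y →ₗ[k] M X Y) (n : ℕ) : Prop :=
  ∀ X Y (w : Word Q X Y), w.len < n → a X Y w.toT = 0

theorem T.path_ext {X Y : S} {M : Type u} [AddCommGroup M] [Module k M] {a c : T Q X Y →ₗ[k] M}
    {p : ObjPath S X Y} (h : ∀ w : Word Q X Y, w.len = p.len → a w.toT = c w.toT)
    (t : PathMod Q p) : a (T.of Q p t) = c (T.of Q p t) := by
  suffices Submodule.span k {t | ∃ w : Word Q X Y, w.len = p.len ∧ True ∧ w.toT = t} ≤
    LinearMap.eqLocus a c from this (T.of_mem_span Q p t)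
  rw [Submodule.span_le]
  rintro _ ⟨w, hw, -, rfl⟩
  exact h w hw

theorem VanishesBelow.path {M : S → S → Type u} [∀ X Y, AddCommGroup (M X Y)]
    [∀ X Y, Module k (M X Y)] {a : ∀ X Y : S, T Q X Y →ₗ[k] M X Y} {n : ℕ}
    (h : VanishesBelow a n) {X Y : S} {p : ObjPath S X Y} (hp : p.len < n) (t : PathMod Q p) :
    a X Y (T.of Q p t) = 0 :=
  T.path_ext (c := 0) (fun w hw => h X Y w (hw ▸ hp)) t

theorem VanishesBelow.of_path {M : S → S → Type u} [∀ X Y, AddCommGroup (M X Y)]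
    [∀ X Y, Module k (M X Y)] {a : ∀ X Y : S, T Q X Y →ₗ[k] M X Y} {n : ℕ}
    (h : ∀ X Y (p : ObjPath S X Y) (t : PathMod Q p), p.len < n → a X Y (T.of Q p t) = 0) :
    VanishesBelow a n := by
  intro X Y w hw
  obtain ⟨p, hp, t, -, e⟩ := w.exists_path
  rw [e, h _ _ _ _ (hp ▸ hw)]

/-- Every cut with a nonempty left piece leaves fewer than `n` letters for `c`, hence contributes
zero. -/
theorem conv_of_right {a : TMap Q R φ γ} {c : TMap Q R γ χ} {n : ℕ} (hc : VanishesBelow c n)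
    (d : ℤ) {X Y : S} {w : Word Q X Y} (hw : w.len ≤ n) : TMap.conv d a c X Y w.toT =
      sg k (d * w.deg) • T.mul R (φ X) (γ X) (χ Y) (a X X (T.one Q X) ⊗ₜ c X Y w.toT) := by
  rw [TMap.conv_toT, Word.sum_eq_first]
  · rfl
  · intro Z u v hu hl
    rw [hc _ _ v (by omega), TensorProduct.tmul_zero, map_zero, smul_zero]

theorem conv_of_left {a : TMap Q R φ γ} {c : TMap Q R γ χ} {n : ℕ} (ha : VanishesBelow a n)
    (d : ℤ) {X Y : S} {w : Word Q X Y} (hw : w.len ≤ n) : TMap.conv d a c X Y w.toT =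
      T.mul R (φ X) (γ Y) (χ Y) (a X Y w.toT ⊗ₜ c Y Y (T.one Q Y)) := by
  rw [TMap.conv_toT, Word.sum_eq_last]
  · rw [Word.deg, mul_zero, sg_zero, one_smul]; rfl
  · intro Z u v hu hl
    rw [ha _ _ u (by omega), TensorProduct.zero_tmul, map_zero, smul_zero]

theorem VanishesBelow.conv_right {a : TMap Q R φ γ} {c : TMap Q R γ χ} {n : ℕ}
    (hc : VanishesBelow c n) (d : ℤ) : VanishesBelow (TMap.conv d a c) n := by
  intro X Y w hw
  rw [conv_of_right hc d hw.le, hc _ _ w hw, TensorProduct.tmul_zero, map_zero, smul_zero]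

theorem VanishesBelow.conv_left {a : TMap Q R φ γ} {c : TMap Q R γ χ} {n : ℕ}
    (ha : VanishesBelow a n) (d : ℤ) : VanishesBelow (TMap.conv d a c) n := by
  intro X Y w hw
  rw [conv_of_left ha d hw.le, ha _ _ w hw, TensorProduct.zero_tmul, map_zero]

theorem VanishesBelow.ofComp {a : ∀ X Y : S, T Q X Y →ₗ[k] R.Hom (φ X) (γ Y)} {n : ℕ}
    (ha : VanishesBelow a n) : VanishesBelow (TMap.ofComp a) n := by
  intro X Y w hw
  rw [TMap.ofComp, LinearMap.comp_apply, ha _ _ w hw, map_zero]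

theorem TMap.conv_add_right (d : ℤ) (a : TMap Q R φ γ) (c c' : TMap Q R γ χ) :
    TMap.conv d a (c + c') = TMap.conv d a c + TMap.conv d a c' := by
  refine funext fun X => funext fun Y => LinearMap.ext fun t => ?_
  rw [TMap.conv, LinearMap.comp_apply, LinearMap.comp_apply, TMap.tensor_add_right, map_add]
  rfl

/-! ### The leading term of the differential of an `A_∞`-category -/

theorem Word.sum_sub_first_mem {M : Type u} [AddCommGroup M] [Module k M] {X Y : S}
    {w : Word Q X Y} {F : ∀ Z, Word Q X Z → Word Q Z Y → M} (N : Submodule k M)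
    (h : ∀ Z u v, 0 < u.len → u.len + v.len = w.len → F Z u v ∈ N) :
    w.sum F - F X (nil X) w ∈ N := by
  cases w with
  | nil X => rw [sum, sub_self]; exact N.zero_mem
  | cons i x w =>
    rw [sum, add_sub_cancel_left]
    refine sum_mem N fun Z u v h1 _ => h _ _ _ (by simp [len]) ?_
    simp only [len]; omega

variable (Q) in
/-- The part `⨁ TᵐQ`, `m < n`, of `TQ`. -/
noncomputable def T.filt (X Y : S) (n : ℕ) : Submodule k (T Q X Y) :=
  Submodule.span k {t | ∃ w : Word Q X Y, w.len < n ∧ w.toT = t}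

theorem T.cons_mem_filt {X Y Z : S} {i : ℤ} {x : Q.Hom X Z} (hx : x ∈ Q.gr X Z i) {n : ℕ}
    {t : T Q Z Y} (ht : t ∈ T.filt Q Z Y n) : T.cons Q X Z Y x t ∈ T.filt Q X Y (n + 1) := by
  suffices T.filt Q Z Y n ≤ (T.filt Q X Y (n + 1)).comap (T.cons Q X Z Y x) from this ht
  refine Submodule.span_le.2 ?_
  rintro _ ⟨w, hw, rfl⟩
  refine Submodule.subset_span ⟨.cons i ⟨x, hx⟩ w, ?_, rfl⟩
  simp only [Word.len]; omega

theorem VanishesBelow.filt {M : S → S → Type u} [∀ X Y, AddCommGroup (M X Y)]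
    [∀ X Y, Module k (M X Y)] {a : ∀ X Y : S, T Q X Y →ₗ[k] M X Y} {n : ℕ}
    (h : VanishesBelow a n) {X Y : S} {t : T Q X Y} (ht : t ∈ T.filt Q X Y n) : a X Y t = 0 := by
  suffices T.filt Q X Y n ≤ LinearMap.ker (a X Y) from this ht
  refine Submodule.span_le.2 ?_
  rintro _ ⟨w, hw, rfl⟩
  exact h _ _ w hw

end

section

variable {k : Type u} [CommRing k] {S S' : Type u}

/-- The differential `∑ 1^{⊗q} ⊗ b₁ ⊗ 1^{⊗t}` of `TsB`. -/
noncomputable def T.diff (B : AInfCategory k S) (X Y : S) : T B.s X Y →ₗ[k] T B.s X Y :=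
  DirectSum.lmap (fun p => PathMod.diff B p)

theorem T.diff_of (B : AInfCategory k S) {X Y : S} (p : ObjPath S X Y) (t : PathMod B.s p) :
    T.diff B X Y (T.of B.s p t) = T.of B.s p (PathMod.diff B p t) := by
  classical
  exact DirectSum.lmap_lof (R := k) (fun p => PathMod.diff B p) p t

theorem T.diff_one (B : AInfCategory k S) (X : S) : T.diff B X X (T.one B.s X) = 0 := by
  rw [T.one, T.diff_of, PathMod.diff, LinearMap.zero_apply, map_zero]

theorem T.diff_cons (B : AInfCategory k S) {X Y Z : S} (x : B.s.Hom X Z) (t : T B.s Z Y) :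
    T.diff B X Y (T.cons B.s X Z Y x t) = T.cons B.s X Z Y (B.b1 X Z x) (T.sgn B.s 1 Z Y t) +
      T.cons B.s X Z Y x (T.diff B Z Y t) := by
  suffices T.diff B X Y ∘ₗ T.cons B.s X Z Y x = T.cons B.s X Z Y (B.b1 X Z x) ∘ₗ T.sgn B.s 1 Z Y +
      T.cons B.s X Z Y x ∘ₗ T.diff B Z Y from LinearMap.congr_fun this t
  refine T.hom_ext B.s fun p t => ?_
  rw [LinearMap.comp_apply, LinearMap.add_apply, LinearMap.comp_apply, LinearMap.comp_apply,
    T.cons_of, T.diff_of, T.sgn_of, T.diff_of, T.cons_of, T.cons_of, PathMod.diff, ← map_add,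
    ← map_add]
  simp

theorem TMap.one_isCocategoryHom (Q : GradedQuiver k S) : IsCocategoryHom (TMap.one Q) where
  degree := TMap.one_hasDegree
  comul X Y := by
    refine T.word_ext fun w => ?_
    rw [LinearMap.comp_apply, LinearMap.comp_apply, TMap.tensor_comul]
    refine (Word.comul_toT w).trans (w.sum_congr fun Z u v _ _ => ?_)
    rw [zero_mul, sg_zero, one_smul]
    rfl
  counit X Y := rfl

theorem AInfCategory.pi1_b_one (B : AInfCategory k S) (X : S) :
    T.pi1 B.s X X (B.b X X (T.one B.s X)) = 0 := by
  rw [T.pi1, LinearMap.comp_apply, B.b_zero, map_zero]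

theorem TMap.pi1_one_one (Q : GradedQuiver k S) (X : S) :
    T.pi1 Q X X (TMap.one Q X X (T.one Q X)) = 0 := T.pi1_one X

/-- On the empty word the recursion `IsCoderivation.eq_sum` involves only the length-one parts of 1
and of b(1), and both are zero. -/
theorem AInfCategory.b_one (B : AInfCategory k S) (X : S) : B.b X X (T.one B.s X) = 0 := by
  have h1 := TMap.one_isCocategoryHom B.s
  have := B.isCoderivation.eq_sum h1 h1 (Word.nil X)
  rw [Word.toT_nil, Word.sum, Word.sum, Word.toT_nil, B.pi1_b_one, TMap.pi1_one_one,
    TensorProduct.zero_tmul, TensorProduct.zero_tmul, map_zero, smul_zero, add_zero] at this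
  exact this

theorem T.in1_apply {Q : GradedQuiver k S} {X Y : S} (x : Q.Hom X Y) :
    T.in1 Q X Y x = T.cons Q X Y Y x (T.one Q Y) := rfl

theorem T.in1_mul {Q : GradedQuiver k S} {X Y Z : S} (x : Q.Hom X Z) (t : T Q Z Y) :
    T.mul Q X Z Y (T.in1 Q X Z x ⊗ₜ t) = T.cons Q X Z Y x t := by
  rw [T.in1_apply, T.cons_mul, T.one_mul]

/-- The differential of an `A_∞`-category on a word. -/
theorem AInfCategory.b_cons (B : AInfCategory k S) {X Y Z : S} {i : ℤ} (x : B.s.gr X Z i)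
    (w : Word B.s Z Y) : B.b X Y (T.cons B.s X Z Y x.1 w.toT) =
      T.cons B.s X Z Y x.1 (B.b Z Y w.toT) + w.sum fun W u v => sg k (1 * v.deg) •
        T.cons B.s X W Y (T.pr1 B.s X W (B.b X W (T.cons B.s X Z W x.1 u.toT))) v.toT := by
  have h1 := TMap.one_isCocategoryHom B.s
  have e := B.isCoderivation.eq_sum h1 h1 (Word.cons i x w)
  rw [Word.sum, Word.sum, Word.toT_nil, B.pi1_b_one, TMap.pi1_one_one, TensorProduct.zero_tmul,
    TensorProduct.zero_tmul, map_zero, smul_zero, zero_add, zero_add, Word.sum_eq_first] at e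
  · refine e.trans (congrArg₂ _ ?_ (w.sum_congr fun W u v _ _ => congrArg _ ?_))
    · have : T.pi1 B.s X Z (TMap.one B.s X Z (Word.cons i x (.nil Z)).toT) =
          T.in1 B.s X Z x.1 := T.pi1_in1 x.1
      rw [this]
      exact T.in1_mul _ _
    · exact T.in1_mul _ _
  · intro Z' u v hu _
    have : T.pi1 B.s X Z' (TMap.one B.s X Z' (Word.cons i x u).toT) = 0 :=
      T.pi1_word (by simp only [Word.len]; omega)
    rw [this, TensorProduct.zero_tmul, map_zero]

/-- Since b₀ = 0, the differential never lengthens words; b₁ preserves the length and every bₘ with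
m ≥ 2 lowers it. -/
theorem AInfCategory.b_word_sub_mem (B : AInfCategory k S) {X Y : S} (w : Word B.s X Y) :
    B.b X Y w.toT - T.diff B X Y w.toT ∈ T.filt B.s X Y w.len := by
  induction w with
  | nil X =>
    rw [Word.toT_nil, T.diff_one, sub_zero, B.b_one]
    exact Submodule.zero_mem _
  | @cons X Z Y i x w ih =>
    have h := Word.sum_sub_first_mem (w := w) (F := fun W u v => sg k (1 * v.deg) •
        T.cons B.s X W Y (T.pr1 B.s X W (B.b X W (T.cons B.s X Z W x.1 u.toT))) v.toT)
        (T.filt B.s X Y (w.len + 1)) (by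
      intro W u v hu hl
      refine Submodule.smul_mem _ _ ?_
      exact T.cons_mem_filt (T.pr1_mem_gr (B.isCoderivation.degree.word (Word.cons i x u)))
        (Submodule.subset_span ⟨v, by omega, rfl⟩))
    -- In the sum over prefixes, the empty prefix gives b₁ on the first letter with its Koszul sign;
    -- longer prefixes shorten the word.
    have e : sg k (1 * w.deg) • T.cons B.s X Z Y
        (T.pr1 B.s X Z (B.b X Z (T.cons B.s X Z Z x.1 (Word.nil Z).toT))) w.toT =
        T.cons B.s X Z Y (B.b1 X Z x.1) (T.sgn B.s 1 Z Y w.toT) := by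
      rw [Word.sgn_toT, map_smul]
      rfl
    rw [e] at h
    rw [Word.toT_cons, T.diff_cons, B.b_cons]
    have := Submodule.add_mem _ h (T.cons_mem_filt x.2 ih)
    rw [map_sub] at this
    have aux : ∀ s t u v : T B.s X Y, s + t - (u + v) = t - u + (s - v) := fun s t u v => by abel
    exact (aux _ _ _ _).symm ▸ this

theorem AInfCategory.b_of_sub_mem (B : AInfCategory k S) {X Y : S} (p : ObjPath S X Y)
    (t : PathMod B.s p) :
    B.b X Y (T.of B.s p t) - T.of B.s p (PathMod.diff B p t) ∈ T.filt B.s X Y p.len := by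
  rw [← T.diff_of]
  suffices Submodule.span k {t | ∃ w : Word B.s X Y, w.len = p.len ∧ True ∧ w.toT = t} ≤
    (T.filt B.s X Y p.len).comap ((B.b X Y : T B.s X Y →ₗ[k] T B.s X Y) - T.diff B X Y) from
    this (T.of_mem_span B.s p t)
  rw [Submodule.span_le]
  rintro _ ⟨w, hw, -, rfl⟩
  rw [← hw]
  exact B.b_word_sub_mem w

/-- At the leading length only ∑ 1 ⊗ b₁ ⊗ 1 is visible, which is the differential of the complex N.
-/
theorem VanishesBelow.b_of {B : AInfCategory k S} {M : S → S → Type u}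
    [∀ X Y, AddCommGroup (M X Y)] [∀ X Y, Module k (M X Y)]
    {a : ∀ X Y : S, T B.s X Y →ₗ[k] M X Y} {n : ℕ}
    (h : VanishesBelow a n) {X Y : S} {p : ObjPath S X Y} (hp : p.len ≤ n) (t : PathMod B.s p) :
    a X Y (B.b X Y (T.of B.s p t)) = a X Y (T.of B.s p (PathMod.diff B p t)) := by
  rw [← sub_eq_zero]
  refine (map_sub (a X Y) _ _).symm.trans (h.filt ?_)
  refine Submodule.span_mono ?_ (B.b_of_sub_mem p t)
  rintro _ ⟨w, hw, rfl⟩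
  exact ⟨w, hw.trans_le hp, rfl⟩

/-! ### The maps `b₁` and `b₂` -/

theorem AInfCategory.b1_mem_gr (C : AInfCategory k S) {X Y : S} {i : ℤ} {x : C.s.Hom X Y}
    (hx : x ∈ C.s.gr X Y i) : C.b1 X Y x ∈ C.s.gr X Y (i + 1) :=
  T.pr1_mem_gr (C.isCoderivation.degree _ _ _ _ (T.in1_mem_gr hx))

theorem AInfCategory.b2_mem_gr (C : AInfCategory k S) {X Y Z : S} {i j : ℤ} {x : C.s.Hom X Z}
    {y : C.s.Hom Z Y} (hx : x ∈ C.s.gr X Z i) (hy : y ∈ C.s.gr Z Y j) :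
    C.b2 X Z Y x y ∈ C.s.gr X Y (i + j + 1) := by
  have := T.mul_mem_gr (T.in1_mem_gr hx) (T.in1_mem_gr hy)
  rw [T.in1_mul] at this
  exact T.pr1_mem_gr (C.isCoderivation.degree _ _ _ _ this)

theorem AInfCategory.b_in1 (C : AInfCategory k S) {X Y : S} {i : ℤ} {x : C.s.Hom X Y}
    (hx : x ∈ C.s.gr X Y i) : C.b X Y (T.in1 C.s X Y x) = T.in1 C.s X Y (C.b1 X Y x) := by
  have := C.b_cons ⟨x, hx⟩ (Word.nil Y)
  rw [Word.sum, Word.deg, mul_zero, sg_zero, one_smul, Word.toT_nil, C.b_one, map_zero,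
    zero_add] at this
  exact this

/-- The equation `b² = 0` on `T²`. -/
theorem AInfCategory.b1_b2 (C : AInfCategory k S) {X Y Z : S} {i j : ℤ} {x : C.s.Hom X Z}
    {y : C.s.Hom Z Y} (hx : x ∈ C.s.gr X Z i) (hy : y ∈ C.s.gr Z Y j) :
    C.b1 X Y (C.b2 X Z Y x y) + C.b2 X Z Y x (C.b1 Z Y y) +
      sg k j • C.b2 X Z Y (C.b1 X Z x) y = 0 := by
  have e := C.b_cons ⟨x, hx⟩ (Word.cons j ⟨y, hy⟩ (Word.nil Y))
  rw [Word.sum, Word.sum, Word.toT_cons, Word.toT_nil, Word.toT_nil,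
    ← T.in1_apply, C.b_in1 hy, Word.deg, Word.deg, Word.deg, mul_zero, sg_zero, one_smul, one_mul,
    add_zero] at e
  have h := congrArg (fun t => T.pr1 C.s X Y (C.b X Y t)) e
  have h0 : C.b X Y (C.b X Y (T.cons C.s X Z Y x (T.in1 C.s Z Y y))) = 0 :=
    LinearMap.congr_fun (C.b_sq X Y) _
  simp only [map_add, map_smul] at h
  rw [h0, map_zero] at h
  rw [h]
  rw [add_comm, add_comm (C.b1 X Y _), ← add_assoc, add_comm (sg k j • _), add_assoc]
  rfl

end

section

variable {k : Type u} [CommRing k] {S S' : Type u} {B : AInfCategory k S} {C : AInfCategory k S'}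

/-! ### Multiplication by a cycle -/

theorem leftMul_apply {X X' Y : S'} (ρ : C.s.Hom X X') {i : ℤ} {x : C.s.Hom X' Y}
    (hx : x ∈ C.s.gr X' Y i) : leftMul C ρ Y x = sg k i • C.b2 X X' Y ρ x := by
  rw [leftMul, LinearMap.comp_apply, GradedQuiver.sgn_apply 1 hx, one_mul, map_smul]

theorem leftMul_mem_gr {X X' Y : S'} {ρ : C.s.Hom X X'} (hρ : ρ ∈ C.s.gr X X' (-1)) {i : ℤ}
    {x : C.s.Hom X' Y} (hx : x ∈ C.s.gr X' Y i) : leftMul C ρ Y x ∈ C.s.gr X Y i := by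
  rw [leftMul_apply ρ hx]
  have := C.b2_mem_gr hρ hx
  rw [show -1 + i + 1 = i by ring] at this
  exact Submodule.smul_mem _ _ this

theorem GradedQuiver.hom_ext {Q : GradedQuiver k S} {X Y : S} {M : Type u} [AddCommGroup M]
    [Module k M] {a c : Q.Hom X Y →ₗ[k] M} (h : ∀ i, ∀ x ∈ Q.gr X Y i, a x = c x) : a = c := by
  refine LinearMap.ext fun x => ?_
  have hx : x ∈ ⨆ i, Q.gr X Y i := by
    rw [(Q.internal X Y).submodule_iSup_eq_top]; trivial
  suffices (⨆ i, Q.gr X Y i) ≤ LinearMap.eqLocus a c from this hx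
  exact iSup_le h

/-- For a cycle ρ, the relation b² = 0 on T² makes x ↦ (ρ ⊗ x)b₂ anticommute with b₁; the sign
(-1)^(deg x) in `leftMul` turns this into commutation. -/
theorem b1_leftMul {X X' Y : S'} {ρ : C.s.Hom X X'} (hρ : ρ ∈ C.s.gr X X' (-1))
    (hb : C.b1 X X' ρ = 0) :
    C.b1 X Y ∘ₗ leftMul C ρ Y = leftMul C ρ Y ∘ₗ C.b1 X' Y := by
  refine GradedQuiver.hom_ext fun i x hx => ?_
  have h := C.b1_b2 hρ hx
  rw [hb, map_zero, LinearMap.zero_apply, smul_zero, add_zero] at h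
  rw [LinearMap.comp_apply, LinearMap.comp_apply, leftMul_apply ρ hx,
    leftMul_apply ρ (C.b1_mem_gr hx), map_smul, eq_neg_of_add_eq_zero_left h, sg_add, sg_one,
    mul_neg_one, neg_smul, smul_neg]

/-! ### The obstruction theory -/

section

variable {X₀ Xₙ : S} {p : ObjPath S X₀ Xₙ} {X X' Y : S'}

theorem homDiff_eq (i : ℤ) (a : PathMod B.s p →ₗ[k] C.s.Hom X Y) :
    homDiff B C p X Y i a = C.b1 X Y ∘ₗ a - sg k i • (a ∘ₗ PathMod.diff B p) := by
  rw [homDiff, negOnePow_smul k]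

theorem homDiff_add (i : ℤ) (a c : PathMod B.s p →ₗ[k] C.s.Hom X Y) :
    homDiff B C p X Y i (a + c) = homDiff B C p X Y i a + homDiff B C p X Y i c := by
  simp only [homDiff_eq, LinearMap.comp_add, LinearMap.add_comp, smul_add]
  abel

theorem homDiff_sub (i : ℤ) (a c : PathMod B.s p →ₗ[k] C.s.Hom X Y) :
    homDiff B C p X Y i (a - c) = homDiff B C p X Y i a - homDiff B C p X Y i c := by
  simp only [homDiff_eq, LinearMap.comp_sub, LinearMap.sub_comp, smul_sub]
  abel

theorem homDiff_comp {w : C.s.Hom X' Y →ₗ[k] C.s.Hom X Y}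
    (hw : C.b1 X Y ∘ₗ w = w ∘ₗ C.b1 X' Y) (i : ℤ) (a : PathMod B.s p →ₗ[k] C.s.Hom X' Y) :
    homDiff B C p X Y i (w ∘ₗ a) = w ∘ₗ homDiff B C p X' Y i a := by
  rw [homDiff_eq, homDiff_eq, ← LinearMap.comp_assoc, hw, LinearMap.comp_sub, LinearMap.comp_smul,
    LinearMap.comp_assoc, LinearMap.comp_assoc]

/-- The acyclicity of the cone of a quasi-isomorphism. -/
theorem HomQuasiIso.exists_primitive {w : C.s.Hom X' Y →ₗ[k] C.s.Hom X Y}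
    (h : HomQuasiIso B C p w) (hw : C.b1 X Y ∘ₗ w = w ∘ₗ C.b1 X' Y)
    (hwd : ∀ i, ∀ x ∈ C.s.gr X' Y i, w x ∈ C.s.gr X Y i)
    {l : PathMod B.s p →ₗ[k] C.s.Hom X' Y} {n : PathMod B.s p →ₗ[k] C.s.Hom X Y}
    (hl : l ∈ homDeg B C p X' Y 0) (hn : n ∈ homDeg B C p X Y (-1))
    (hl0 : homDiff B C p X' Y 0 l = 0) (hn0 : homDiff B C p X Y (-1) n = w ∘ₗ l) :
    ∃ q ∈ homDeg B C p X' Y (-1), ∃ e ∈ homDeg B C p X Y (-2),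
      l = homDiff B C p X' Y (-1) q ∧ n = w ∘ₗ q + homDiff B C p X Y (-2) e := by
  -- The image of the class of `l` is bounded by `n`, so injectivity makes `l` a boundary.
  obtain ⟨q, hq, hlq⟩ := (h 0).2 l hl hl0 ⟨n, hn, hn0.symm⟩
  rw [show (0 : ℤ) - 1 = -1 by rfl] at hq hlq
  have hwq : w ∘ₗ q ∈ homDeg B C p X Y (-1) := fun j t ht => hwd _ _ (hq j t ht)
  -- The difference `n - w ∘ₗ q` is a cycle, so by surjectivity it is the image of a cycle `c` up to
  -- a boundary. Adding `c` to `q` does not change the differential of `q`.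
  obtain ⟨c, hc, hc0, e, he, hce⟩ := (h (-1)).1 (n - w ∘ₗ q) (Submodule.sub_mem _ hn hwq) (by
    rw [homDiff_sub, hn0, homDiff_comp hw, ← hlq, sub_self])
  rw [show (-1 : ℤ) - 1 = -2 by rfl] at he hce
  refine ⟨q + c, Submodule.add_mem _ hq hc, e, he, ?_, ?_⟩
  · rw [homDiff_add, hc0, add_zero, hlq]
  · rw [← hce, LinearMap.comp_add]
    abel

end

/-! ### Transformations and their components -/

variable {φ γ χ : S → S'} {f : AInfFunctor B C φ} {g : AInfFunctor B C γ} {h : AInfFunctor B C χ}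

theorem AInfFunctor.map_one (f : AInfFunctor B C φ) (X : S) :
    f.map X X (T.one B.s X) = T.one C.s (φ X) :=
  f.isCocategoryHom.map_one (f.map_zero X)

theorem AInfFunctor.post_eq_pre (f : AInfFunctor B C φ) : TMap.post C.b f.map = TMap.pre f.map B.b :=
  funext fun X => funext fun Y => f.map_b X Y

/-- The components of a transformation. -/
noncomputable def AInfTransformation.comp {d : ℤ} (r : AInfTransformation f g d) (X Y : S) :
    T B.s X Y →ₗ[k] C.s.Hom (φ X) (γ Y) :=
  T.pr1 C.s (φ X) (γ Y) ∘ₗ r.map X Y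

theorem AInfTransformation.comp_degree {d : ℤ} (r : AInfTransformation f g d) :
    CompHasDegree r.comp d :=
  r.isCoderivation.degree.comp

theorem AInfTransformation.map_eq {d : ℤ} (r : AInfTransformation f g d) :
    r.map = TMap.conv 0 f.map (TMap.conv d (TMap.ofComp r.comp) g.map) :=
  r.isCoderivation.eq_conv f.isCocategoryHom g.isCocategoryHom f.map_zero

variable (f g) in
/-- The transformation with given components. -/
noncomputable def AInfTransformation.ofComp {d : ℤ}
    {a : ∀ X Y : S, T B.s X Y →ₗ[k] C.s.Hom (φ X) (γ Y)} (ha : CompHasDegree a d) :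
    AInfTransformation f g d where
  map := TMap.conv 0 f.map (TMap.conv d (TMap.ofComp a) g.map)
  isCoderivation := isCoderivation_ofComp f.isCocategoryHom g.isCocategoryHom ha

theorem AInfTransformation.comp_ofComp {d : ℤ}
    {a : ∀ X Y : S, T B.s X Y →ₗ[k] C.s.Hom (φ X) (γ Y)} (ha : CompHasDegree a d) :
    (AInfTransformation.ofComp f g ha).comp = a :=
  funext fun _ => funext fun _ => LinearMap.ext fun t =>
    pr1_coderivation f.isCocategoryHom g.isCocategoryHom d a t

/-- The sum of two transformations. -/
noncomputable def AInfTransformation.add {d : ℤ} (r r' : AInfTransformation f g d) :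
    AInfTransformation f g d where
  map := r.map + r'.map
  isCoderivation := r.isCoderivation.add r'.isCoderivation

theorem AInfTransformation.comp_add {d : ℤ} (r r' : AInfTransformation f g d) {X Y : S}
    (t : T B.s X Y) : (r.add r').comp X Y t = r.comp X Y t + r'.comp X Y t :=
  map_add (T.pr1 C.s (φ X) (γ Y)) _ _

/-- The difference of two transformations. -/
noncomputable def AInfTransformation.sub {d : ℤ} (r r' : AInfTransformation f g d) :
    AInfTransformation f g d where
  map := r.map + (-1 : k) • r'.map
  isCoderivation := r.isCoderivation.add (r'.isCoderivation.smul _)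

theorem AInfTransformation.comp_sub {d : ℤ} (r r' : AInfTransformation f g d) {X Y : S}
    (t : T B.s X Y) : (r.sub r').comp X Y t = r.comp X Y t - r'.comp X Y t := by
  change T.pr1 C.s (φ X) (γ Y) (r.map X Y t + (-1 : k) • r'.map X Y t) = _
  rw [map_add, map_smul, neg_one_smul, ← sub_eq_add_neg]
  rfl

theorem AInfTransformation.add_sub_map {d : ℤ} (r r' : AInfTransformation f g d) :
    (r'.add (r.sub r')).map = r.map := by
  refine funext fun X => funext fun Y => LinearMap.ext fun t => ?_
  change r'.map X Y t + (r.map X Y t + (-1 : k) • r'.map X Y t) = r.map X Y t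
  module

/-- Up to length `n` no letters remain for `f` or `g` beside a nonzero component of `r`, and both
functors send 1 to 1. -/
theorem AInfTransformation.leading {d : ℤ} {r : AInfTransformation f g d} {n : ℕ}
    (hr : VanishesBelow r.comp n) {X Y : S} {w : Word B.s X Y} (hw : w.len ≤ n) :
    r.map X Y w.toT = T.in1 C.s (φ X) (γ Y) (r.comp X Y w.toT) := by
  rw [r.map_eq, conv_of_right (hr.ofComp.conv_left d) 0 hw, conv_of_left hr.ofComp d hw, f.map_one,
    g.map_one, T.mul_one, T.one_mul, zero_mul, sg_zero, one_smul]
  rfl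

theorem AInfTransformation.vanishesBelow {d : ℤ} {r : AInfTransformation f g d} {n : ℕ}
    (hr : VanishesBelow r.comp n) : VanishesBelow r.map n := by
  intro X Y w hw
  rw [leading hr hw.le, hr _ _ w hw, map_zero]

theorem AInfTransformation.eq_zero {d : ℤ} {r : AInfTransformation f g d}
    (hr : ∀ n, VanishesBelow r.comp n) : r.map = 0 :=
  r.isCoderivation.eq_zero f.isCocategoryHom g.isCocategoryHom f.map_zero
    fun X Y w => hr (w.len + 1) X Y w w.len.lt_succ_self

/-! ### The map `θ` -/

/-- The factors from `g`, `p` and `h` reassemble into the coderivation `p` itself; this makes θ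
visibly additive in `p`. -/
theorem theta_eq {d e : ℤ} (r : AInfTransformation f g d) (p : AInfTransformation g h e) :
    theta r p = TMap.conv 0 f.map (TMap.conv d (TMap.ofComp r.comp) p.map) := by
  rw [p.map_eq]
  rfl

theorem theta_add {d e : ℤ} (r : AInfTransformation f g d) (p q : AInfTransformation g h e) :
    theta r (p.add q) = theta r p + theta r q := by
  rw [theta_eq, theta_eq, theta_eq, ← TMap.conv_add_right, ← TMap.conv_add_right]
  rfl

theorem theta_hasDegree {d e : ℤ} (r : AInfTransformation f g d) (p : AInfTransformation g h e) :
    (theta r p).HasDegree (d + e) := by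
  have := f.isCocategoryHom.degree.conv
    (r.comp_degree.ofComp.conv p.isCoderivation.degree d) 0
  rwa [zero_add, ← theta_eq] at this

theorem theta_hasComul {d e : ℤ} (r : AInfTransformation f g d) (p : AInfTransformation g h e) :
    (theta r p).HasComul (TMap.tensor 0 f.map (theta r p) +
      (TMap.tensor d r.map p.map + TMap.tensor (d + e) (theta r p) h.map)) := by
  have h1 := TMap.HasComul.theta (a := TMap.ofComp r.comp) f.isCocategoryHom.comul
    (in1_hasComul d r.comp) p.isCoderivation.hasComul
  rwa [← r.map_eq, ← theta_eq] at h1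

theorem pr1_theta_apply {d e : ℤ} (r : AInfTransformation f g d) (p : AInfTransformation g h e)
    {X Y : S} (t : T B.s X Y) : T.pr1 C.s (φ X) (χ Y) (theta r p X Y t) = 0 := by
  rw [theta_eq]
  exact pr1_theta f.isCocategoryHom d r.comp (fun X Y w =>
    p.isCoderivation.pi0_eq_zero g.isCocategoryHom h.isCocategoryHom w) t

/-- All letters must go to `p`, so r₀ ⊗ pₙ is the only surviving term. -/
theorem theta_leading {d e : ℤ} (r : AInfTransformation f g d) {p : AInfTransformation g h e}
    {n : ℕ} (hp : VanishesBelow p.comp n) {X Y : S} {w : Word B.s X Y} (hw : w.len ≤ n) :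
    theta r p X Y w.toT = sg k (d * w.deg) •
      T.in2 C.s (φ X) (γ X) (χ Y) (r.zeroComponent X) (p.comp X Y w.toT) := by
  rw [theta_eq, conv_of_right ((p.vanishesBelow hp).conv_right d) 0 hw,
    conv_of_right (p.vanishesBelow hp) d hw, f.map_one, T.one_mul, zero_mul, sg_zero, one_smul,
    p.leading hp hw]
  congr 1
  exact T.in1_mul _ _

/-! ### The equations for the transformations `p` and `v` -/

/-- The transformation `[p, b] = pb + bp`. -/
noncomputable def AInfTransformation.bracket (p : AInfTransformation g h (-1)) :
    AInfTransformation g h 0 where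
  map := TMap.post C.b p.map + TMap.pre p.map B.b
  isCoderivation := by
    have := IsCoderivation.bracket B.isCoderivation C.isCoderivation g.post_eq_pre
      h.post_eq_pre h.isCocategoryHom.degree p.isCoderivation
    rwa [sg_neg, sg_one, neg_neg, one_smul, neg_add_cancel] at this

theorem AInfTransformation.bracket_apply (p : AInfTransformation g h (-1)) {X Y : S}
    (t : T B.s X Y) :
    p.bracket.map X Y t = C.b (γ X) (χ Y) (p.map X Y t) + p.map X Y (B.b X Y t) := rfl

theorem sg_neg_two : sg k (-2) = 1 := by
  rw [sg_neg, show (2 : ℤ) = 1 + 1 by rfl, sg_add, sg_one, neg_one_mul, neg_neg]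

theorem isCoderivation_bracket_neg_two (v : AInfTransformation f h (-2)) :
    IsCoderivation f.map h.map (-1) (TMap.post C.b v.map + (-1 : k) • TMap.pre v.map B.b) := by
  have := IsCoderivation.bracket B.isCoderivation C.isCoderivation f.post_eq_pre
    h.post_eq_pre h.isCocategoryHom.degree v.isCoderivation
  rwa [sg_neg_two] at this

variable (r : NatTransformation f g)

theorem isCoderivation_B2 (p : AInfTransformation g h (-1)) :
    IsCoderivation f.map h.map (-1) (B2 r.toAInfTransformation p) := by
  refine isCoderivation_ofComp (d := -1) f.isCocategoryHom h.isCocategoryHom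
    (a := fun X Y => T.pr1 C.s (φ X) (χ Y) ∘ₗ C.b (φ X) (χ Y) ∘ₗ
      theta r.toAInfTransformation p X Y) ?_
  exact ((theta_hasDegree r.toAInfTransformation p).post C.isCoderivation.degree).comp

theorem pr1_B2 (p : AInfTransformation g h (-1)) {X Y : S} (t : T B.s X Y) :
    T.pr1 C.s (φ X) (χ Y) (B2 r.toAInfTransformation p X Y t) =
      T.pr1 C.s (φ X) (χ Y) (C.b (φ X) (χ Y) (theta r.toAInfTransformation p X Y t)) :=
  pr1_coderivation f.isCocategoryHom h.isCocategoryHom _ (fun X Y => T.pr1 C.s (φ X) (χ Y) ∘ₗ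
    C.b (φ X) (χ Y) ∘ₗ theta r.toAInfTransformation p X Y) t

/-- `(r ⊗ p)B₂ = θb - bθ - (r ⊗ [p, b])θ`. -/
theorem B2_eq (p : AInfTransformation g h (-1)) {X Y : S} (t : T B.s X Y) :
    B2 r.toAInfTransformation p X Y t =
      C.b (φ X) (χ Y) (theta r.toAInfTransformation p X Y t) -
        theta r.toAInfTransformation p X Y (B.b X Y t) -
        theta r.toAInfTransformation p.bracket X Y t := by
  have h1 := isCoderivation_bracket_theta B.isCoderivation C.isCoderivation f.post_eq_pre
    h.post_eq_pre h.isCocategoryHom.degree p.isCoderivation.degree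
    (r := r.map) (funext fun X => funext fun Y => r.natural X Y)
    (theta_hasDegree r.toAInfTransformation p) (theta_hasDegree r.toAInfTransformation p.bracket)
    (theta_hasComul r.toAInfTransformation p) (theta_hasComul r.toAInfTransformation p.bracket)
  have h2 := (isCoderivation_B2 r p).add (h1.smul (-1))
  -- Both sides are coderivations, so components suffice. The components of `B2` are by construction
  -- those of θ followed by the differential, while the other two terms are values of θ maps and
  -- have no part in T¹.
  have h3 := h2.eq_zero f.isCocategoryHom h.isCocategoryHom f.map_zero (by
    intro X Y w
    change T.pr1 C.s (φ X) (χ Y) (B2 r.toAInfTransformation p X Y w.toT + (-1 : k) •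
      (C.b (φ X) (χ Y) (theta r.toAInfTransformation p X Y w.toT) +
        (-1 : k) • theta r.toAInfTransformation p X Y (B.b X Y w.toT) +
        (-1 : k) • theta r.toAInfTransformation p.bracket X Y w.toT)) = 0
    have aux : ∀ x y z w : C.s.Hom (φ X) (χ Y), x = y → z = 0 → w = 0 →
        x + (-1 : k) • (y + (-1 : k) • z + (-1 : k) • w) = 0 := by
      rintro x y z w rfl rfl rfl
      module
    rw [map_add, map_smul, map_add, map_add, map_smul, map_smul]
    exact aux _ _ _ _ (pr1_B2 r p _) (pr1_theta_apply _ _ _) (pr1_theta_apply _ _ _))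
  have h4 : B2 r.toAInfTransformation p X Y t + (-1 : k) •
      (C.b (φ X) (χ Y) (theta r.toAInfTransformation p X Y t) +
        (-1 : k) • theta r.toAInfTransformation p X Y (B.b X Y t) +
        (-1 : k) • theta r.toAInfTransformation p.bracket X Y t) = 0 :=
    LinearMap.congr_fun (congrFun (congrFun h3 X) Y) t
  rw [neg_one_smul, neg_one_smul, neg_one_smul, ← sub_eq_add_neg, ← sub_eq_add_neg,
    ← sub_eq_add_neg] at h4
  exact eq_of_sub_eq_zero h4

theorem AInfCategory.b_b (B : AInfCategory k S) {X Y : S} (t : T B.s X Y) :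
    B.b X Y (B.b X Y t) = 0 :=
  LinearMap.congr_fun (B.b_sq X Y) t

/-- Both sides equal bpb, because b² = 0 in both categories. -/
theorem AInfTransformation.b_bracket (p : AInfTransformation g h (-1)) {X Y : S} (t : T B.s X Y) :
    C.b (γ X) (χ Y) (p.bracket.map X Y t) = p.bracket.map X Y (B.b X Y t) := by
  rw [bracket_apply, bracket_apply, map_add]
  have h1 : C.b (γ X) (χ Y) (C.b (γ X) (χ Y) (p.map X Y t)) = 0 := C.b_b _
  rw [B.b_b]
  erw [h1, map_zero, add_zero, zero_add]

/-- The transformation `r' - (r ⊗ p)B₂ - (vb - bv)`. -/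
noncomputable def defect (r' : NatTransformation f h) (p : AInfTransformation g h (-1))
    (v : AInfTransformation f h (-2)) : AInfTransformation f h (-1) where
  map := r'.map + (-1 : k) • (B2 r.toAInfTransformation p +
    (TMap.post C.b v.map + (-1 : k) • TMap.pre v.map B.b))
  isCoderivation := r'.isCoderivation.add
    (((isCoderivation_B2 r p).add (isCoderivation_bracket_neg_two v)).smul _)

theorem defect_apply (r' : NatTransformation f h) (p : AInfTransformation g h (-1))
    (v : AInfTransformation f h (-2)) {X Y : S} (t : T B.s X Y) :
    (defect r r' p v).map X Y t = r'.map X Y t - (B2 r.toAInfTransformation p X Y t +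
      (C.b (φ X) (χ Y) (v.map X Y t) - v.map X Y (B.b X Y t))) := by
  change r'.map X Y t + (-1 : k) • (B2 r.toAInfTransformation p X Y t +
    (C.b (φ X) (χ Y) (v.map X Y t) + (-1 : k) • v.map X Y (B.b X Y t))) = _
  rw [neg_one_smul, neg_one_smul, ← sub_eq_add_neg, ← sub_eq_add_neg]

theorem defect_comp (r' : NatTransformation f h) (p : AInfTransformation g h (-1))
    (v : AInfTransformation f h (-2)) {X Y : S} (t : T B.s X Y) :
    (defect r r' p v).comp X Y t = r'.toAInfTransformation.comp X Y t -
      (T.pr1 C.s (φ X) (χ Y) (C.b (φ X) (χ Y) (theta r.toAInfTransformation p X Y t)) +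
      (T.pr1 C.s (φ X) (χ Y) (C.b (φ X) (χ Y) (v.map X Y t)) - v.comp X Y (B.b X Y t))) := by
  rw [AInfTransformation.comp, LinearMap.comp_apply, defect_apply, ← pr1_B2, map_sub, map_add,
    map_sub]
  rfl

/-- A primed letter stands for the unprimed map precomposed with the differential of TsB. The zeros
in the second bracket are the double precompositions. -/
theorem differential_aux {M : Type u} [AddCommGroup M] [Module k M] {b : M →ₗ[k] M}
    (hb : ∀ x, b (b x) = 0) {r r' θ θ' τ τ' v v' : M} (h : b r + r' = 0) :
    b (r - (b θ - θ' - τ + (b v - v'))) + (r' - (b θ' - 0 - τ' + (b v' - 0))) = b τ + τ' := by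
  rw [eq_neg_of_add_eq_zero_right h]
  simp only [map_sub, map_add, hb]
  abel

/-- The cycle `r'` and the commutators of θ and `v` with the differential contribute nothing,
leaving the correction term (r ⊗ [p, b])θ of `B2_eq`. -/
theorem b_defect (r' : NatTransformation f h) (p : AInfTransformation g h (-1))
    (v : AInfTransformation f h (-2)) {X Y : S} (t : T B.s X Y) :
    C.b (φ X) (χ Y) ((defect r r' p v).map X Y t) + (defect r r' p v).map X Y (B.b X Y t) =
      C.b (φ X) (χ Y) (theta r.toAInfTransformation p.bracket X Y t) +
        theta r.toAInfTransformation p.bracket X Y (B.b X Y t) := by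
  have h1 : C.b (φ X) (χ Y) (r'.map X Y t) + r'.map X Y (B.b X Y t) = 0 :=
    LinearMap.congr_fun (r'.natural X Y) t
  rw [defect_apply, defect_apply, B2_eq, B2_eq, B.b_b, map_zero, map_zero]
  exact differential_aux (b := C.b (φ X) (χ Y)) C.b_b h1

end

section

variable {k : Type u} [CommRing k] {S S' : Type u} {B : AInfCategory k S} {C : AInfCategory k S'}
  {φ γ χ : S → S'} {f : AInfFunctor B C φ} {g : AInfFunctor B C γ} {h : AInfFunctor B C χ}

/-! ### Leading terms of the equations -/

theorem CompHasDegree.mem_homDeg {a : ∀ X Y : S, T B.s X Y →ₗ[k] C.s.Hom (φ X) (γ Y)} {d : ℤ}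
    (ha : CompHasDegree a d) {X Y : S} (p : ObjPath S X Y) :
    a X Y ∘ₗ T.of B.s p ∈ homDeg B C p (φ X) (γ Y) d :=
  fun _ _ ht => ha _ _ _ _ (T.of_mem_gr B.s ht)

theorem compHasDegree_desc {d : ℤ}
    {a : ∀ (X Y : S) (p : ObjPath S X Y), PathMod B.s p →ₗ[k] C.s.Hom (φ X) (γ Y)}
    (ha : ∀ X Y p, a X Y p ∈ homDeg B C p (φ X) (γ Y) d) :
    CompHasDegree (R := C.s) (φ := φ) (γ := γ) (fun X Y => T.desc B.s (a X Y)) d := by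
  intro X Y i t ht
  obtain ⟨s, hs⟩ := T.eq_sum B.s t
  rw [hs, map_sum]
  refine Submodule.sum_mem _ fun p _ => ?_
  rw [T.desc_of]
  exact ha _ _ _ _ _ (ht p)

theorem AInfTransformation.pr1_b_of {d : ℤ} {r : AInfTransformation f g d} {n : ℕ}
    (hr : VanishesBelow r.comp n) {X Y : S} {p : ObjPath S X Y} (hp : p.len ≤ n)
    (t : PathMod B.s p) :
    T.pr1 C.s (φ X) (γ Y) (C.b (φ X) (γ Y) (r.map X Y (T.of B.s p t))) =
      C.b1 (φ X) (γ Y) (r.comp X Y (T.of B.s p t)) := by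
  refine T.path_ext (a := T.pr1 C.s (φ X) (γ Y) ∘ₗ C.b (φ X) (γ Y) ∘ₗ r.map X Y)
    (c := C.b1 (φ X) (γ Y) ∘ₗ r.comp X Y) (fun w hw => ?_) t
  rw [LinearMap.comp_apply, LinearMap.comp_apply, LinearMap.comp_apply, r.leading hr (hw.trans_le hp)]
  rfl

/-- This is the dictionary between the two levels: the leading component of a bracket with b is the
Hom-complex differential of the leading component. -/
theorem AInfTransformation.homDiff_comp {d : ℤ} {r : AInfTransformation f g d} {n : ℕ}
    (hr : VanishesBelow r.comp n) (i : ℤ) {X Y : S} {p : ObjPath S X Y} (hp : p.len ≤ n)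
    (t : PathMod B.s p) :
    homDiff B C p (φ X) (γ Y) i (r.comp X Y ∘ₗ T.of B.s p) t =
      T.pr1 C.s (φ X) (γ Y) (C.b (φ X) (γ Y) (r.map X Y (T.of B.s p t))) -
        sg k i • r.comp X Y (B.b X Y (T.of B.s p t)) := by
  rw [homDiff_eq, pr1_b_of hr hp, hr.b_of hp]
  rfl

theorem AInfTransformation.bracket_comp (p : AInfTransformation g h (-1)) {X Y : S}
    (t : T B.s X Y) : p.bracket.comp X Y t =
      T.pr1 C.s (γ X) (χ Y) (C.b (γ X) (χ Y) (p.map X Y t)) + p.comp X Y (B.b X Y t) :=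
  map_add (T.pr1 C.s (γ X) (χ Y)) _ _

theorem AInfTransformation.bracket_comp_of {p : AInfTransformation g h (-1)} {n : ℕ}
    (hp : VanishesBelow p.comp n) {X Y : S} {P : ObjPath S X Y} (hP : P.len ≤ n)
    (t : PathMod B.s P) : p.bracket.comp X Y (T.of B.s P t) =
      homDiff B C P (γ X) (χ Y) (-1) (p.comp X Y ∘ₗ T.of B.s P) t := by
  rw [homDiff_comp hp _ hP, bracket_comp, sg_neg, sg_one, neg_one_smul, sub_neg_eq_add]

theorem AInfTransformation.bracket_comp_add (p q : AInfTransformation g h (-1)) {X Y : S}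
    (t : T B.s X Y) :
    (p.add q).bracket.comp X Y t = p.bracket.comp X Y t + q.bracket.comp X Y t := by
  simp only [bracket_comp, comp_add]
  have : (p.add q).map X Y t = p.map X Y t + q.map X Y t := rfl
  rw [this, map_add, map_add]
  exact add_add_add_comm _ _ _ _

variable (r : NatTransformation f g)

/-- Only (r₀ ⊗ pₙ)b₂ survives. The Koszul sign (-1)^(deg w) of θ and the sign (-1)^(deg w + e) of
`leftMul` combine to (-1)^e. -/
theorem pr1_b_theta_of {e : ℤ} {p : AInfTransformation g h e} {n : ℕ} (hp : VanishesBelow p.comp n)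
    {X Y : S} {P : ObjPath S X Y} (hP : P.len ≤ n) (t : PathMod B.s P) :
    T.pr1 C.s (φ X) (χ Y) (C.b (φ X) (χ Y) (theta r.toAInfTransformation p X Y (T.of B.s P t))) =
      sg k e • leftMul C (r.zeroComponent X) (χ Y) (p.comp X Y (T.of B.s P t)) := by
  refine T.path_ext (a := T.pr1 C.s (φ X) (χ Y) ∘ₗ C.b (φ X) (χ Y) ∘ₗ
      theta r.toAInfTransformation p X Y)
    (c := sg k e • (leftMul C (r.zeroComponent X) (χ Y) ∘ₗ p.comp X Y)) (fun w hw => ?_) t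
  rw [LinearMap.comp_apply, LinearMap.comp_apply, LinearMap.smul_apply, LinearMap.comp_apply,
    theta_leading _ hp (hw.trans_le hP), leftMul_apply _ (p.comp_degree _ _ _ _ w.toT_mem_gr),
    map_smul, map_smul, smul_smul, ← sg_add, neg_one_mul, sg_neg, add_comm w.deg e, ← add_assoc,
    sg_add, sg_add, sg_mul_self, one_mul]
  rfl

theorem defect_comp_add (r' : NatTransformation f h) (p q : AInfTransformation g h (-1))
    (v u : AInfTransformation f h (-2)) {X Y : S} (t : T B.s X Y) :
    (defect r r' (p.add q) (v.add u)).comp X Y t = (defect r r' p v).comp X Y t -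
      (T.pr1 C.s (φ X) (χ Y) (C.b (φ X) (χ Y) (theta r.toAInfTransformation q X Y t)) +
      (T.pr1 C.s (φ X) (χ Y) (C.b (φ X) (χ Y) (u.map X Y t)) - u.comp X Y (B.b X Y t))) := by
  have h1 : (v.add u).map X Y t = v.map X Y t + u.map X Y t := rfl
  have h2 : (theta r.toAInfTransformation p + theta r.toAInfTransformation q) X Y t =
    theta r.toAInfTransformation p X Y t + theta r.toAInfTransformation q X Y t := rfl
  have h3 : (v.add u).comp X Y (B.b X Y t) = v.comp X Y (B.b X Y t) + u.comp X Y (B.b X Y t) :=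
    v.comp_add u _
  have aux : ∀ {a b₁ b₂ c₁ c₂ d₁ d₂ d : C.s.Hom (φ X) (χ Y)}, d = d₁ + d₂ →
      a - (b₁ + b₂ + (c₁ + c₂ - d)) = a - (b₁ + (c₁ - d₁)) - (b₂ + (c₂ - d₂)) := by
    rintro a b₁ b₂ c₁ c₂ d₁ d₂ _ rfl
    abel
  rw [defect_comp, defect_comp, theta_add, h1, h2, map_add, map_add, map_add, map_add]
  exact aux h3

/-- The product with r₀ enters with a plus sign: the minus sign of the defect meets the factor
(-1)^(-1) from `pr1_b_theta_of`. -/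
theorem defect_comp_add_of (r' : NatTransformation f h) (p : AInfTransformation g h (-1))
    (v : AInfTransformation f h (-2)) {q : AInfTransformation g h (-1)}
    {u : AInfTransformation f h (-2)} {n : ℕ} (hq : VanishesBelow q.comp n)
    (hu : VanishesBelow u.comp n) {X Y : S} {P : ObjPath S X Y} (hP : P.len ≤ n)
    (t : PathMod B.s P) :
    (defect r r' (p.add q) (v.add u)).comp X Y (T.of B.s P t) =
      (defect r r' p v).comp X Y (T.of B.s P t) +
        leftMul C (r.zeroComponent X) (χ Y) (q.comp X Y (T.of B.s P t)) -
        homDiff B C P (φ X) (χ Y) (-2) (u.comp X Y ∘ₗ T.of B.s P) t := by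
  rw [defect_comp_add, pr1_b_theta_of r hq hP, u.homDiff_comp hu _ hP, sg_neg, sg_one,
    neg_one_smul, sg_neg_two, one_smul]
  abel

theorem VanishesBelow.bracket {p : AInfTransformation g h (-1)} {n : ℕ}
    (hp : VanishesBelow p.comp n) : VanishesBelow p.bracket.comp n := by
  refine .of_path fun X Y P t hP => ?_
  rw [AInfTransformation.bracket_comp_of hp hP.le]
  have : p.comp X Y ∘ₗ T.of B.s P = 0 := LinearMap.ext fun t => hp.path hP t
  rw [this, homDiff_eq, LinearMap.comp_zero, LinearMap.zero_comp, smul_zero, sub_zero,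
    LinearMap.zero_apply]

theorem VanishesBelow.defect_add {r' : NatTransformation f h} {p q : AInfTransformation g h (-1)}
    {v u : AInfTransformation f h (-2)} {n : ℕ} (hd : VanishesBelow (defect r r' p v).comp n)
    (hq : VanishesBelow q.comp n) (hu : VanishesBelow u.comp n) :
    VanishesBelow (defect r r' (p.add q) (v.add u)).comp n := by
  refine .of_path fun X Y P t hP => ?_
  rw [defect_comp_add_of r r' p v hq hu hP.le, hd.path hP, hq.path hP, map_zero]
  have : u.comp X Y ∘ₗ T.of B.s P = 0 := LinearMap.ext fun t => hu.path hP t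
  rw [this, homDiff_eq, LinearMap.comp_zero, LinearMap.zero_comp, smul_zero, sub_zero,
    LinearMap.zero_apply, sub_zero, add_zero]

theorem VanishesBelow.bracket_add {p q : AInfTransformation g h (-1)} {n : ℕ}
    (hp : VanishesBelow p.bracket.comp n) (hq : VanishesBelow q.comp n) :
    VanishesBelow (p.add q).bracket.comp n := by
  intro X Y w hw
  rw [AInfTransformation.bracket_comp_add, hp _ _ _ hw, hq.bracket _ _ _ hw, add_zero]

/-- Leading term of the fact that [p, b] commutes with b; together with `homDiff_defect` it makes
the two leading errors a cycle in the cone. -/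
theorem homDiff_bracket {p : AInfTransformation g h (-1)} {n : ℕ}
    (hp : VanishesBelow p.bracket.comp n) {X Y : S} {P : ObjPath S X Y} (hP : P.len ≤ n) :
    homDiff B C P (γ X) (χ Y) 0 (p.bracket.comp X Y ∘ₗ T.of B.s P) = 0 := by
  refine LinearMap.ext fun t => ?_
  rw [AInfTransformation.homDiff_comp hp _ hP, p.b_bracket, sg_zero, one_smul]
  exact sub_self _

/-- Leading term of `b_defect`. On its right-hand side one summand is a value of θ and has no part
in T¹; the other is multiplication by r₀. -/
theorem homDiff_defect {r' : NatTransformation f h} {p : AInfTransformation g h (-1)}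
    {v : AInfTransformation f h (-2)} {n : ℕ} (hp : VanishesBelow p.bracket.comp n)
    (hd : VanishesBelow (defect r r' p v).comp n) {X Y : S} {P : ObjPath S X Y} (hP : P.len ≤ n) :
    homDiff B C P (φ X) (χ Y) (-1) ((defect r r' p v).comp X Y ∘ₗ T.of B.s P) =
      leftMul C (r.zeroComponent X) (χ Y) ∘ₗ p.bracket.comp X Y ∘ₗ T.of B.s P := by
  refine LinearMap.ext fun t => ?_
  have h1 := congrArg (T.pr1 C.s (φ X) (χ Y)) (b_defect r r' p v (T.of B.s P t))
  have h2 : T.pr1 C.s (φ X) (χ Y) (theta r.toAInfTransformation p.bracket X Y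
    (B.b X Y (T.of B.s P t))) = 0 := pr1_theta_apply _ _ _
  rw [map_add, map_add, pr1_b_theta_of r hp hP, sg_zero, one_smul, h2, add_zero] at h1
  rw [AInfTransformation.homDiff_comp hd _ hP, sg_neg, sg_one, neg_one_smul, sub_neg_eq_add]
  exact h1

/-! ### The inductive construction -/

theorem NatTransformation.zeroComponent_mem_gr (X : S) :
    r.zeroComponent X ∈ C.s.gr (φ X) (γ X) (-1) := by
  have := r.comp_degree _ _ _ _ (Word.nil X : Word B.s X X).toT_mem_gr
  rwa [Word.deg, zero_add] at this

/-- The correction of the components of length `n`. -/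
theorem exists_correction (hb : ∀ X, C.b1 (φ X) (γ X) (r.zeroComponent X) = 0)
    (hqi : ∀ (X Y : S) (P : ObjPath S X Y), HomQuasiIso B C P
      (leftMul C (r.zeroComponent X) (χ Y)))
    (r' : NatTransformation f h) {p : AInfTransformation g h (-1)}
    {v : AInfTransformation f h (-2)} {n : ℕ} (hp : VanishesBelow p.bracket.comp n)
    (hd : VanishesBelow (defect r r' p v).comp n) :
    ∃ (q : AInfTransformation g h (-1)) (u : AInfTransformation f h (-2)),
      VanishesBelow q.comp n ∧ VanishesBelow u.comp n ∧
      VanishesBelow (p.add q).bracket.comp (n + 1) ∧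
      VanishesBelow (defect r r' (p.add q) (v.add u)).comp (n + 1) := by
  have key : ∀ (X Y : S) (P : ObjPath S X Y), ∃ a ∈ homDeg B C P (γ X) (χ Y) (-1),
      ∃ e ∈ homDeg B C P (φ X) (χ Y) (-2), (P.len < n → a = 0 ∧ e = 0) ∧
      (P.len = n → homDiff B C P (γ X) (χ Y) (-1) a = - p.bracket.comp X Y ∘ₗ T.of B.s P ∧
        homDiff B C P (φ X) (χ Y) (-2) e = (defect r r' p v).comp X Y ∘ₗ T.of B.s P +
          leftMul C (r.zeroComponent X) (χ Y) ∘ₗ a) := by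
    intro X Y P
    by_cases hP : P.len = n
    · obtain ⟨a, ha, e, he, h1, h2⟩ := (hqi X Y P).exists_primitive
        (b1_leftMul (r.zeroComponent_mem_gr X) (hb X))
        (fun i x hx => leftMul_mem_gr (r.zeroComponent_mem_gr X) hx)
        (p.bracket.comp_degree.mem_homDeg P) ((defect r r' p v).comp_degree.mem_homDeg P)
        (homDiff_bracket hp hP.le) (homDiff_defect r hp hd hP.le)
      -- The primitive `a` has differential equal to the leading bracket, which the correction has
      -- to cancel; hence the sign.
      refine ⟨-a, Submodule.neg_mem _ ha, e, he, fun h => absurd hP h.ne, fun _ => ⟨?_, ?_⟩⟩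
      · rw [h1, eq_neg_iff_add_eq_zero, ← homDiff_add, neg_add_cancel,
          homDiff_eq, LinearMap.comp_zero, LinearMap.zero_comp, smul_zero, sub_zero]
      · rw [h2, LinearMap.comp_neg]
        abel
    -- Only length `n` is corrected in this step; zero is chosen on all other paths.
    · exact ⟨0, Submodule.zero_mem _, 0, Submodule.zero_mem _, fun _ => ⟨rfl, rfl⟩,
        fun h => absurd h hP⟩
  choose a ha e he h0 hn using key
  have hq := AInfTransformation.comp_ofComp (f := g) (g := h) (compHasDegree_desc ha)
  have hu := AInfTransformation.comp_ofComp (f := f) (g := h) (compHasDegree_desc he)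
  have hq0 : VanishesBelow (AInfTransformation.ofComp g h (compHasDegree_desc ha)).comp n := by
    refine .of_path fun X Y P t hP => ?_
    rw [hq, T.desc_of, (h0 X Y P hP).1, LinearMap.zero_apply]
  have hu0 : VanishesBelow (AInfTransformation.ofComp f h (compHasDegree_desc he)).comp n := by
    refine .of_path fun X Y P t hP => ?_
    rw [hu, T.desc_of, (h0 X Y P hP).2, LinearMap.zero_apply]
  have hqn : ∀ X Y (P : ObjPath S X Y), (AInfTransformation.ofComp g h
      (compHasDegree_desc ha)).comp X Y ∘ₗ T.of B.s P = a X Y P := fun X Y P =>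
    LinearMap.ext fun t => by rw [hq, LinearMap.comp_apply, T.desc_of]
  have hun : ∀ X Y (P : ObjPath S X Y), (AInfTransformation.ofComp f h
      (compHasDegree_desc he)).comp X Y ∘ₗ T.of B.s P = e X Y P := fun X Y P =>
    LinearMap.ext fun t => by rw [hu, LinearMap.comp_apply, T.desc_of]
  refine ⟨_, _, hq0, hu0, .of_path fun X Y P t hP => ?_, .of_path fun X Y P t hP => ?_⟩
  · rcases (Nat.lt_succ_iff.1 hP).lt_or_eq with h | h
    · exact (hp.bracket_add hq0).path h t
    · rw [AInfTransformation.bracket_comp_add, AInfTransformation.bracket_comp_of hq0 h.le, hqn,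
        (hn X Y P h).1, LinearMap.neg_apply, LinearMap.comp_apply,
        add_neg_cancel]
  · rcases (Nat.lt_succ_iff.1 hP).lt_or_eq with h | h
    · exact (hd.defect_add r hq0 hu0).path h t
    · rw [defect_comp_add_of r r' p v hq0 hu0 h.le, hun, (hn X Y P h).2, ← hqn X Y P]
      exact sub_self _

/-! ### Passage to the limit. -/

theorem AInfTransformation.ext_map {d : ℤ} {p q : AInfTransformation f g d}
    (hpq : p.map = q.map) : p = q := by
  cases p; cases q; cases hpq; rfl

variable (f g) in
theorem AInfTransformation.exists_zero (d : ℤ) : Nonempty (AInfTransformation f g d) :=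
  ⟨AInfTransformation.ofComp f g (a := fun _ _ => 0) fun _ _ _ _ _ => Submodule.zero_mem _⟩

/-- The limit of a sequence of transformations whose components stabilize. -/
theorem AInfTransformation.exists_limit {d : ℤ} {s : ℕ → AInfTransformation f g d}
    (hs : ∀ n, ∃ q : AInfTransformation f g d, VanishesBelow q.comp n ∧ s (n + 1) = (s n).add q) :
    ∃ p : AInfTransformation f g d, ∀ n, ∃ q : AInfTransformation f g d,
      VanishesBelow q.comp n ∧ p = (s n).add q := by
  have hs1 : ∀ m n, m ≤ n → ∀ X Y (P : ObjPath S X Y) t, P.len < m →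
      (s n).comp X Y (T.of B.s P t) = (s m).comp X Y (T.of B.s P t) := by
    intro m n hmn X Y P t hP
    induction n, hmn using Nat.le_induction with
    | base => rfl
    | succ n hmn ih =>
      obtain ⟨q, hq, e⟩ := hs n
      rw [e, comp_add, ih, hq.path (hP.trans_le hmn), add_zero]
  -- The component on paths of length m is final from stage m + 1 on, since later corrections vanish
  -- below length m + 1.
  have hd : CompHasDegree (R := C.s) (φ := φ) (γ := γ) (fun X Y => T.desc B.s fun P =>
      (s (P.len + 1)).comp X Y ∘ₗ T.of B.s P) d :=
    compHasDegree_desc fun X Y P => (s (P.len + 1)).comp_degree.mem_homDeg P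
  refine ⟨ofComp f g hd, fun n => ⟨(ofComp f g hd).sub (s n), .of_path fun X Y P t hP => ?_,
    ext_map (add_sub_map _ _).symm⟩⟩
  rw [comp_sub, comp_ofComp, T.desc_of, LinearMap.comp_apply, hs1 _ _ hP _ _ _ _ P.len.lt_succ_self,
    sub_self]

theorem exists_equivalent_of_eq_zero (r' : NatTransformation f h)
    (p : AInfTransformation g h (-1)) (v : AInfTransformation f h (-2))
    (hp : p.bracket.map = 0) (hd : (defect r r' p v).map = 0) :
    ∃ p : NatTransformation g h, Equivalent f h r'.map (r.comp p) := by
  let P : NatTransformation g h := .mk p fun X Y => congrFun (congrFun hp X) Y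
  have hc : r.comp P = B2 r.toAInfTransformation p := rfl
  refine ⟨P, ?_⟩
  rw [hc]
  refine ⟨v, fun X Y => LinearMap.ext fun t => ?_⟩
  have h3 : (defect r r' p v).map X Y t = 0 := by rw [hd]; rfl
  rw [defect_apply] at h3
  have aux : ∀ x y z : T C.s (φ X) (χ Y), x - (y + z) = 0 → x - y = z :=
    fun x y z h => sub_eq_of_eq_add' (eq_of_sub_eq_zero h)
  exact aux _ _ _ h3

theorem exists_factorization (hb : ∀ X, C.b1 (φ X) (γ X) (r.zeroComponent X) = 0)
    (hqi : ∀ (X Y : S) (P : ObjPath S X Y), HomQuasiIso B C P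
      (leftMul C (r.zeroComponent X) (χ Y)))
    (r' : NatTransformation f h) :
    ∃ p : NatTransformation g h, Equivalent f h r'.map (r.comp p) := by
  have step := fun (n : ℕ) (s : {s : AInfTransformation g h (-1) × AInfTransformation f h (-2) //
      VanishesBelow s.1.bracket.comp n ∧ VanishesBelow (defect r r' s.1 s.2).comp n}) =>
    exists_correction r hb hqi r' s.2.1 s.2.2
  choose q u hq hu h1 h2 using step
  obtain ⟨p₀⟩ := AInfTransformation.exists_zero g h (-1)
  obtain ⟨v₀⟩ := AInfTransformation.exists_zero f h (-2)
  let s : ∀ n, {s : AInfTransformation g h (-1) × AInfTransformation f h (-2) //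
      VanishesBelow s.1.bracket.comp n ∧ VanishesBelow (defect r r' s.1 s.2).comp n} := fun n =>
    -- Any starting pair will do: there are no words of length less than 0.
    Nat.rec ⟨(p₀, v₀), fun _ _ _ hw => absurd hw (Nat.not_lt_zero _),
      fun _ _ _ hw => absurd hw (Nat.not_lt_zero _)⟩
      (fun n s => ⟨(s.1.1.add (q n s), s.1.2.add (u n s)), h1 n s, h2 n s⟩) n
  obtain ⟨p, hp⟩ := AInfTransformation.exists_limit (s := fun n => (s n).1.1)
    fun n => ⟨q n (s n), hq n _, rfl⟩
  obtain ⟨v, hv⟩ := AInfTransformation.exists_limit (s := fun n => (s n).1.2)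
    fun n => ⟨u n (s n), hu n _, rfl⟩
  -- The limit differs from stage `n` by a transformation vanishing below `n`, so it inherits the
  -- vanishing of the errors below `n`, for every `n`.
  have hbr : p.bracket.map = 0 := AInfTransformation.eq_zero fun n => by
    obtain ⟨q, hq, e⟩ := hp n
    rw [e]
    exact (s n).2.1.bracket_add hq
  have hdef : (defect r r' p v).map = 0 := AInfTransformation.eq_zero fun n => by
    obtain ⟨q, hq, e⟩ := hp n
    obtain ⟨u, hu, e'⟩ := hv n
    rw [e, e']
    exact (s n).2.2.defect_add r hq hu
  exact exists_equivalent_of_eq_zero r r' p v hbr hdef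

end
end AInf

open AInf

theorem mainTheorem9 {k : Type u} [CommRing k] {S S' : Type u}
    (B : AInfCategory k S) (C : AInfCategory k S') {φ : S → S'} (f : AInfFunctor B C φ)
    (γ : S → S') (r₀ : ∀ X : S, C.quiver.Hom (φ X) (γ X))
    (hr₀_degree : ∀ X, r₀ X ∈ C.quiver.gr (φ X) (γ X) 0)
    (hr₀_cycle : ∀ X, C.b1 (φ X) (γ X) (C.quiver.shift (φ X) (γ X) (r₀ X)) = 0)
    (hu : ∀ (X Y X₀ Xₙ : S) (p : ObjPath S X₀ Xₙ),
      HomQuasiIso B C p (leftMul C (C.quiver.shift (φ X) (γ X) (r₀ X)) (γ Y)))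
    (g g' : AInfFunctor B C γ) (r : NatTransformation f g) (r' : NatTransformation f g')
    (hr : ∀ X, r.zeroComponent X = C.quiver.shift (φ X) (γ X) (r₀ X))
    (hr' : ∀ X, r'.zeroComponent X = C.quiver.shift (φ X) (γ X) (r₀ X)) :
    ∃ p : NatTransformation g g', Equivalent f g' r'.map (r.comp p) :=
  exists_factorization r (fun X => by rw [hr]; exact hr₀_cycle X)
    (fun X Y P => by rw [hr]; exact hu X Y X Y P) r'
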